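/- Let $N,p$ be integers with $p>2N>4$. For a bounded real sequence $v=(v_n)_{n\in\mathbb Z}$ with norm $\|v\|=\sup_n|v_n|$ let $H^0=H^0(v)$ be the (zero magnetic field, $b=0$) tight-binding Hamiltonian of the armchair nanotube: the bounded self-adjoint operator on $\ell^2(\mathbb Z\times\{0,1\}\times\mathbb Z/N\mathbb Z)$ given by $$(H^0f)_{n,0,k}=f_{n+1,1,k}+f_{n-1,1,k-1}+f_{n,1,k}+v_{2n}f_{n,0,k},$$ $$(H^0f)_{n,1,k}=f_{n+1,0,k+1}+f_{n-1,0,k}+f_{n,0,k}+v_{2n+1}f_{n,1,k}.$$ For a real $p$-periodic sequence $q$ let $(J(q)f)_n=f_{n-1}+f_{n+1}+q_nf_n$, let $z_0^+<z_1^-\le z_1^+<z_2^-\le z_2^+<\dots<z_p^-$ be the eigenvalues, counted with multiplicity, of $J(q)$ acting on $2p$-periodic sequences, and let $\gamma_n=\gamma_n(q)=(z_n^-,z_n^+)$, $1\le n\le p-1$, be the gaps of $J(q)$ (empty if $z_n^-=z_n^+$). Put $\hat e_n=p^{-1}(e^{2\pi i nj/p})_{j=0}^{p-1}$ and let $\Xi_p\subset\mathbb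 R^p$ be the set of vectors $\sum_{0\le n\le p/2}\alpha_n(\hat e_n+\hat e_{p-n})$ with real $\alpha_n$ such that $\alpha_n\ne0$ for $1\le n\le p/2$. Set $$r_\pm=2\cos\Bigl(\frac\pi3\mp\frac1{2N}\mp\frac1{6p}\Bigr)-1,\qquad \tilde r_-=1+2\cos\Bigl(\frac\pi{2N}+\frac1{6p}\Bigr),\qquad \tilde r_+=1+2\cos\frac1{6p}.$$ **(i)** There is $\delta>0$, depending only on $N$ and $p$, such that for every $v$ with $v_{2n}=v_{2n+1}$ and $v_{n+2p}=v_n$ for all $n\in\mathbb Z$ and with $\|v\|<\delta$, the following holds, where $\gamma_n=\gamma_n(v^{ev})$ are the gaps of $J(v^{ev})$, $v^{ev}=(v_{2n})_n$, and $1\le n\le p-1$ throughout. - $\sigma(H^0)\cap[r_-,r_+]=A_1\cup A_2$, where $$A_1=[r_-,r_+]\setminus\bigcup_{|n-\frac p3|\le\frac p{2N}}(\gamma_n+1),\qquad A_2=[r_-,r_+]\setminus\bigcup_{|n-\frac{2p}3|\le\frac p{2N}}(\gamma_n-1),$$ and $A_1$ and $A_2$ contribute spectral multiplicity $2$ each;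 that is, the spectrum of $H^0$ has multiplicity $2$ on the symmetric difference $A_1\triangle A_2$ and multiplicity $4$ on $A_1\cap A_2$. - $$\sigma(H^0)\cap[-\tilde r_+,-\tilde r_-]=[-\tilde r_+,-\tilde r_-]\setminus\bigcup_{1\le n\le\frac p{2N}+\frac1{6\pi}}(\gamma_n-1),$$ $$\sigma(H^0)\cap[\tilde r_-,\tilde r_+]=[\tilde r_-,\tilde r_+]\setminus\bigcup_{p-\frac p{2N}-\frac1{6\pi}\le n\le p-1}(\gamma_n+1),$$ and the spectrum of $H^0$ has multiplicity $2$ on each of these two sets. Here the spectrum of a bounded self-adjoint operator $A$ has multiplicity $m$ on a Borel set $S\subset\mathbb R$ if the part of $A$ in the range of the spectral projection $\mathbf 1_S(A)$ is unitarily equivalent to multiplication by $x$ in $L^2(\nu;\mathbb C^m)$ for some finite Borel measure $\nu$ carried by $S$. **(ii)** If $v_{2n}=v_{2n+1}$ and $v_{n+2p}=v_n$ for all $n\in\mathbb Z$, and $(v_{2n})_{n=1}^p\in\Xi_p$, then there is $t_0>0$ such that for all $0<t<t_0$ every gap $\gamma_n(t\,v^{ev})$, $1\le n\le p-1$, of $J(t\,v^{ev})$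 is open ($z_n^-<z_n^+$); in particular all the gaps that appear in (i) for the potential $tv$ are open. -/

import Mathlib

open MeasureTheory
open scoped ENNReal

noncomputable section

namespace Armchair

/-! ## Operators on square-summable sequences -/

/-- `ℓ²(ι)`, complex-valued. -/
abbrev L2 (ι : Type) : Type := lp (fun _ : ι => ℂ) 2

/-- Bounded real sequences `v = (vₙ)`, `n ∈ ℤ`, with the norm `‖v‖ = sup |vₙ|`. -/
abbrev Potential : Type := lp (fun _ : ℤ => ℝ) ∞

theorem memlp_comp {ι : Type} (σ : ι ≃ ι) (f : L2 ι) :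
    Memℓp (fun i => f (σ i)) 2 := by
  have hf := (memℓp_gen_iff (p := 2) (by norm_num)).1 (lp.memℓp f)
  exact (memℓp_gen_iff (p := 2) (by norm_num)).2 (σ.summable_iff.2 hf)

theorem lp_norm_sq {ι : Type} (f : L2 ι) : ‖f‖ ^ 2 = ∑' i, ‖f i‖ ^ 2 := by
  have h := lp.norm_rpow_eq_tsum (p := 2) (by norm_num) f
  simpa using h

/-- The bounded operator `(S f) i = f (σ i)` on `ℓ²(ι)` for a permutation `σ` of `ι`. -/
def permOp {ι : Type} (σ : ι ≃ ι) : L2 ι →L[ℂ] L2 ι :=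
  LinearMap.mkContinuous
    { toFun := fun f => ⟨fun i => f (σ i), memlp_comp σ f⟩
      map_add' := fun _ _ => rfl
      map_smul' := fun _ _ => rfl } 1 (by
    intro f
    rw [one_mul]
    refine abs_le_of_sq_le_sq' ?_ (norm_nonneg _) |>.2
    rw [lp_norm_sq, lp_norm_sq]
    exact le_of_eq (σ.tsum_eq (fun i => ‖f i‖ ^ 2)))

theorem permOp_apply {ι : Type} (σ : ι ≃ ι) (f : L2 ι) (i : ι) : permOp σ f i = f (σ i) := rfl

theorem norm_mul_le {ι : Type} (v : Potential) (c : ι → ℤ) (f : L2 ι) (i : ι) :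
    ‖(v (c i) : ℂ) * f i‖ ≤ ‖v‖ * ‖f i‖ := by
  rw [norm_mul, Complex.norm_real]
  exact mul_le_mul_of_nonneg_right (lp.norm_apply_le_norm (by simp) v (c i)) (norm_nonneg _)

theorem memlp_mul {ι : Type} (v : Potential) (c : ι → ℤ) (f : L2 ι) :
    Memℓp (fun i => (v (c i) : ℂ) * f i) 2 := by
  have hf := (memℓp_gen_iff (p := 2) (by norm_num)).1 (lp.memℓp f)
  refine (memℓp_gen_iff (p := 2) (by norm_num)).2 ?_
  refine Summable.of_nonneg_of_le (fun i => by positivity) (fun i => ?_)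
    (hf.mul_left (‖v‖ ^ (2 : ℝ≥0∞).toReal))
  rw [← Real.mul_rpow (norm_nonneg _) (norm_nonneg _)]
  exact Real.rpow_le_rpow (norm_nonneg _) (norm_mul_le v c f i) (by simp)

/-- The bounded multiplication operator `(V f) i = v (c i) f i` on `ℓ²(ι)`. -/
def mulOp {ι : Type} (v : Potential) (c : ι → ℤ) : L2 ι →L[ℂ] L2 ι :=
  LinearMap.mkContinuous
    { toFun := fun f => ⟨fun i => (v (c i) : ℂ) * f i, memlp_mul v c f⟩
      map_add' := fun f g => by
        ext i
        exact mul_add _ _ _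
      map_smul' := fun a f => by
        ext i
        exact mul_left_comm _ _ _ } ‖v‖ (by
    intro f
    refine abs_le_of_sq_le_sq' ?_ (by positivity) |>.2
    have hf := (memℓp_gen_iff (p := 2) (by norm_num)).1 (lp.memℓp f)
    have hg := (memℓp_gen_iff (p := 2) (by norm_num)).1 (memlp_mul v c f)
    simp only [ENNReal.toReal_ofNat, Real.rpow_ofNat] at hf hg
    rw [mul_pow, lp_norm_sq, lp_norm_sq, ← tsum_mul_left]
    refine Summable.tsum_le_tsum (fun i => ?_) hg (hf.mul_left _)
    rw [← mul_pow]
    exact pow_le_pow_left₀ (norm_nonneg _) (norm_mul_le v c f i) 2)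

theorem mulOp_apply {ι : Type} (v : Potential) (c : ι → ℤ) (f : L2 ι) (i : ι) :
    mulOp v c f i = (v (c i) : ℂ) * f i := rfl

/-! ## The armchair nanotube without magnetic field -/

/-- The vertices `(n, j, k) ∈ ℤ × {0, 1} × ℤ/N` of the armchair nanotube. -/
abbrev Vertex (N : ℕ) : Type := ℤ × Fin 2 × ZMod N

/-- First bond: `(n, 0, k) ↔ (n + 1, 1, k)`. -/
def bondA (N : ℕ) : Vertex N → Vertex N
  | (n, 0, k) => (n + 1, 1, k)
  | (n, 1, k) => (n - 1, 0, k)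

/-- Second bond: `(n, 0, k) ↔ (n - 1, 1, k - 1)`. -/
def bondB (N : ℕ) : Vertex N → Vertex N
  | (n, 0, k) => (n - 1, 1, k - 1)
  | (n, 1, k) => (n + 1, 0, k + 1)

/-- Third bond: `(n, 0, k) ↔ (n, 1, k)`. -/
def bondC (N : ℕ) : Vertex N → Vertex N
  | (n, 0, k) => (n, 1, k)
  | (n, 1, k) => (n, 0, k)

theorem bondA_involutive (N : ℕ) : Function.Involutive (bondA N) := by
  rintro ⟨n, j, k⟩
  fin_cases j <;> simp [bondA]

theorem bondB_involutive (N : ℕ) : Function.Involutive (bondB N) := by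
  rintro ⟨n, j, k⟩
  fin_cases j <;> simp [bondB]

theorem bondC_involutive (N : ℕ) : Function.Involutive (bondC N) := by
  rintro ⟨n, j, k⟩
  fin_cases j <;> simp [bondC]

/-- The index of the potential at a vertex: `V_{n,0,k} = v_{2n}`, `V_{n,1,k} = v_{2n+1}`. -/
def site (N : ℕ) : Vertex N → ℤ
  | (n, 0, _) => 2 * n
  | (n, 1, _) => 2 * n + 1

/-- The tight-binding Hamiltonian `H⁰ = H⁰₀ + V` on `ℓ²` of the armchair nanotube with zero
magnetic field and potential `v`; see `hamiltonian_apply_zero`, `hamiltonian_apply_one`. -/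
def hamiltonian (N : ℕ) (v : Potential) : L2 (Vertex N) →L[ℂ] L2 (Vertex N) :=
  permOp (bondA_involutive N).toPerm + permOp (bondB_involutive N).toPerm +
    permOp (bondC_involutive N).toPerm + mulOp v (site N)

theorem hamiltonian_apply_zero (N : ℕ) (v : Potential) (f : L2 (Vertex N)) (n : ℤ) (k : ZMod N) :
    hamiltonian N v f (n, 0, k) =
      f (n + 1, 1, k) + f (n - 1, 1, k - 1) + f (n, 1, k) + (v (2 * n) : ℂ) * f (n, 0, k) := rfl

theorem hamiltonian_apply_one (N : ℕ) (v : Potential) (f : L2 (Vertex N)) (n : ℤ) (k : ZMod N) :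
    hamiltonian N v f (n, 1, k) =
      f (n - 1, 0, k) + f (n + 1, 0, k + 1) + f (n, 0, k) +
        (v (2 * n + 1) : ℂ) * f (n, 1, k) := rfl

/-! ## Spectral multiplicity of a bounded self-adjoint operator -/

section Multiplicity

variable {E : Type} [NormedAddCommGroup E] [InnerProductSpace ℂ E] [CompleteSpace E]

/-- `μ` is the spectral measure of the bounded self-adjoint operator `A` at the vector `f`: the
finite measure on the (compact) spectrum of `A` with moments `∫ xⁿ dμ = ⟨f, Aⁿ f⟩`. -/
def IsSpectralMeasure (A : E →L[ℂ] E) (f : E) (μ : Measure ℝ) : Prop :=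
  IsFiniteMeasure μ ∧ μ (spectrum ℝ A)ᶜ = 0 ∧
    ∀ n : ℕ, ((∫ x, x ^ n ∂μ : ℝ) : ℂ) = inner ℂ f ((A ^ n) f)

/-- The spectral subspace of `A` for a Borel set `S ⊆ ℝ` (the range of the spectral projection
`1_S(A)`): the vectors whose spectral measure is carried by `S`. -/
def spectralSubspace (A : E →L[ℂ] E) (S : Set ℝ) : Set E :=
  {f | ∃ μ : Measure ℝ, IsSpectralMeasure A f μ ∧ μ Sᶜ = 0}

/-- The spectrum of the bounded self-adjoint operator `A` on the Borel set `S` has (uniform)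
multiplicity `m`: the part of `A` in the spectral subspace of `S` is unitarily equivalent to
multiplication by `x` in `L²(ν; ℂᵐ)` for some measure `ν` carried by `S`. -/
def HasMultiplicity (A : E →L[ℂ] E) (S : Set ℝ) (m : ℕ) : Prop :=
  ∃ ν : Measure ℝ, IsFiniteMeasure ν ∧ ν Sᶜ = 0 ∧
    ∃ U : Lp (EuclideanSpace ℂ (Fin m)) 2 ν →ₗᵢ[ℂ] E,
      Set.range U = spectralSubspace A S ∧
      ∀ g : Lp (EuclideanSpace ℂ (Fin m)) 2 ν, ∃ h : Lp (EuclideanSpace ℂ (Fin m)) 2 ν,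
        (h =ᵐ[ν] fun x => (x : ℂ) • g x) ∧ A (U g) = U h

end Multiplicity

/-! ## Gaps of the periodic Schrödinger operator -/

/-- The matrix of `(J f)_n = f_{n-1} + f_{n+1} + q_n f_n`, with `q` of period `p`, acting on the
sequences of period `2p` (given by their values at `0, …, 2p - 1`). -/
def periodicMatrix (p : ℕ) (q : ℤ → ℝ) : Matrix (Fin (2 * p)) (Fin (2 * p)) ℝ :=
  fun i j =>
    (if ((i : ℕ) + 1) % (2 * p) = j then 1 else 0) +
      (if ((j : ℕ) + 1) % (2 * p) = i then 1 else 0) +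
      (if i = j then q (i : ℕ) else 0)

theorem periodicMatrix_isHermitian (p : ℕ) (q : ℤ → ℝ) : (periodicMatrix p q).IsHermitian := by
  ext i j
  simp only [Matrix.conjTranspose_apply, star_trivial, periodicMatrix]
  by_cases h : i = j
  · subst h
    rfl
  · rw [if_neg h, if_neg (Ne.symm h)]
    ring

/-- The `2p`-periodic eigenvalues `λ₀ ≤ λ₁ ≤ … ≤ λ_{2p-1}` of `J(q)`, counted with multiplicity
(`eigenvalues₀` lists them in decreasing order). The value for `j ≥ 2p` is irrelevant. -/
def periodicEigenvalue (p : ℕ) (q : ℤ → ℝ) (j : ℕ) : ℝ :=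
  if h : j < 2 * p then
    (periodicMatrix_isHermitian p q).eigenvalues₀
      ⟨2 * p - 1 - j, by rw [Fintype.card_fin]; omega⟩
  else 0

/-- `z_n^-`, `1 ≤ n ≤ p`, where the `2p`-periodic eigenvalues in increasing order are
`z_0^+ < z_1^- ≤ z_1^+ < z_2^- ≤ z_2^+ < … < z_p^-`. -/
def zMinus (p : ℕ) (q : ℤ → ℝ) (n : ℕ) : ℝ := periodicEigenvalue p q (2 * n - 1)

/-- `z_n^+`, `0 ≤ n ≤ p - 1`. -/
def zPlus (p : ℕ) (q : ℤ → ℝ) (n : ℕ) : ℝ := periodicEigenvalue p q (2 * n)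

/-- The `n`-th gap `γ_n = (z_n^-, z_n^+)`, `1 ≤ n ≤ p - 1`, of `J(q)`; empty if degenerate. -/
def gap (p : ℕ) (q : ℤ → ℝ) (n : ℕ) : Set ℝ := Set.Ioo (zMinus p q n) (zPlus p q n)

/-- The shifted gap `γ_n + c`. -/
def shiftedGap (p : ℕ) (q : ℤ → ℝ) (c : ℝ) (n : ℕ) : Set ℝ := (fun x => x + c) '' gap p q n

/-- The `p`-periodic potential `v^ev = (v_{2n})`. -/
def evenPart (v : Potential) : ℤ → ℝ := fun n => v (2 * n)

/-- The vector `ê_n = p⁻¹ (τ_n^{2j})_{j=0}^{p-1}` with `τ_n = e^{iπn/p}`. -/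
def eHat (p n : ℕ) : Fin p → ℂ := fun j =>
  (p : ℂ)⁻¹ * Complex.exp (Complex.I * Real.pi * n / p) ^ (2 * (j : ℕ))

/-- The set `Ξ_p ⊆ ℝᵖ` of the vectors `∑_{n ≤ p/2} α_n (ê_n + ê_{p-n})` with real coefficients,
`α_n ≠ 0` for `1 ≤ n ≤ p/2`. The coefficient `α_0` of the constant vector, which only translates
the spectrum, is unrestricted (it may vanish or not). -/
def Xi (p : ℕ) : Set (Fin p → ℝ) :=
  {u | ∃ α : ℕ → ℝ, (∀ n, 1 ≤ n → 2 * n ≤ p → α n ≠ 0) ∧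
    ∀ j, (u j : ℂ) =
      ∑ n ∈ Finset.range (p / 2 + 1), (α n : ℂ) * (eHat p n j + eHat p (p - n) j)}

/-- The vector `(v_{2n})_{n=1}^p ∈ ℝᵖ`. -/
def evenVector (p : ℕ) (v : Potential) : Fin p → ℝ := fun j => v (2 * ((j : ℕ) + 1))

/-! ## The spectral windows -/

/-- `r_+ = 2 cos (π/3 - 1/(2N) - 1/(6p)) - 1`. -/
def rPlus (N p : ℕ) : ℝ := 2 * Real.cos (Real.pi / 3 - 1 / (2 * N) - 1 / (6 * p)) - 1

/-- `r_- = 2 cos (π/3 + 1/(2N) + 1/(6p)) - 1`. -/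
def rMinus (N p : ℕ) : ℝ := 2 * Real.cos (Real.pi / 3 + 1 / (2 * N) + 1 / (6 * p)) - 1

/-- `r̃_+ = 1 + 2 cos (1/(6p))`. -/
def rTildePlus (p : ℕ) : ℝ := 1 + 2 * Real.cos (1 / (6 * p))

/-- `r̃_- = 1 + 2 cos (π/(2N) + 1/(6p))`. -/
def rTildeMinus (N p : ℕ) : ℝ := 1 + 2 * Real.cos (Real.pi / (2 * N) + 1 / (6 * p))

/-- `[r_-, r_+]` without the gaps `γ_n + 1`, `|n - p/3| ≤ p/(2N)`. -/
def centerFirst (N p : ℕ) (q : ℤ → ℝ) : Set ℝ :=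
  Set.Icc (rMinus N p) (rPlus N p) \
    ⋃ n ∈ {n : ℕ | 1 ≤ n ∧ n ≤ p - 1 ∧ |(n : ℝ) - p / 3| ≤ p / (2 * N)}, shiftedGap p q 1 n

/-- `[r_-, r_+]` without the gaps `γ_n - 1`, `|n - 2p/3| ≤ p/(2N)`. -/
def centerSecond (N p : ℕ) (q : ℤ → ℝ) : Set ℝ :=
  Set.Icc (rMinus N p) (rPlus N p) \
    ⋃ n ∈ {n : ℕ | 1 ≤ n ∧ n ≤ p - 1 ∧ |(n : ℝ) - 2 * p / 3| ≤ p / (2 * N)},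
      shiftedGap p q (-1) n

/-- `[-r̃_+, -r̃_-]` without the gaps `γ_n - 1`, `1 ≤ n ≤ p/(2N) + 1/(6π)`. -/
def edgeLower (N p : ℕ) (q : ℤ → ℝ) : Set ℝ :=
  Set.Icc (-rTildePlus p) (-rTildeMinus N p) \
    ⋃ n ∈ {n : ℕ | 1 ≤ n ∧ n ≤ p - 1 ∧ (n : ℝ) ≤ p / (2 * N) + 1 / (6 * Real.pi)},
      shiftedGap p q (-1) n

/-- `[r̃_-, r̃_+]` without the gaps `γ_n + 1`, `p - p/(2N) - 1/(6π) ≤ n ≤ p - 1`. -/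
def edgeUpper (N p : ℕ) (q : ℤ → ℝ) : Set ℝ :=
  Set.Icc (rTildeMinus N p) (rTildePlus p) \
    ⋃ n ∈ {n : ℕ | 1 ≤ n ∧ n ≤ p - 1 ∧ (p : ℝ) - p / (2 * N) - 1 / (6 * Real.pi) ≤ n},
      shiftedGap p q 1 n

end Armchair

end

/-! Since `v (2n) = v (2n + 1)`, the potential depends on `n` only. Sequences constant in `k` with
signs `σ ^ (n + j)`, `σ = ±1`, form two invariant subspaces: the first two families of bonds
preserve the sign and the third multiplies it by `σ`, so `H⁰` acts there as `J(v^ev) + σ`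
(`hamiltonian_lift`). The orthogonal complement of the two consists of the sequences with zero mean
in `k`, and `armchairModel` records the splitting.

The zero-mean part stays out of all windows. With the hoppings `A`, `B`, `C` along the bonds, the
closing of a hexagon gives `2 Re ⟨Cf, (A + B)f⟩ = Re ⟨(C + ACB)f, (A + B)f⟩`, and `C + ACB` adds
neighbours in the cyclic variable, so a discrete Wirtinger inequality bounds it by `2 cos (π/N)`.
Hence the free zero-mean operator satisfies `sin (π/N) ‖f‖ ≤ ‖H f‖ ≤ √(5 + 4 cos (π/N)) ‖f‖`
(`free_bounds`). The central window lies inside the lower bound and the outer windows outside the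
upper one, with room for a small `v`. The outer windows moreover meet only one of `J + 1`, `J - 1`.

The multiplicity of `J` comes from an explicit diagonalization. Let `Δ` be the discriminant. The
eigenvalues of the `2p`-periodic problem are the roots of `Δ² - 4` with multiplicity
(`prod_periodicEigenvalue`), so the spectrum is `Δ² ≤ 4`, and each band is mapped by `Δ` bijectively
onto `(-2, 2)`. On the bands there is a definite quadratic form on initial values, invariant under
the monodromy; completing the square in it yields real generalized eigenvectors with values in `ℂ²`.
They are orthonormal in `L²` of the bands: taking `Δ` as the variable and summing over bands reduces
this to Lagrange interpolation and Chebyshev orthogonality (`integral_kernel`). They are complete by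
a moment argument (`span_blochLp_orthogonal`). So `J` is multiplication by `x` in `L²(bands; ℂ²)`,
and the windows see one or two such copies (`hasMultiplicity_two`, `hasMultiplicity_four`).

To see which gaps enter a window, Weyl's inequality compares the gap edges with the free nodes `-2
cos (π n / p)`. Trigonometric estimates keep the nodes not listed strictly outside the window;
finitely many strict inequalities leave a common margin, and `δ` is the least margin.

For the opening of the gaps: if the `n`-th gap of `J(t q)` is closed for arbitrarily small `t`,
every solution at its edge is `2p`-periodic. Pairing one of them with a free wave `g` by Abel
summation and letting `t → 0` kills a Fourier coefficient of `q`; the unknown shift of the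
eigenvalue drops out because `∑ g² = 0`. On `Ξ_p` these coefficients are nonzero multiples of the
`α_m`. -/

noncomputable section

namespace Armchair

open Polynomial

/-! ## Three-term recurrences on `ℤ` -/

section Recurrence

variable {R : Type} [CommRing R]

/-- `u` solves `u (n + 1) + u (n - 1) = c n * u n`. -/
def IsSol (c u : ℤ → R) : Prop := ∀ n, u (n + 1) + u (n - 1) = c n * u n

/-- The recurrence runs in both directions, so an identity between solutions need only be checked at
two neighbouring sites. The identities for shifted solutions below are proved in this way. -/
theorem IsSol.ext {c u v : ℤ → R} (hu : IsSol c u) (hv : IsSol c v) (m : ℤ)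
    (h0 : u m = v m) (h1 : u (m + 1) = v (m + 1)) : u = v := by
  have key : ∀ k : ℤ, u (m + k) = v (m + k) ∧ u (m + k + 1) = v (m + k + 1) := by
    intro k
    induction k using Int.induction_on with
    | zero => simpa using ⟨h0, h1⟩
    | succ i ih =>
      have a := hu (m + i + 1)
      have b := hv (m + i + 1)
      rw [add_sub_cancel_right] at a b
      refine ⟨by rw [← add_assoc]; exact ih.2, ?_⟩
      rw [← add_assoc]
      rw [ih.1, ih.2, ← b] at a
      exact add_right_cancel a
    | pred i ih =>
      have a := hu (m + -i)
      have b := hv (m + -i)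
      have e : m + (-(i : ℤ) - 1) = m + -i - 1 := by ring
      rw [e, sub_add_cancel]
      rw [ih.1, ih.2, ← b] at a
      exact ⟨add_left_cancel a, ih.1⟩
  funext n
  have := (key (n - m)).1
  rwa [add_sub_cancel] at this

theorem IsSol.add {c u v : ℤ → R} (hu : IsSol c u) (hv : IsSol c v) :
    IsSol c (fun n => u n + v n) := fun n => by
  linear_combination hu n + hv n

theorem IsSol.sub {c u v : ℤ → R} (hu : IsSol c u) (hv : IsSol c v) :
    IsSol c (fun n => u n - v n) := fun n => by
  linear_combination hu n - hv n

theorem IsSol.const_mul {c u : ℤ → R} (hu : IsSol c u) (r : R) :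
    IsSol c (fun n => r * u n) := fun n => by
  linear_combination r * hu n

theorem IsSol.shift {c u : ℤ → R} (hu : IsSol c u) {l : ℤ} (hc : ∀ n, c (n + l) = c n) :
    IsSol c (fun n => u (n + l)) := fun n => by
  have h := hu (n + l)
  rw [hc] at h
  rw [← h]
  congr 2 <;> ring_nf

/-- The pairs `(u n, u (n + 1))`, `n ≥ 0`, of a solution. -/
def solPair (c : ℤ → R) (a b : R) : ℕ → R × R
  | 0 => (a, b)
  | n + 1 => ((solPair c a b n).2, c (n + 1) * (solPair c a b n).2 - (solPair c a b n).1)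

/-- The solution with prescribed values `a`, `b` at `0`, `1`. -/
def sol (c : ℤ → R) (a b : R) (n : ℤ) : R :=
  -- To the left the recurrence is run after the reflection `n ↦ 1 - n`, which exchanges the sites
  -- `0` and `1`; hence the order `b a` and the coefficients `c (1 - k)`.
  if 0 ≤ n then (solPair c a b n.toNat).1 else (solPair (fun k => c (1 - k)) b a (1 - n).toNat).1

theorem sol_zero (c : ℤ → R) (a b : R) : sol c a b 0 = a := by simp [sol, solPair]

theorem sol_one (c : ℤ → R) (a b : R) : sol c a b 1 = b := by simp [sol, solPair]

theorem sol_natCast (c : ℤ → R) (a b : R) (n : ℕ) : sol c a b n = (solPair c a b n).1 := by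
  simp [sol]

theorem sol_neg (c : ℤ → R) (a b : R) (n : ℕ) :
    sol c a b (1 - n) = (solPair (fun k => c (1 - k)) b a n).1 := by
  rcases n with _ | _ | n
  · simp [sol, solPair]
  · simp [sol, solPair]
  · have : ¬ (0 : ℤ) ≤ 1 - ((n + 1 + 1 : ℕ) : ℤ) := by push_cast; omega
    rw [sol, if_neg this, sub_sub_cancel, Int.toNat_natCast]

theorem isSol_sol (c : ℤ → R) (a b : R) : IsSol c (sol c a b) := by
  intro n
  rcases lt_or_ge 0 n with h | h
  · obtain ⟨k, rfl⟩ : ∃ k : ℕ, n = k + 1 := ⟨(n - 1).toNat, by omega⟩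
    have e1 : ((k : ℤ) + 1 + 1) = ((k + 2 : ℕ) : ℤ) := by push_cast; ring
    have e2 : ((k : ℤ) + 1) = ((k + 1 : ℕ) : ℤ) := by push_cast; ring
    rw [add_sub_cancel_right, e1, e2, sol_natCast, sol_natCast, sol_natCast]
    simp [solPair]
  · obtain ⟨k, rfl⟩ : ∃ k : ℕ, n = 1 - ((k + 1 : ℕ) : ℤ) := ⟨(-n).toNat, by omega⟩
    have e1 : 1 - ((k + 1 : ℕ) : ℤ) + 1 = 1 - (k : ℤ) := by push_cast; ring
    have e2 : 1 - ((k + 1 : ℕ) : ℤ) - 1 = 1 - ((k + 2 : ℕ) : ℤ) := by push_cast; ring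
    rw [e1, e2, sol_neg, sol_neg, sol_neg]
    simp [solPair]

theorem IsSol.map {S : Type} [CommRing S] (f : R →+* S) {c u : ℤ → R} (hu : IsSol c u) :
    IsSol (fun n => f (c n)) (fun n => f (u n)) := fun n => by
  simp only [← map_add, ← map_mul, hu n]

/-- The Wronskian of two solutions is constant. -/
theorem IsSol.wronskian {c u v : ℤ → R} (hu : IsSol c u) (hv : IsSol c v) (n : ℤ) :
    u n * v (n + 1) - v n * u (n + 1) = u 0 * v 1 - v 0 * u 1 := by
  have step : ∀ n, u (n + 1) * v (n + 1 + 1) - v (n + 1) * u (n + 1 + 1) =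
      u n * v (n + 1) - v n * u (n + 1) := by
    intro n
    have a := hu (n + 1)
    have b := hv (n + 1)
    rw [add_sub_cancel_right] at a b
    linear_combination u (n + 1) * b - v (n + 1) * a
  induction n using Int.induction_on with
  | zero => simp
  | succ i ih => rw [step, ih]
  | pred i ih =>
    have := step (-(i : ℤ) - 1)
    rw [sub_add_cancel] at this
    rw [sub_add_cancel, ← this, ih]

end Recurrence

/-! ## The discriminant of a periodic Schrödinger operator -/

/-- The coefficients `X - q n` of the recurrence `J u = X u`. -/
def jCoeff (q : ℤ → ℝ) (n : ℤ) : ℝ[X] := X - C (q n)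

/-- The solution with initial values `(1, 0)`. -/
def theta (q : ℤ → ℝ) : ℤ → ℝ[X] := sol (jCoeff q) 1 0

/-- The solution with initial values `(0, 1)`. -/
def phi (q : ℤ → ℝ) : ℤ → ℝ[X] := sol (jCoeff q) 0 1

theorem isSol_theta (q : ℤ → ℝ) : IsSol (jCoeff q) (theta q) := isSol_sol _ _ _

theorem isSol_phi (q : ℤ → ℝ) : IsSol (jCoeff q) (phi q) := isSol_sol _ _ _

@[simp] theorem theta_zero (q : ℤ → ℝ) : theta q 0 = 1 := sol_zero _ _ _
@[simp] theorem theta_one (q : ℤ → ℝ) : theta q 1 = 0 := sol_one _ _ _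
@[simp] theorem phi_zero (q : ℤ → ℝ) : phi q 0 = 0 := sol_zero _ _ _
@[simp] theorem phi_one (q : ℤ → ℝ) : phi q 1 = 1 := sol_one _ _ _

theorem theta_phi_wronskian (q : ℤ → ℝ) (n : ℤ) :
    theta q n * phi q (n + 1) - phi q n * theta q (n + 1) = 1 := by
  rw [(isSol_theta q).wronskian (isSol_phi q)]
  simp

/-- The discriminant (trace of the monodromy matrix). -/
def discr (p : ℕ) (q : ℤ → ℝ) : ℝ[X] := theta q p + phi q (p + 1)

/-- `n ↦ green q m n` is the solution with values `0`, `1` at `m`, `m + 1`. -/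
def green (q : ℤ → ℝ) (m n : ℤ) : ℝ[X] := theta q m * phi q n - phi q m * theta q n

theorem isSol_green (q : ℤ → ℝ) (m : ℤ) : IsSol (jCoeff q) (green q m) :=
  ((isSol_phi q).const_mul _).sub ((isSol_theta q).const_mul _)

@[simp] theorem green_self (q : ℤ → ℝ) (m : ℤ) : green q m m = 0 := by
  simp [green, mul_comm]

@[simp] theorem green_succ (q : ℤ → ℝ) (m : ℤ) : green q m (m + 1) = 1 :=
  theta_phi_wronskian q m

theorem green_swap (q : ℤ → ℝ) (m n : ℤ) : green q n m = -green q m n := by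
  simp only [green]; ring

/-! ### Monodromy over one period -/

section Periodic

variable {p : ℕ} {q : ℤ → ℝ} (hq : ∀ n, q (n + p) = q n)
include hq

theorem jCoeff_add_period (n : ℤ) : jCoeff q (n + p) = jCoeff q n := by
  simp [jCoeff, hq]

theorem green_add_period (m n : ℤ) : green q (m + p) (n + p) = green q m n := by
  have h := (isSol_green q (m + p)).shift (jCoeff_add_period hq)
  refine congrFun (h.ext (isSol_green q m) m ?_ ?_) n
  · simp
  · rw [show m + 1 + (p : ℤ) = m + p + 1 by ring]
    simp

theorem theta_add_period (n : ℤ) :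
    theta q (n + p) = theta q p * theta q n + theta q (p + 1) * phi q n := by
  have h := (isSol_theta q).shift (jCoeff_add_period hq)
  refine congrFun (h.ext (((isSol_theta q).const_mul _).add ((isSol_phi q).const_mul _)) 0 ?_ ?_) n
  · simp
  · simp [add_comm]

theorem phi_add_period (n : ℤ) :
    phi q (n + p) = phi q p * theta q n + phi q (p + 1) * phi q n := by
  have h := (isSol_phi q).shift (jCoeff_add_period hq)
  refine congrFun (h.ext (((isSol_theta q).const_mul _).add ((isSol_phi q).const_mul _)) 0 ?_ ?_) n
  · simp
  · simp [add_comm]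

theorem theta_sub_period (n : ℤ) :
    theta q (n - p) = phi q (p + 1) * theta q n - theta q (p + 1) * phi q n := by
  have h1 := theta_add_period hq (n - p)
  have h2 := phi_add_period hq (n - p)
  have w := theta_phi_wronskian q p
  rw [sub_add_cancel] at h1 h2
  rw [h1, h2]
  linear_combination -theta q (n - p) * w

theorem phi_sub_period (n : ℤ) :
    phi q (n - p) = -phi q p * theta q n + theta q p * phi q n := by
  have h1 := theta_add_period hq (n - p)
  have h2 := phi_add_period hq (n - p)
  have w := theta_phi_wronskian q p
  rw [sub_add_cancel] at h1 h2
  rw [h1, h2]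
  linear_combination -phi q (n - p) * w

/-- Cayley–Hamilton for the monodromy matrix `M`: its determinant is `1` by the Wronskian, so `M +
M⁻¹` is the trace. -/
theorem green_cayley_hamilton (m n : ℤ) :
    green q m (n + p) + green q m (n - p) = discr p q * green q m n := by
  simp only [green, discr, theta_add_period hq, phi_add_period hq, theta_sub_period hq,
    phi_sub_period hq]
  ring

end Periodic

/-- The quadratic form (in the initial values of solutions) invariant under the monodromy. -/
def formKernel (p : ℕ) (q : ℤ → ℝ) (m n : ℤ) : ℝ[X] :=
  phi q p * (theta q m * theta q n) +
    C 2⁻¹ * (phi q (p + 1) - theta q p) * (theta q m * phi q n + phi q m * theta q n) -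
    theta q (p + 1) * (phi q m * phi q n)

theorem C_half_mul_two : (C (2⁻¹ : ℝ)) * 2 = (1 : ℝ[X]) := by
  rw [← C_ofNat (R := ℝ), ← C_mul]; norm_num

/-- Gram identity for a binary quadratic form: by the Wronskian the form has determinant `1 - Δ²/4`,
and `green q m n` is the area spanned by the vectors `(theta, phi)` at `m` and `n`. So the form is
definite where `|Δ| < 2`. -/
theorem formKernel_det (p : ℕ) (q : ℤ → ℝ) (m n : ℤ) :
    4 * (formKernel p q m m * formKernel p q n n - formKernel p q m n ^ 2) =
      (4 - discr p q ^ 2) * green q m n ^ 2 := by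
  have w := theta_phi_wronskian q p
  have h := C_half_mul_two
  simp only [formKernel, green, discr]
  set a := theta q p
  set b := phi q p
  set c := theta q (p + 1)
  set d := phi q (p + 1)
  have h' : (4 : ℝ[X]) * (C 2⁻¹ * C 2⁻¹) = 1 := by linear_combination (C 2⁻¹ * 2 + 1) * h
  linear_combination (-(d - a) ^ 2 * (theta q m * phi q n - phi q m * theta q n) ^ 2) * h' + 
    4 * (theta q m * phi q n - phi q m * theta q n) ^ 2 * w

/-! ### Periodic identities for the invariant form -/

section Periodic

variable {p : ℕ} {q : ℤ → ℝ} (hq : ∀ n, q (n + p) = q n)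
include hq

/-- The form is the Wronskian pairing with `(M - M⁻¹) / 2`, `M` the monodromy. Through this
description it inherits the Cayley–Hamilton recurrence. -/
theorem two_mul_formKernel (m n : ℤ) :
    2 * formKernel p q m n = green q m (n + p) - green q m (n - p) := by
  have h := C_half_mul_two
  simp only [green, formKernel, theta_add_period hq, phi_add_period hq, theta_sub_period hq,
    phi_sub_period hq]
  linear_combination ((phi q (p + 1) - theta q p) * (theta q m * phi q n + phi q m * theta q n)) * h

theorem formKernel_self (m : ℤ) : formKernel p q m m = green q m (m + p) := by
  have h := two_mul_formKernel hq m m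
  have h2 := green_add_period hq (m - p) m
  rw [sub_add_cancel] at h2
  rw [green_swap q (m - p) m, ← h2] at h
  have : (2 : ℝ[X]) ≠ 0 := two_ne_zero
  refine mul_left_cancel₀ this ?_
  rw [h]; ring

/-- As functions of `l` both sides solve `u (l + 1) + u (l - 1) = Δ u l`. The gain is the separation
into polynomials in `x` independent of `l` and functions of `Δ` alone, which is what summing over
the fibres of `Δ` requires. -/
theorem formKernel_chebyshev (m r l : ℤ) :
    formKernel p q m (m + r + l * p) =
      green q m (m + r) * (Chebyshev.T ℝ (l + 1)).comp (C 2⁻¹ * discr p q) +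
        green q (m + r) (m + p) * (Chebyshev.T ℝ l).comp (C 2⁻¹ * discr p q) := by
  have hh := C_half_mul_two
  have h2 : (2 : ℝ[X]) ≠ 0 := two_ne_zero
  have ch := fun n => green_cayley_hamilton hq m n
  have hβ : green q m (m + r - p) = - green q (m + r) (m + p) := by
    have := green_add_period hq m (m + r - p)
    rw [sub_add_cancel] at this
    rw [← this, green_swap]
  have hrec : IsSol (fun _ => discr p q) (fun l => formKernel p q m (m + r + l * p)) := by
    intro l
    refine mul_left_cancel₀ h2 ?_
    have e1 := two_mul_formKernel hq m (m + r + (l + 1) * p)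
    have e2 := two_mul_formKernel hq m (m + r + (l - 1) * p)
    have e3 := two_mul_formKernel hq m (m + r + l * p)
    have c1 := ch (m + r + (l + 1) * p)
    have c2 := ch (m + r + (l - 1) * p)
    have i1 : m + r + (l + 1) * p - p = m + r + l * p := by ring
    have i2 : m + r + (l - 1) * p + p = m + r + l * p := by ring
    have i3 : m + r + (l + 1) * p = m + r + l * p + p := by ring
    have i4 : m + r + (l - 1) * p = m + r + l * p - p := by ring
    rw [i1] at e1 c1
    rw [i2] at e2 c2
    rw [i3] at e1 c1
    rw [i4] at e2 c2
    beta_reduce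
    rw [i3, i4]
    linear_combination e1 + e2 - discr p q * e3 + c1 - c2
  have hrec' : IsSol (fun _ => discr p q) (fun l =>
      green q m (m + r) * (Chebyshev.T ℝ (l + 1)).comp (C 2⁻¹ * discr p q) +
        green q (m + r) (m + p) * (Chebyshev.T ℝ l).comp (C 2⁻¹ * discr p q)) := by
    have t : ∀ k : ℤ, (Chebyshev.T ℝ (k + 1)).comp (C 2⁻¹ * discr p q) +
        (Chebyshev.T ℝ (k - 1)).comp (C 2⁻¹ * discr p q) =
        discr p q * (Chebyshev.T ℝ k).comp (C 2⁻¹ * discr p q) := by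
      intro k
      have := congrArg (fun P => P.comp (C 2⁻¹ * discr p q)) (Chebyshev.T_add_one ℝ k)
      simp only [sub_comp, mul_comp, X_comp, ofNat_comp] at this
      linear_combination this + (discr p q * (Chebyshev.T ℝ k).comp (C 2⁻¹ * discr p q)) * hh
    intro l
    have t1 := t (l + 1)
    have t2 := t l
    rw [add_sub_cancel_right] at t1
    have e : l - 1 + 1 = l := by ring
    simp only [e]
    linear_combination green q m (m + r) * t1 + green q (m + r) (m + p) * t2
  have h0 := two_mul_formKernel hq m (m + r)
  have hm1 := two_mul_formKernel hq m (m + r - p)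
  have c0 := ch (m + r)
  have c1 := ch (m + r - p)
  rw [sub_add_cancel] at hm1 c1
  -- Comparison at `l = -1, 0`, where only `T₀` and `T₁ = T₋₁` occur.
  refine congrFun (hrec.ext hrec' (-1) ?_ ?_) l
  · refine mul_left_cancel₀ h2 ?_
    have e : m + r + (-1) * (p : ℤ) = m + r - p := by ring
    simp only [e]
    simp only [Int.reduceNeg, neg_add_cancel, Chebyshev.T_zero, one_comp, mul_one,
      Chebyshev.T_neg, Chebyshev.T_one, X_comp]
    rw [hβ] at c1
    linear_combination hm1 - c1 - (green q (m + r) (m + p) * discr p q) * hh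
  · refine mul_left_cancel₀ h2 ?_
    simp only [Int.reduceNeg, neg_add_cancel, zero_mul, add_zero, zero_add, Chebyshev.T_zero,
      one_comp, mul_one, Chebyshev.T_one, X_comp]
    rw [hβ] at h0 c0
    linear_combination h0 + c0 - (green q m (m + r) * discr p q) * hh

end Periodic

/-! ### Degrees -/

/-- The first claim is a strict bound on `degree`, not on `natDegree`, so that it also covers the
zero polynomial `green q m m` at `j = 0`. -/
theorem green_degree (q : ℤ → ℝ) (m : ℤ) (j : ℕ) :
    (green q m (m + j)).degree < (j : ℕ) ∧
      (green q m (m + j + 1)).Monic ∧ (green q m (m + j + 1)).natDegree = j := by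
  induction j with
  | zero => simp
  | succ j ih =>
    obtain ⟨h1, h2, h3⟩ := ih
    have e := isSol_green q m (m + j + 1)
    rw [add_sub_cancel_right] at e
    have e' : green q m (m + j + 1 + 1) =
        jCoeff q (m + j + 1) * green q m (m + j + 1) - green q m (m + j) := by
      rw [← e]; ring
    have d1 : (green q m (m + j + 1)).degree = j := by
      rw [degree_eq_natDegree h2.ne_zero, h3]
    have mm : (jCoeff q (m + j + 1) * green q m (m + j + 1)).Monic :=
      (monic_X_sub_C _).mul h2
    have dd : (jCoeff q (m + j + 1) * green q m (m + j + 1)).degree = (j + 1 : ℕ) := by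
      rw [degree_mul, d1, jCoeff, degree_X_sub_C]
      push_cast; ring
    have lt : (green q m (m + j)).degree <
        (jCoeff q (m + j + 1) * green q m (m + j + 1)).degree := by
      rw [dd]
      exact h1.trans (by exact_mod_cast Nat.lt_succ_self j)
    refine ⟨?_, ?_, ?_⟩
    · push_cast
      rw [← add_assoc, d1]
      exact_mod_cast Nat.lt_succ_self j
    · push_cast
      rw [← add_assoc, e']
      exact mm.sub_of_left lt
    · push_cast
      rw [← add_assoc, e']
      refine natDegree_eq_of_degree_eq_some ?_
      rw [degree_sub_eq_left_of_degree_lt lt, dd]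

theorem phi_eq_green (q : ℤ → ℝ) (n : ℤ) : phi q n = green q 0 n := by simp [green]

theorem theta_eq_green (q : ℤ → ℝ) (n : ℤ) : theta q n = -green q 1 n := by simp [green]

theorem discr_monic_natDegree {p : ℕ} (hp : 0 < p) (q : ℤ → ℝ) :
    (discr p q).Monic ∧ (discr p q).natDegree = p := by
  have h1 := (green_degree q 1 (p - 1)).1
  obtain ⟨-, h2, h3⟩ := green_degree q 0 p
  have e : (1 : ℤ) + ((p - 1 : ℕ) : ℤ) = p := by omega
  rw [e] at h1
  rw [zero_add, ← phi_eq_green] at h2 h3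
  have lt : (theta q p).degree < (phi q (p + 1)).degree := by
    rw [theta_eq_green, degree_neg, degree_eq_natDegree h2.ne_zero, h3]
    exact h1.trans_le (by exact_mod_cast Nat.sub_le p 1)
  refine ⟨h2.add_of_right lt, ?_⟩
  rw [discr, natDegree_eq_of_degree_eq (degree_add_eq_right_of_degree_lt lt), h3]

/-! ### The derivative of the discriminant -/

/-- Variation of constants: differentiating the recurrence in the spectral variable adds the source
`u`, and `green q j` is the response to a unit source at `j`. -/
theorem derivative_sol_natCast (q : ℤ → ℝ) {u : ℤ → ℝ[X]} (hu : IsSol (jCoeff q) u)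
    (h0 : derivative (u 0) = 0) (h1 : derivative (u 1) = 0) (n : ℕ) :
    derivative (u n) = ∑ j ∈ Finset.Icc 1 n, green q j n * u j := by
  have key : ∀ n : ℕ, derivative (u n) = ∑ j ∈ Finset.Icc 1 n, green q j n * u j ∧
      derivative (u (n + 1)) = ∑ j ∈ Finset.Icc 1 (n + 1), green q j (n + 1) * u j := by
    intro n
    induction n with
    | zero => simp [h0, h1]
    | succ n ih =>
      refine ⟨by push_cast; exact ih.2, ?_⟩
      have e := congrArg derivative (hu (n + 1))
      have d : derivative (jCoeff q (n + 1)) = 1 := by simp [jCoeff]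
      rw [add_sub_cancel_right, derivative_add, derivative_mul, d, ih.1, ih.2, one_mul] at e
      push_cast
      rw [Finset.sum_Icc_succ_top (by omega)]
      push_cast
      rw [green_self, zero_mul, add_zero]
      rw [Finset.sum_Icc_succ_top (by omega)] at e ⊢
      push_cast at e ⊢
      rw [green_self, zero_mul, add_zero] at e
      rw [green_succ, one_mul]
      have : ∑ j ∈ Finset.Icc 1 n, green q j (n + 1 + 1) * u j =
          jCoeff q (n + 1) * ∑ j ∈ Finset.Icc 1 n, green q j (n + 1) * u j -
            ∑ j ∈ Finset.Icc 1 n, green q j n * u j := by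
        rw [Finset.mul_sum, ← Finset.sum_sub_distrib]
        refine Finset.sum_congr rfl fun j _ => ?_
        have := isSol_green q j (n + 1)
        rw [add_sub_cancel_right] at this
        linear_combination u j * this
      rw [this]
      linear_combination e
  exact (key n).1

/-- This ties `Δ'` to the invariant form: where the form is definite the summands have one sign, so
`Δ'` cannot vanish and dominates each of them. -/
theorem derivative_discr (p : ℕ) (q : ℤ → ℝ) :
    derivative (discr p q) = ∑ j ∈ Finset.Icc 1 p, formKernel p q j j := by
  have h1 := derivative_sol_natCast q (isSol_theta q) (by simp) (by simp) p
  have h2 := derivative_sol_natCast q (isSol_phi q) (by simp) (by simp) (p + 1)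
  rw [Finset.sum_Icc_succ_top (by omega)] at h2
  push_cast at h2
  rw [green_self, zero_mul, add_zero] at h2
  rw [discr, derivative_add, h1, h2, ← Finset.sum_add_distrib]
  refine Finset.sum_congr rfl fun j _ => ?_
  simp only [green, formKernel]
  linear_combination (-(phi q (p + 1) - theta q p) * (theta q j * phi q j)) * C_half_mul_two

end Armchair
end


noncomputable section

set_option linter.unusedSectionVars false

namespace Armchair

open Polynomial

/-! ## Periodic eigenvalues and the discriminant -/

theorem periodicEigenvalue_of_lt (p : ℕ) (q : ℤ → ℝ) (j : Fin (2 * p)) :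
    periodicEigenvalue p q j = (periodicMatrix_isHermitian p q).eigenvalues₀
      (Fin.cast (Fintype.card_fin _).symm j.rev) := by
  rw [periodicEigenvalue, dif_pos j.2]
  congr 1
  ext
  simp [Fin.rev]
  omega

theorem periodicEigenvalue_mono (p : ℕ) (q : ℤ → ℝ) {i j : ℕ} (hij : i ≤ j) (hj : j < 2 * p) :
    periodicEigenvalue p q i ≤ periodicEigenvalue p q j := by
  rw [periodicEigenvalue_of_lt p q ⟨i, hij.trans_lt hj⟩, periodicEigenvalue_of_lt p q ⟨j, hj⟩]
  apply (periodicMatrix_isHermitian p q).eigenvalues₀_antitone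
  simp only [Fin.le_def, Fin.val_cast, Fin.val_rev]
  omega

/-- Orthonormal eigenvectors of the periodic matrix, in increasing order of the eigenvalues. -/
theorem exists_sorted_eigenbasis (p : ℕ) (q : ℤ → ℝ) :
    ∃ b : OrthonormalBasis (Fin (2 * p)) ℝ (EuclideanSpace ℝ (Fin (2 * p))), ∀ j,
      Matrix.mulVec (periodicMatrix p q) (b j) = periodicEigenvalue p q j • ⇑(b j) := by
  set h := periodicMatrix_isHermitian p q
  refine ⟨h.eigenvectorBasis.reindex ((Fintype.equivOfCardEq (Fintype.card_fin _)).symm.trans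
    ((finCongr (Fintype.card_fin _)).trans Fin.revPerm)), fun j => ?_⟩
  rw [OrthonormalBasis.reindex_apply, h.mulVec_eigenvectorBasis, periodicEigenvalue_of_lt]
  congr 1
  rw [Matrix.IsHermitian.eigenvalues]
  congr 1
  simp

/-- The residue of an integer modulo `2 p`. -/
def residue (p : ℕ) [NeZero p] (n : ℤ) : Fin (2 * p) :=
  ⟨(n % (2 * p : ℕ)).toNat, by
    have h : (0 : ℤ) < (2 * p : ℕ) := by have := NeZero.pos p; omega
    have := Int.emod_lt_of_pos n h
    have := Int.emod_nonneg n h.ne'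
    omega⟩

section

variable {p : ℕ} [NeZero p]

theorem residue_val (n : ℤ) : ((residue p n : ℕ) : ℤ) = n % (2 * p : ℕ) := by
  have h : (0 : ℤ) < (2 * p : ℕ) := by have := NeZero.pos p; omega
  exact Int.toNat_of_nonneg (Int.emod_nonneg n h.ne')

theorem residue_eq_iff (n m : ℤ) :
    residue p n = residue p m ↔ n % (2 * p : ℕ) = m % (2 * p : ℕ) := by
  rw [← residue_val, ← residue_val, Fin.ext_iff, Nat.cast_inj]

theorem residue_natCast (i : Fin (2 * p)) : residue p (i : ℕ) = i := by
  apply Fin.ext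
  have := residue_val (p := p) (i : ℕ)
  rw [Int.emod_eq_of_lt (by positivity) (by exact_mod_cast i.2)] at this
  exact_mod_cast this

theorem residue_add_period (n : ℤ) : residue p (n + (2 * p : ℕ)) = residue p n := by
  rw [residue_eq_iff, Int.add_emod_right]

theorem residue_succ_iff (n : ℤ) (j : Fin (2 * p)) :
    ((residue p n : ℕ) + 1) % (2 * p) = j ↔ j = residue p (n + 1) := by
  rw [← Nat.cast_inj (R := ℤ), Int.natCast_mod, Nat.cast_add, residue_val, ← residue_natCast j,
    residue_eq_iff, residue_natCast]
  rw [Nat.cast_one, Int.emod_add_emod, Int.emod_eq_of_lt (a := ((j : ℕ) : ℤ)) (by positivity)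
    (by exact_mod_cast j.2)]
  exact eq_comm

theorem residue_pred_iff (n : ℤ) (j : Fin (2 * p)) :
    ((j : ℕ) + 1) % (2 * p) = residue p n ↔ j = residue p (n - 1) := by
  rw [← residue_natCast j, residue_succ_iff, residue_eq_iff, residue_eq_iff]
  constructor
  · intro h
    have := Int.ModEq.sub_right 1 (show n ≡ _ [ZMOD _] from h)
    rw [add_sub_cancel_right] at this
    exact this.symm
  · intro h
    have := Int.ModEq.add_right 1 (show _ ≡ n - 1 [ZMOD _] from h)
    rw [sub_add_cancel] at this
    exact this.symm

theorem periodicMatrix_mulVec {q : ℤ → ℝ} (hq : ∀ n, q (n + p) = q n) (x : Fin (2 * p) → ℝ)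
    (n : ℤ) :
    Matrix.mulVec (periodicMatrix p q) x (residue p n) =
      x (residue p (n + 1)) + x (residue p (n - 1)) + q n * x (residue p n) := by
  have hq2 : q ((residue p n : ℕ) : ℤ) = q n := by
    rw [residue_val]
    have hz : ∀ k : ℤ, q (n + k * p) = q n := by
      intro k
      induction k using Int.induction_on with
      | zero => simp
      | succ i ih => rw [← ih, ← hq (n + i * p)]; congr 1; ring
      | pred i ih => rw [← ih, ← hq]; congr 1; ring
    rw [← hz (-(2 * (n / (2 * p : ℕ))))]
    congr 1
    have := Int.emod_def n (2 * p : ℕ)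
    rw [this]; push_cast; ring
  simp only [Matrix.mulVec, dotProduct, periodicMatrix, residue_succ_iff, residue_pred_iff,
    eq_comm (a := residue p n), add_mul, ite_mul, one_mul, zero_mul, Finset.sum_add_distrib,
    Finset.sum_ite_eq', Finset.mem_univ, if_true, hq2]

end

/-- The `2p`-periodic solutions of `J u = z u`. -/
def periodicSol (p : ℕ) (q : ℤ → ℝ) (z : ℝ) : Submodule ℝ (ℤ → ℝ) where
  carrier := {u | IsSol (fun n => z - q n) u ∧ ∀ n, u (n + (2 * p : ℕ)) = u n}
  add_mem' := fun {u v} hu hv => ⟨hu.1.add hv.1, fun n => by simp only [Pi.add_apply, hu.2, hv.2]⟩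
  zero_mem' := ⟨fun n => by simp, fun n => rfl⟩
  smul_mem' := fun r u hu => ⟨hu.1.const_mul r, fun n => by simp only [Pi.smul_apply, hu.2]⟩

/-- The initial values of a periodic solution. -/
def initialValues (p : ℕ) (q : ℤ → ℝ) (z : ℝ) : periodicSol p q z →ₗ[ℝ] ℝ × ℝ where
  toFun u := ((u : ℤ → ℝ) 0, (u : ℤ → ℝ) 1)
  map_add' _ _ := rfl
  map_smul' _ _ := rfl

theorem initialValues_injective (p : ℕ) (q : ℤ → ℝ) (z : ℝ) :
    Function.Injective (initialValues p q z) := by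
  intro u v h
  have h0 := congrArg Prod.fst h
  have h1 := congrArg Prod.snd h
  exact Subtype.ext (u.2.1.ext v.2.1 0 h0 h1)

instance (p : ℕ) (q : ℤ → ℝ) (z : ℝ) : FiniteDimensional ℝ (periodicSol p q z) :=
  Module.Finite.of_injective _ (initialValues_injective p q z)

theorem finrank_periodicSol_le (p : ℕ) (q : ℤ → ℝ) (z : ℝ) :
    Module.finrank ℝ (periodicSol p q z) ≤ 2 := by
  have := LinearMap.finrank_le_finrank_of_injective (initialValues_injective p q z)
  simpa using this

theorem isSol_eval (q : ℤ → ℝ) (z : ℝ) {u : ℤ → ℝ[X]} (hu : IsSol (jCoeff q) u) :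
    IsSol (fun n => z - q n) (fun n => (u n).eval z) := by
  have := hu.map (evalRingHom z)
  simpa [jCoeff] using this

theorem IsSol.eq_combination {q : ℤ → ℝ} {z : ℝ} {u : ℤ → ℝ} (hu : IsSol (fun n => z - q n) u)
    (n : ℤ) : u n = u 0 * (theta q n).eval z + u 1 * (phi q n).eval z := by
  refine congrFun (hu.ext (((isSol_eval q z (isSol_theta q)).const_mul (u 0)).add
    ((isSol_eval q z (isSol_phi q)).const_mul (u 1))) 0 ?_ ?_) n <;> simp

/-! ### Periodic eigenvalues as the roots of `discr ^ 2 - 4` -/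

section Discr

variable {p : ℕ} [NeZero p] {q : ℤ → ℝ} (hq : ∀ n, q (n + p) = q n)
include hq

/-- Distinct members of the orthonormal eigenbasis, unrolled to `2p`-periodic sequences, remain
independent. Multiplicities of eigenvalues can thus be read off from a solution space of dimension
at most two. -/
theorem finrank_periodicSol_ge {z : ℝ} {k : ℕ} (e : Fin k → Fin (2 * p))
    (he : Function.Injective e) (hz : ∀ i, periodicEigenvalue p q (e i) = z) :
    k ≤ Module.finrank ℝ (periodicSol p q z) := by
  obtain ⟨b, hb⟩ := exists_sorted_eigenbasis p q
  have mem : ∀ i, (fun n => b (e i) (residue p n)) ∈ periodicSol p q z := by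
    intro i
    refine ⟨fun n => ?_, fun n => by simp only [residue_add_period]⟩
    have := periodicMatrix_mulVec hq (b (e i)) n
    rw [hb, hz, Pi.smul_apply, smul_eq_mul] at this
    linear_combination -this
  have li : LinearIndependent ℝ (fun i => (⟨_, mem i⟩ : periodicSol p q z)) := by
    have := (b.orthonormal.linearIndependent.comp e he)
    rw [Fintype.linearIndependent_iff] at this ⊢
    intro g hg i
    refine this g ?_ i
    ext j
    have h := congrFun (congrArg Subtype.val hg) (j : ℕ)
    simp only [Submodule.coe_sum, Submodule.coe_smul, Finset.sum_apply, Pi.smul_apply,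
      residue_natCast] at h
    simpa using h
  simpa using li.fintype_card_le_finrank

/-- Three equal eigenvalues would give a three-dimensional space of solutions of a second-order
recurrence. -/
theorem periodicEigenvalue_lt_add_two {j : ℕ} (hj : j + 2 < 2 * p) :
    periodicEigenvalue p q j < periodicEigenvalue p q (j + 2) := by
  by_contra! h
  have h1 := periodicEigenvalue_mono p q (show j ≤ j + 1 by omega) (by omega)
  have h2 := periodicEigenvalue_mono p q (show j + 1 ≤ j + 2 by omega) hj
  have := finrank_periodicSol_ge hq (z := periodicEigenvalue p q j)
    (fun i : Fin 3 => ⟨j + i, by omega⟩) (fun a b hab => by simpa [Fin.ext_iff] using hab) (by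
      intro i
      fin_cases i
      · rfl
      · exact le_antisymm (h2.trans h) h1
      · exact le_antisymm h (h1.trans h2))
  have := finrank_periodicSol_le p q (periodicEigenvalue p q j)
  omega

theorem IsSol.discr_mul {z : ℝ} {u : ℤ → ℝ} (hu : IsSol (fun n => z - q n) u) (n : ℤ) :
    u (n + p) + u (n - p) = (discr p q).eval z * u n := by
  have h := fun k => congrArg (eval z) (green_cayley_hamilton hq k n)
  have h0 := h 0
  have h1 := h 1
  simp only [eval_add, eval_mul, ← phi_eq_green] at h0
  simp only [green, theta_one, phi_one, zero_mul, zero_sub, one_mul, eval_add, eval_neg,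
    eval_mul] at h1
  rw [hu.eq_combination (n + p), hu.eq_combination (n - p), hu.eq_combination n]
  linear_combination u 1 * h0 - u 0 * h1

/-- For a `2p`-periodic solution the values at `n + p` and `n - p` agree up to the centre, so
Cayley–Hamilton at `n + p` collapses to one term. Using it twice gives `Δ² = 4`. -/
theorem periodicSol_discr_mul {z : ℝ} {u : ℤ → ℝ} (hu : u ∈ periodicSol p q z) (n : ℤ) :
    2 * u n = (discr p q).eval z * u (n + p) := by
  have h := IsSol.discr_mul hq hu.1 (n + p)
  have h2 := hu.2 n
  rw [show n + ((2 * p : ℕ) : ℤ) = n + p + p by push_cast; ring] at h2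
  rw [add_sub_cancel_right, h2] at h
  linear_combination h

theorem discr_sq_eq_of_periodicSol {z : ℝ} (h : 1 ≤ Module.finrank ℝ (periodicSol p q z)) :
    (discr p q).eval z ^ 2 = 4 := by
  obtain ⟨u, hu⟩ := Module.finrank_pos_iff_exists_ne_zero.1 (show 0 < _ from h)
  obtain ⟨n, hn⟩ : ∃ n, (u : ℤ → ℝ) n ≠ 0 := by
    by_contra! h
    exact hu (Subtype.ext (funext h))
  have h1 := periodicSol_discr_mul hq u.2 n
  have h2 := periodicSol_discr_mul hq u.2 (n + p)
  have h3 := u.2.2 n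
  rw [show n + ((2 * p : ℕ) : ℤ) = n + p + p by push_cast; ring] at h3
  rw [h3] at h2
  refine mul_right_cancel₀ hn ?_
  linear_combination -2 * h1 - (discr p q).eval z * h2

theorem mem_periodicSol_of_finrank {z : ℝ} (h : 2 ≤ Module.finrank ℝ (periodicSol p q z))
    {u : ℤ → ℝ} (hu : IsSol (fun n => z - q n) u) : u ∈ periodicSol p q z := by
  have e : Module.finrank ℝ (periodicSol p q z) = Module.finrank ℝ (ℝ × ℝ) := by
    simpa using le_antisymm (finrank_periodicSol_le p q z) h
  obtain ⟨v, hv⟩ := (LinearMap.injective_iff_surjective_of_finrank_eq_finrank e).1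
    (initialValues_injective p q z) (u 0, u 1)
  have : u = v := hu.ext v.2.1 0 (congrArg Prod.fst hv).symm (congrArg Prod.snd hv).symm
  rw [this]
  exact v.2

/-- If all solutions are `2p`-periodic then so is `green q j`; it vanishes at `j`, hence at `j + p`,
and those values are the summands of `Δ'`. -/
theorem derivative_discr_eq_zero_of_finrank {z : ℝ}
    (h : 2 ≤ Module.finrank ℝ (periodicSol p q z)) : (derivative (discr p q)).eval z = 0 := by
  have d := discr_sq_eq_of_periodicSol hq (by omega : 1 ≤ Module.finrank ℝ (periodicSol p q z))
  rw [derivative_discr, eval_finsetSum]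
  refine Finset.sum_eq_zero fun j _ => ?_
  rw [formKernel_self hq]
  have := periodicSol_discr_mul hq
    (mem_periodicSol_of_finrank hq h (isSol_eval q z (isSol_green q j))) j
  simp only [green_self, eval_zero, mul_zero] at this
  rcases mul_eq_zero.1 this.symm with h0 | h0
  · rw [h0] at d; norm_num at d
  · exact h0

theorem discr_sq_sub_monic_natDegree :
    (discr p q ^ 2 - 4).Monic ∧ (discr p q ^ 2 - 4).natDegree = 2 * p := by
  obtain ⟨h1, h2⟩ := discr_monic_natDegree (NeZero.pos p) q
  have m : (discr p q ^ 2).Monic := h1.pow 2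
  have d : (discr p q ^ 2).natDegree = 2 * p := by rw [h1.natDegree_pow, h2]
  have hp := NeZero.pos p
  have lt : (4 : ℝ[X]).degree < (discr p q ^ 2).degree := by
    rw [degree_eq_natDegree m.ne_zero, d]
    refine (degree_C_le (a := (4 : ℝ))).trans_lt ?_
    exact_mod_cast (by omega : 0 < 2 * p)
  refine ⟨m.sub_of_left lt, ?_⟩
  rw [natDegree_eq_of_degree_eq (degree_sub_eq_left_of_degree_lt lt), d]

/-- Both sides are monic of degree `2p`, so divisibility suffices. An eigenvalue occurs at most
twice; one occurrence makes it a root of `Δ² - 4`, two occurrences also force `Δ' = 0` and hence a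
double root. -/
theorem prod_periodicEigenvalue :
    ∏ j ∈ Finset.range (2 * p), (X - C (periodicEigenvalue p q j)) = discr p q ^ 2 - 4 := by
  obtain ⟨h1, h2⟩ := discr_sq_sub_monic_natDegree (p := p) hq
  rw [Finset.prod_range]
  symm
  set m : Multiset ℝ := Finset.univ.val.map (fun j : Fin (2 * p) => periodicEigenvalue p q j)
  have hm : ∏ j : Fin (2 * p), (X - C (periodicEigenvalue p q j)) =
      (m.map (fun a => X - C a)).prod := by
    rw [Multiset.map_map]; rfl
  have mon : (∏ j : Fin (2 * p), (X - C (periodicEigenvalue p q j))).Monic :=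
    monic_prod_of_monic _ _ fun j _ => monic_X_sub_C _
  refine eq_of_monic_of_dvd_of_natDegree_le mon h1 ?_ ?_
  · rw [hm, Multiset.prod_X_sub_C_dvd_iff_le_roots h1.ne_zero, Multiset.le_iff_count]
    intro c
    rw [count_roots, Multiset.count_map]
    set s := Finset.univ.filter (fun j : Fin (2 * p) => c = periodicEigenvalue p q j)
    change s.card ≤ _
    have key := finrank_periodicSol_ge hq (z := c) (fun i : Fin s.card => s.equivFin.symm i)
      (fun a b hab => by simpa using hab)
      (fun i => (Finset.mem_filter.1 (s.equivFin.symm i).2).2.symm)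
    have le2 := finrank_periodicSol_le p q c
    have root : 1 ≤ s.card → (discr p q ^ 2 - 4).IsRoot c := by
      intro h
      rw [IsRoot.def, eval_sub, eval_pow, discr_sq_eq_of_periodicSol hq (h.trans key)]
      simp
    rcases Nat.lt_or_ge s.card 1 with h | h
    · omega
    · rcases Nat.lt_or_ge s.card 2 with h' | h'
      · have := (rootMultiplicity_pos h1.ne_zero).2 (root h)
        omega
      · have := (one_lt_rootMultiplicity_iff_isRoot h1.ne_zero).2 ⟨root h, by
          rw [IsRoot.def]
          have := derivative_discr_eq_zero_of_finrank hq (h'.trans key)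
          simp [derivative_pow, this]⟩
        omega
  · rw [h2, natDegree_prod_of_monic _ _ fun j _ => monic_X_sub_C _]
    simp

theorem discr_sq_sub_eval (x : ℝ) :
    (discr p q).eval x ^ 2 - 4 = ∏ j ∈ Finset.range (2 * p), (x - periodicEigenvalue p q j) := by
  have := congrArg (eval x) (prod_periodicEigenvalue hq)
  rw [eval_prod] at this
  simpa using this.symm

end Discr

/-- The Laguerre inequality for real-rooted polynomials. -/
theorem laguerre_inequality {P : ℝ[X]} (hP : P.Splits) (x : ℝ) :
    P.eval x * (derivative (derivative P)).eval x ≤ (derivative P).eval x ^ 2 := by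
  have key : ∀ m : Multiset ℝ, (m.map (fun a => X - C a)).prod.eval x *
      (derivative (derivative (m.map (fun a => X - C a)).prod)).eval x ≤
        (derivative (m.map (fun a => X - C a)).prod).eval x ^ 2 := by
    intro m
    induction m using Multiset.induction_on with
    | empty => simp
    | cons a m ih =>
      rw [Multiset.map_cons, Multiset.prod_cons]
      set R := (m.map (fun a => X - C a)).prod
      simp only [derivative_mul, derivative_sub, derivative_X, derivative_C, sub_zero, one_mul,
        derivative_add, eval_add, eval_mul, eval_sub, eval_X, eval_C]
      -- After cancellation the inequality for `(X - a) R` is `(x - a)²` times the one for `R`, with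
      -- the square `R(x)²` to spare.
      nlinarith [mul_le_mul_of_nonneg_left ih (sq_nonneg (x - a)), sq_nonneg (R.eval x)]
  rw [hP.eq_prod_roots]
  have := key P.roots
  simp only [derivative_C_mul, eval_mul, eval_C]
  nlinarith [mul_le_mul_of_nonneg_left this (sq_nonneg P.leadingCoeff)]

/-! ### Bands and gaps -/

theorem prod_sub_pos {M m : ℕ} (hm : m ≤ M) (l : ℕ → ℝ) (x : ℝ) (h1 : ∀ j < m, l j < x)
    (h2 : ∀ j, m ≤ j → j < M → x < l j) :
    0 < (-1) ^ (M - m) * ∏ j ∈ Finset.range M, (x - l j) := by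
  rw [← Finset.prod_range_mul_prod_Ico _ hm, mul_left_comm]
  refine mul_pos (Finset.prod_pos fun j hj => sub_pos.2 (h1 j (Finset.mem_range.1 hj))) ?_
  have : ∏ j ∈ Finset.Ico m M, (x - l j) = (-1) ^ (M - m) * ∏ j ∈ Finset.Ico m M, (l j - x) := by
    rw [← Nat.card_Ico, ← Finset.prod_const, ← Finset.prod_mul_distrib]
    exact Finset.prod_congr rfl fun j _ => by ring
  rw [this, ← mul_assoc, ← mul_pow]
  simp only [mul_neg, mul_one, neg_neg, one_pow, one_mul]
  exact Finset.prod_pos fun j hj => sub_pos.2 (h2 j (Finset.mem_Ico.1 hj).1 (Finset.mem_Ico.1 hj).2)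

section Bands

variable {p : ℕ} [NeZero p] {q : ℤ → ℝ} (hq : ∀ n, q (n + p) = q n)
include hq

/-- Sign count in the factorization of `Δ² - 4`: an odd number of eigenvalues lies to the right of a
point in a band. In a gap, or outside the hull, the number is even. -/
theorem discr_sq_lt_of_mem_band {n : ℕ} (hn : n < p) {x : ℝ}
    (hx : x ∈ Set.Ioo (zPlus p q n) (zMinus p q (n + 1))) : (discr p q).eval x ^ 2 < 4 := by
  have := prod_sub_pos (show 2 * n + 1 ≤ 2 * p by omega) (periodicEigenvalue p q) x
    (fun j hj => (periodicEigenvalue_mono p q (show j ≤ 2 * n by omega) (by omega)).trans_lt hx.1)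
    (fun j hj hj' => hx.2.trans_le
      (periodicEigenvalue_mono p q (show 2 * (n + 1) - 1 ≤ j by omega) hj'))
  rw [← discr_sq_sub_eval hq, Odd.neg_one_pow (by rw [Nat.odd_iff]; omega)] at this
  linarith

theorem discr_sq_zPlus {n : ℕ} (hn : n < p) : (discr p q).eval (zPlus p q n) ^ 2 = 4 := by
  have := discr_sq_sub_eval hq (zPlus p q n)
  rw [Finset.prod_eq_zero (Finset.mem_range.2 (show 2 * n < 2 * p by omega)) (sub_self _)] at this
  linarith

theorem discr_sq_zMinus {n : ℕ} (hn : n < p) : (discr p q).eval (zMinus p q (n + 1)) ^ 2 = 4 := by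
  have := discr_sq_sub_eval hq (zMinus p q (n + 1))
  rw [Finset.prod_eq_zero (Finset.mem_range.2 (show 2 * (n + 1) - 1 < 2 * p by omega))
    (sub_self _)] at this
  linarith

theorem discr_sq_le_of_mem_band {n : ℕ} (hn : n < p) {x : ℝ}
    (hx : x ∈ Set.Icc (zPlus p q n) (zMinus p q (n + 1))) : (discr p q).eval x ^ 2 ≤ 4 := by
  rcases hx.1.eq_or_lt with rfl | h1
  · exact (discr_sq_zPlus hq hn).le
  · rcases hx.2.eq_or_lt with rfl | h2
    · exact (discr_sq_zMinus hq hn).le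
    · exact (discr_sq_lt_of_mem_band hq hn ⟨h1, h2⟩).le

theorem discr_sq_gt_of_mem_gap {n : ℕ} (hn : 1 ≤ n) (hn' : n ≤ p - 1) {x : ℝ}
    (hx : x ∈ gap p q n) : 4 < (discr p q).eval x ^ 2 := by
  have := prod_sub_pos (show 2 * n ≤ 2 * p by omega) (periodicEigenvalue p q) x
    (fun j hj => (periodicEigenvalue_mono p q (show j ≤ 2 * n - 1 by omega)
      (by omega)).trans_lt hx.1)
    (fun j hj hj' => hx.2.trans_le (periodicEigenvalue_mono p q hj hj'))
  rw [← discr_sq_sub_eval hq, Even.neg_one_pow (by rw [Nat.even_iff]; omega)] at this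
  linarith

theorem discr_sq_gt_of_lt {x : ℝ} (hx : x < zPlus p q 0) : 4 < (discr p q).eval x ^ 2 := by
  have := prod_sub_pos (show 0 ≤ 2 * p by omega) (periodicEigenvalue p q) x
    (fun j hj => absurd hj (by omega))
    (fun j hj hj' => hx.trans_le (periodicEigenvalue_mono p q hj hj'))
  rw [← discr_sq_sub_eval hq, Even.neg_one_pow (by rw [Nat.even_iff]; omega)] at this
  linarith

theorem discr_sq_gt_of_gt {x : ℝ} (hx : zMinus p q p < x) : 4 < (discr p q).eval x ^ 2 := by
  have hp := NeZero.pos p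
  have := prod_sub_pos (le_refl (2 * p)) (periodicEigenvalue p q) x
    (fun j hj => (periodicEigenvalue_mono p q (show j ≤ 2 * p - 1 by omega)
      (by omega)).trans_lt hx)
    (fun j hj hj' => absurd hj (by omega))
  rw [← discr_sq_sub_eval hq, Even.neg_one_pow (by rw [Nat.even_iff]; omega)] at this
  linarith

omit hq in
theorem band_or_gap (x : ℝ) : x < zPlus p q 0 ∨ zMinus p q p < x ∨
    (∃ n < p, x ∈ Set.Icc (zPlus p q n) (zMinus p q (n + 1))) ∨
    ∃ n, 1 ≤ n ∧ n ≤ p - 1 ∧ x ∈ gap p q n := by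
  have hp := NeZero.pos p
  by_contra! h
  obtain ⟨h0, h1, h2, h3⟩ := h
  have key : ∀ n < p, zPlus p q n ≤ x ∧ zMinus p q (n + 1) < x := by
    intro n
    induction n with
    | zero =>
      intro hn
      refine ⟨h0, ?_⟩
      by_contra! h
      exact h2 0 hn ⟨h0, h⟩
    | succ n ih =>
      intro hn
      have a := (ih (by omega)).2
      have b : zPlus p q (n + 1) ≤ x := by
        by_contra! h
        exact h3 (n + 1) (by omega) (by omega) ⟨a, h⟩
      refine ⟨b, ?_⟩
      by_contra! h
      exact h2 (n + 1) hn ⟨b, h⟩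
  have := (key (p - 1) (by omega)).2
  rw [Nat.sub_add_cancel hp] at this
  exact absurd this (not_lt.2 h1)

theorem discr_sq_le_iff (x : ℝ) : (discr p q).eval x ^ 2 ≤ 4 ↔
    ∃ n < p, x ∈ Set.Icc (zPlus p q n) (zMinus p q (n + 1)) := by
  refine ⟨fun h => ?_, fun ⟨n, hn, hx⟩ => discr_sq_le_of_mem_band hq hn hx⟩
  rcases band_or_gap (p := p) (q := q) x with h1 | h1 | h1 | ⟨n, hn, hn', hx⟩
  · exact absurd h (not_le.2 (discr_sq_gt_of_lt hq h1))
  · exact absurd h (not_le.2 (discr_sq_gt_of_gt hq h1))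
  · exact h1
  · exact absurd h (not_le.2 (discr_sq_gt_of_mem_gap hq hn hn' hx))

theorem discr_sq_le_iff_notMem_gap {x : ℝ} (h0 : zPlus p q 0 ≤ x) (h1 : x ≤ zMinus p q p) :
    (discr p q).eval x ^ 2 ≤ 4 ↔ ∀ n, 1 ≤ n → n ≤ p - 1 → x ∉ gap p q n := by
  refine ⟨fun h n hn hn' hx => absurd h (not_le.2 (discr_sq_gt_of_mem_gap hq hn hn' hx)),
    fun h => ?_⟩
  rcases band_or_gap (p := p) (q := q) x with h2 | h2 | h2 | ⟨n, hn, hn', hx⟩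
  · exact absurd h2 (not_lt.2 h0)
  · exact absurd h2 (not_lt.2 h1)
  · exact (discr_sq_le_iff hq x).2 h2
  · exact absurd hx (h n hn hn')

theorem discr_sq_lt_iff (x : ℝ) : (discr p q).eval x ^ 2 < 4 ↔
    ∃ n < p, x ∈ Set.Ioo (zPlus p q n) (zMinus p q (n + 1)) := by
  refine ⟨fun h => ?_, fun ⟨n, hn, hx⟩ => discr_sq_lt_of_mem_band hq hn hx⟩
  obtain ⟨n, hn, h1, h2⟩ := (discr_sq_le_iff hq x).1 h.le
  refine ⟨n, hn, h1.lt_of_ne ?_, h2.lt_of_ne ?_⟩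
  · rintro rfl
    exact h.ne (discr_sq_zPlus hq hn)
  · rintro rfl
    exact h.ne (discr_sq_zMinus hq hn)

/-- The bands are nondegenerate. -/
theorem zPlus_lt_zMinus {n : ℕ} (hn : n < p) : zPlus p q n < zMinus p q (n + 1) := by
  have hle : zPlus p q n ≤ zMinus p q (n + 1) :=
    periodicEigenvalue_mono p q (show 2 * n ≤ 2 * (n + 1) - 1 by omega) (by omega)
  refine hle.lt_of_ne fun heq => ?_
  have e1 : 2 * (n + 1) - 1 = 2 * n + 1 := by omega
  have e : periodicEigenvalue p q (2 * n + 1) = zPlus p q n := by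
    rw [heq, zMinus, e1]
  set c := zPlus p q n with hc
  have fr : 2 ≤ Module.finrank ℝ (periodicSol p q c) :=
    finrank_periodicSol_ge hq (fun i : Fin 2 => ⟨2 * n + i, by omega⟩)
      (fun a b hab => by simpa [Fin.ext_iff] using hab) (by
        intro i
        fin_cases i
        · rfl
        · exact e)
  have d1 := derivative_discr_eq_zero_of_finrank hq fr
  have d0 := discr_sq_zPlus hq hn
  rw [← hc] at d0
  have hQ := prod_periodicEigenvalue (p := p) hq
  -- the second derivative of `Δ² - 4` at the double root
  set l : ℕ → ℝ := fun j => periodicEigenvalue p q (if j < 2 * n then j else j + 2)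
  have hs : ∏ j ∈ Finset.range (2 * p), (X - C (periodicEigenvalue p q j)) =
      (X - C c) ^ 2 * ∏ j ∈ Finset.range (2 * p - 2), (X - C (l j)) := by
    rw [← Finset.prod_range_mul_prod_Ico _ (show 2 * n ≤ 2 * p by omega),
      ← Finset.prod_range_mul_prod_Ico _ (show 2 * n ≤ 2 * p - 2 by omega),
      Finset.prod_eq_prod_Ico_succ_bot (by omega), Finset.prod_eq_prod_Ico_succ_bot (by omega), e]
    have a1 : ∏ j ∈ Finset.range (2 * n), (X - C (l j)) =
        ∏ j ∈ Finset.range (2 * n), (X - C (periodicEigenvalue p q j)) :=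
      Finset.prod_congr rfl fun j hj => by simp only [l, if_pos (Finset.mem_range.1 hj)]
    have a2 : ∏ j ∈ Finset.Ico (2 * n) (2 * p - 2), (X - C (l j)) =
        ∏ j ∈ Finset.Ico (2 * n + 1 + 1) (2 * p), (X - C (periodicEigenvalue p q j)) := by
      rw [show 2 * p = 2 * p - 2 + 2 by omega, Nat.add_sub_cancel, add_assoc,
        ← Finset.prod_Ico_add' _ _ _ 2]
      refine Finset.prod_congr rfl fun j hj => ?_
      simp only [l, if_neg (not_lt.2 (Finset.mem_Ico.1 hj).1)]
    rw [a1, a2]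
    change _ * ((X - C c) * ((X - C c) * _)) = _
    ring
  set R := ∏ j ∈ Finset.range (2 * p - 2), (X - C (l j)) with hR
  -- No third eigenvalue equals `c`, and an even number of the remaining ones lies above it.
  have Rpos : 0 < R.eval c := by
    have := prod_sub_pos (show 2 * n ≤ 2 * p - 2 by omega) l c
      (fun j hj => by
        simp only [l, if_pos hj]
        have h1 := periodicEigenvalue_mono p q (show j ≤ 2 * n - 1 by omega) (by omega)
        have h2 := periodicEigenvalue_lt_add_two hq (j := 2 * n - 1) (by omega)
        rw [show 2 * n - 1 + 2 = 2 * n + 1 by omega, e] at h2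
        exact h1.trans_lt h2)
      (fun j hj hj' => by
        simp only [l, if_neg (not_lt.2 hj)]
        have h1 := periodicEigenvalue_mono p q (show 2 * n + 2 ≤ j + 2 by omega) (by omega)
        exact (periodicEigenvalue_lt_add_two hq (j := 2 * n) (by omega)).trans_le h1)
    rw [Even.neg_one_pow (by rw [Nat.even_iff]; omega), one_mul] at this
    rw [hR, eval_prod]
    simpa using this
  have spl : (discr p q ^ 2 - 4).Splits := by
    rw [← hQ]
    exact Splits.prod fun j _ => Splits.X_sub_C _
  have ne0 := (discr_sq_sub_monic_natDegree (p := p) hq).1.ne_zero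
  -- A degenerate band would give `Δ Δ'' = R(c) > 0` at the critical point `c`. Both `Δ + 2` and `Δ
  -- - 2` are real-rooted; Laguerre for `Δ + 2` if `Δ(c) = 2`, and for `Δ - 2` if `Δ(c) = -2`, gives
  -- `Δ Δ'' ≤ 0`.
  have sp1 : (discr p q + 2).Splits := spl.of_dvd ne0 ⟨discr p q - 2, by ring⟩
  have sp2 : (discr p q - 2).Splits := spl.of_dvd ne0 ⟨discr p q + 2, by ring⟩
  have L1 := laguerre_inequality sp1 c
  have L2 := laguerre_inequality sp2 c
  have dd := congrArg (fun P => (derivative (derivative P)).eval c) (hQ.symm.trans hs)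
  simp only [derivative_sub, derivative_pow, derivative_mul, derivative_X, derivative_C,
    derivative_add, derivative_ofNat, eval_sub, eval_add, eval_mul, eval_pow, eval_X, eval_C,
    d1, eval_ofNat, sub_self, sub_zero, add_zero] at dd L1 L2
  norm_num [d1] at dd L1 L2
  rcases sq_eq_sq_iff_eq_or_eq_neg.1 (d0.trans (by norm_num : (4 : ℝ) = 2 ^ 2)) with h | h
  · rw [h] at L1 dd; linarith
  · rw [h] at L2 dd; linarith

-- Inside a band the form is definite by `formKernel_det`, so its diagonal values are nonzero of one
-- sign. A zero at `m` would contradict the identity for the pair `m`, `m + 1`, where `green` is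
-- `1`.
omit [NeZero p] in
theorem formKernel_mul_self_pos {x : ℝ} (hx : (discr p q).eval x ^ 2 < 4) (m n : ℤ) :
    0 < (formKernel p q m m).eval x * (formKernel p q n n).eval x := by
  have det : ∀ m n, 4 * ((formKernel p q m m).eval x * (formKernel p q n n).eval x -
      (formKernel p q m n).eval x ^ 2) =
      (4 - (discr p q).eval x ^ 2) * (green q m n).eval x ^ 2 := by
    intro m n
    simpa using congrArg (eval x) (formKernel_det p q m n)
  have ne : ∀ m, (formKernel p q m m).eval x ≠ 0 := by
    intro m h
    have := det m (m + 1)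
    rw [h, green_succ, eval_one] at this
    nlinarith [sq_nonneg ((formKernel p q m (m + 1)).eval x)]
  have := det m n
  have h2 : 0 ≤ (4 - (discr p q).eval x ^ 2) * (green q m n).eval x ^ 2 :=
    mul_nonneg (by linarith) (sq_nonneg _)
  refine lt_of_le_of_ne ?_ (mul_ne_zero (ne m) (ne n)).symm
  nlinarith [sq_nonneg ((formKernel p q m n).eval x)]

omit [NeZero p] in
theorem formKernel_self_add_mul (n k : ℤ) :
    formKernel p q (n + k * p) (n + k * p) = formKernel p q n n := by
  have step : ∀ n, formKernel p q (n + p) (n + p) = formKernel p q n n := fun n => by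
    rw [formKernel_self hq, formKernel_self hq, green_add_period hq]
  induction k using Int.induction_on with
  | zero => simp
  | succ i ih => rw [← ih, ← step (n + i * p)]; congr 1 <;> ring
  | pred i ih => rw [← ih, ← step]; congr 1 <;> ring

theorem derivative_discr_mul_formKernel_pos {x : ℝ} (hx : (discr p q).eval x ^ 2 < 4) (n : ℤ) :
    0 < (derivative (discr p q)).eval x * (formKernel p q n n).eval x := by
  rw [derivative_discr, eval_finsetSum, Finset.sum_mul]
  exact Finset.sum_pos (fun j _ => formKernel_mul_self_pos hq hx j n)
    ⟨1, Finset.mem_Icc.2 ⟨le_rfl, NeZero.pos p⟩⟩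

/-- `Δ'` is the sum of the diagonal values over one period, all of the same sign, so each is bounded
by the sum. This provides the domination needed for integrability. -/
theorem abs_formKernel_self_le {x : ℝ} (hx : (discr p q).eval x ^ 2 < 4) (n : ℤ) :
    |(formKernel p q n n).eval x| ≤ |(derivative (discr p q)).eval x| := by
  have hp := NeZero.pos p
  obtain ⟨j, hj, hjn⟩ : ∃ j ∈ Finset.Icc 1 p, formKernel p q n n = formKernel p q j j := by
    have h1 := Int.emod_nonneg (n - 1) (show (p : ℤ) ≠ 0 by omega)
    have h2 := Int.emod_lt_of_pos (n - 1) (show (0 : ℤ) < p by omega)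
    refine ⟨((n - 1) % p).toNat + 1, by rw [Finset.mem_Icc]; omega, ?_⟩
    have := Int.emod_add_mul_ediv (n - 1) p
    have e : ((((n - 1) % p).toNat + 1 : ℕ) : ℤ) + (n - 1) / p * p = n := by
      push_cast
      rw [Int.toNat_of_nonneg h1]
      linarith
    rw [← formKernel_self_add_mul hq ((((n - 1) % p).toNat + 1 : ℕ) : ℤ) ((n - 1) / p), e]
  have hn : (formKernel p q n n).eval x ≠ 0 := by
    intro h
    have := formKernel_mul_self_pos hq hx n n
    rw [h] at this
    simp at this
  refine le_of_mul_le_mul_right ?_ (abs_pos.2 hn)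
  rw [← abs_mul, ← abs_mul, abs_of_pos (formKernel_mul_self_pos hq hx n n),
    abs_of_pos (derivative_discr_mul_formKernel_pos hq hx n), derivative_discr, eval_finsetSum,
    Finset.sum_mul]
  have := Finset.single_le_sum (f := fun j : ℕ => (formKernel p q j j).eval x *
    (formKernel p q n n).eval x) (fun j _ => (formKernel_mul_self_pos hq hx j n).le) hj
  rwa [← hjn] at this

end Bands

end Armchair
end


noncomputable section

set_option linter.unusedSectionVars false

namespace Armchair

open Polynomial

/-! ## Integration over the spectrum -/

/-- The `n`-th open band. -/
def band (p : ℕ) (q : ℤ → ℝ) (n : ℕ) : Set ℝ := Set.Ioo (zPlus p q n) (zMinus p q (n + 1))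

theorem measurableSet_band (p : ℕ) (q : ℤ → ℝ) (n : ℕ) : MeasurableSet (band p q n) :=
  measurableSet_Ioo

/-- The interior of the spectrum of `J(q)`. -/
def bandSet (p : ℕ) (q : ℤ → ℝ) : Set ℝ := {x | (discr p q).eval x ^ 2 < 4}

theorem isOpen_bandSet (p : ℕ) (q : ℤ → ℝ) : IsOpen (bandSet p q) :=
  isOpen_lt (by fun_prop) continuous_const

theorem measurableSet_bandSet (p : ℕ) (q : ℤ → ℝ) : MeasurableSet (bandSet p q) :=
  (isOpen_bandSet p q).measurableSet

/-- The inverse of the discriminant on the `n`-th band. -/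
def bandRoot (p : ℕ) (q : ℤ → ℝ) (n : ℕ) : ℝ → ℝ :=
  Function.invFunOn (fun x => (discr p q).eval x) (band p q n)

/-- The Chebyshev weight on `(-2, 2)`. -/
def chebWeight (y : ℝ) : ℝ := (√(1 - (y / 2) ^ 2))⁻¹

theorem integrableOn_chebWeight : IntegrableOn chebWeight (Set.Ioo (-2) 2) := by
  have h := Chebyshev.intervalIntegrable_sqrt_one_sub_sq_inv.comp_mul_left (c := 2⁻¹)
  norm_num at h
  rw [intervalIntegrable_iff_integrableOn_Ioo_of_le (by norm_num)] at h
  refine h.congr_fun (fun y _ => ?_) measurableSet_Ioo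
  simp only [chebWeight, ← Real.sqrt_inv]
  ring_nf

theorem integral_chebyshev_chebWeight (l : ℤ) :
    ∫ y in Set.Ioo (-2 : ℝ) 2, (Chebyshev.T ℝ l).eval (y / 2) * chebWeight y =
      if l = 0 then 2 * Real.pi else 0 := by
  have h : ∫ y in Set.Ioo (-2 : ℝ) 2, (Chebyshev.T ℝ l).eval (y / 2) * chebWeight y =
      2 * ∫ x, (Chebyshev.T ℝ l).eval x ∂Chebyshev.measureT := by
    rw [Chebyshev.integral_measureT, ← integral_Ioc_eq_integral_Ioo,
      ← intervalIntegral.integral_of_le (by norm_num)]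
    have := intervalIntegral.integral_comp_div (a := -2) (b := 2)
      (fun x => (Chebyshev.T ℝ l).eval x * √(1 - x ^ 2)⁻¹) (two_ne_zero)
    rw [show (-2 : ℝ) / 2 = -1 by norm_num, show (2 : ℝ) / 2 = 1 by norm_num, smul_eq_mul] at this
    rw [← this]
    simp only [chebWeight, Real.sqrt_inv]
  rw [h]
  split_ifs with hl
  · rw [hl, Chebyshev.integral_eval_T_real_measureT_zero]
  · rw [Chebyshev.integral_eval_T_real_measureT_of_ne_zero hl, mul_zero]

/-! ### The discriminant as integration variable -/

section Integral

variable {p : ℕ} [NeZero p] {q : ℤ → ℝ} (hq : ∀ n, q (n + p) = q n)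
include hq

theorem bandSet_eq_iUnion : bandSet p q = ⋃ n ∈ Finset.range p, band p q n := by
  ext x
  simp only [bandSet, Set.mem_ofPred_eq, discr_sq_lt_iff hq, Set.mem_iUnion, Finset.mem_range,
    exists_prop, band]

omit [NeZero p] hq in
theorem band_disjoint : ((Finset.range p : Finset ℕ) : Set ℕ).Pairwise
    (Function.onFun Disjoint (band p q)) := by
  have key : ∀ m n, m < n → n < p → Disjoint (band p q m) (band p q n) := by
    intro m n h hn
    rw [Set.disjoint_left]
    intro x hx hx'
    have := periodicEigenvalue_mono p q (show 2 * (m + 1) - 1 ≤ 2 * n by omega) (by omega)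
    exact absurd (hx.2.trans_le this) (not_lt.2 hx'.1.le)
  intro m hm n hn hmn
  simp only [Finset.coe_range, Set.mem_Iio] at hm hn
  rcases hmn.lt_or_gt with h | h
  · exact key m n h hn
  · exact (key n m h hm).symm

theorem derivative_discr_ne_zero {x : ℝ} (hx : x ∈ bandSet p q) :
    (derivative (discr p q)).eval x ≠ 0 := fun h => by
  have := derivative_discr_mul_formKernel_pos hq hx 0
  rw [h, zero_mul] at this
  exact lt_irrefl _ this

theorem band_subset {n : ℕ} (hn : n < p) : band p q n ⊆ bandSet p q :=
  fun _ hx => discr_sq_lt_of_mem_band hq hn hx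

/-- Rolle's theorem: `Δ'` has no zero in an open band. -/
theorem injOn_discr_band {n : ℕ} (hn : n < p) :
    Set.InjOn (fun x => (discr p q).eval x) (Set.Icc (zPlus p q n) (zMinus p q (n + 1))) := by
  have key : ∀ x y, zPlus p q n ≤ x → y ≤ zMinus p q (n + 1) → x < y →
      (discr p q).eval x ≠ (discr p q).eval y := by
    intro x y hx hy hxy h
    obtain ⟨c, hc, h0⟩ := exists_deriv_eq_zero (f := fun x => (discr p q).eval x) hxy
      (by fun_prop) h
    rw [Polynomial.deriv] at h0
    exact derivative_discr_ne_zero hq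
      (band_subset hq hn ⟨hx.trans_lt hc.1, hc.2.trans_le hy⟩) h0
  intro x hx y hy hxy
  rcases lt_trichotomy x y with h | h | h
  · exact absurd hxy (key x y hx.1 hy.2 h)
  · exact h
  · exact absurd hxy.symm (key y x hy.1 hx.2 h)

/-- At both ends of a band `Δ = ±2`; injectivity on the closed band makes the two values opposite,
and the intermediate value theorem fills `(-2, 2)`. -/
theorem image_discr_band {n : ℕ} (hn : n < p) :
    (fun x => (discr p q).eval x) '' band p q n = Set.Ioo (-2) 2 := by
  have hlt := zPlus_lt_zMinus hq hn
  apply Set.Subset.antisymm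
  · rintro _ ⟨x, hx, rfl⟩
    have h := band_subset hq hn hx
    simp only [bandSet, Set.mem_ofPred_eq] at h
    exact abs_lt.1 (abs_lt_of_sq_lt_sq (by linarith) (by norm_num))
  · have h1 := sq_eq_sq_iff_eq_or_eq_neg.1
      ((discr_sq_zPlus hq hn).trans (by norm_num : (4 : ℝ) = 2 ^ 2))
    have h2 := sq_eq_sq_iff_eq_or_eq_neg.1
      ((discr_sq_zMinus hq hn).trans (by norm_num : (4 : ℝ) = 2 ^ 2))
    have ne : (discr p q).eval (zPlus p q n) ≠ (discr p q).eval (zMinus p q (n + 1)) := fun h =>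
      hlt.ne (injOn_discr_band hq hn (Set.left_mem_Icc.2 hlt.le) (Set.right_mem_Icc.2 hlt.le) h)
    have c : ContinuousOn (fun x => (discr p q).eval x)
      (Set.Icc (zPlus p q n) (zMinus p q (n + 1))) := by fun_prop
    rcases h1 with h1 | h1 <;> rcases h2 with h2 | h2
    · exact absurd (h1.trans h2.symm) ne
    · have := intermediate_value_Ioo' hlt.le c
      rwa [h1, h2] at this
    · have := intermediate_value_Ioo hlt.le c
      rwa [h1, h2] at this
    · exact absurd (h1.trans h2.symm) ne

theorem bandRoot_mem {n : ℕ} (hn : n < p) {y : ℝ} (hy : y ∈ Set.Ioo (-2 : ℝ) 2) :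
    bandRoot p q n y ∈ band p q n ∧ (discr p q).eval (bandRoot p q n y) = y := by
  rw [← image_discr_band hq hn] at hy
  exact Function.invFunOn_pos hy

theorem bandRoot_discr {n : ℕ} (hn : n < p) {x : ℝ} (hx : x ∈ band p q n) :
    bandRoot p q n ((discr p q).eval x) = x := by
  have hy : (discr p q).eval x ∈ Set.Ioo (-2 : ℝ) 2 := by
    rw [← image_discr_band hq hn]
    exact ⟨x, hx, rfl⟩
  obtain ⟨h1, h2⟩ := bandRoot_mem hq hn hy
  exact injOn_discr_band hq hn (Set.Ioo_subset_Icc_self h1) (Set.Ioo_subset_Icc_self hx) h2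

/-- Lagrange interpolation at the points of the spectrum with given discriminant. -/
theorem sum_bandRoot {y : ℝ} (hy : y ∈ Set.Ioo (-2 : ℝ) 2) {R : ℝ[X]} (hR : R.degree < p) :
    ∑ n ∈ Finset.range p, R.eval (bandRoot p q n y) /
      (derivative (discr p q)).eval (bandRoot p q n y) = R.coeff (p - 1) := by
  have hp := NeZero.pos p
  have inj : Set.InjOn (fun n => bandRoot p q n y) (Finset.range p : Finset ℕ) := by
    intro m hm n hn h
    by_contra hmn
    have := band_disjoint (q := q) hm hn hmn
    simp only [Finset.coe_range, Set.mem_Iio] at hm hn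
    refine Set.disjoint_left.1 this (bandRoot_mem hq hm hy).1 ?_
    simp only at h
    rw [h]
    exact (bandRoot_mem hq hn hy).1
  -- One root of `Δ = y` in each of the `p` bands exhausts the degree, so the nodal polynomial is `Δ
  -- - y` and the Lagrange weights are `1 / Δ'`.
  have nod : Lagrange.nodal (Finset.range p) (fun n => bandRoot p q n y) = discr p q - C y := by
    obtain ⟨h1, h2⟩ := discr_monic_natDegree hp q
    have hlt : (C y).degree < (discr p q).degree := by
      rw [degree_eq_natDegree h1.ne_zero, h2]
      exact degree_C_le.trans_lt (by exact_mod_cast hp)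
    have hm : (discr p q - C y).Monic := h1.sub_of_left hlt
    have hd : (discr p q - C y).natDegree = p := by
      rw [natDegree_eq_of_degree_eq (degree_sub_eq_left_of_degree_lt hlt), h2]
    refine (eq_of_monic_of_dvd_of_natDegree_le Lagrange.nodal_monic hm ?_ ?_).symm
    · have : Lagrange.nodal (Finset.range p) (fun n => bandRoot p q n y) =
          (((Finset.range p).val.map (fun n => bandRoot p q n y)).map (fun a => X - C a)).prod := by
        rw [Multiset.map_map]; rfl
      rw [this, Multiset.prod_X_sub_C_dvd_iff_le_roots hm.ne_zero, Multiset.le_iff_subset]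
      · intro a ha
        obtain ⟨n, hn, rfl⟩ := Multiset.mem_map.1 ha
        rw [mem_roots hm.ne_zero, IsRoot.def, eval_sub, eval_C,
          (bandRoot_mem hq (Finset.mem_range.1 hn) hy).2, sub_self]
      · exact (Multiset.nodup_map_iff_inj_on (Finset.range p).nodup).2
          fun a ha b hb h => inj ha hb h
    · rw [hd, Lagrange.natDegree_nodal, Finset.card_range]
  have key := Lagrange.coeff_eq_sum (s := Finset.range p) inj (P := R) (by simpa using hR)
  rw [Finset.card_range] at key
  rw [key]
  refine Finset.sum_congr rfl fun n hn => ?_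
  have := Lagrange.eval_nodal_derivative_eval_node_eq (v := fun n => bandRoot p q n y) hn
  rw [nod, derivative_sub, derivative_C, sub_zero, Lagrange.eval_nodal] at this
  rw [this]

theorem integrableOn_chebWeight_discr :
    IntegrableOn (fun x => |(derivative (discr p q)).eval x| * chebWeight ((discr p q).eval x))
      (bandSet p q) := by
  rw [bandSet_eq_iUnion hq, integrableOn_finset_iUnion]
  intro n hn
  have hn' := Finset.mem_range.1 hn
  have := integrableOn_image_iff_integrableOn_abs_deriv_smul (s := band p q n) measurableSet_Ioo
    (f := fun x => (discr p q).eval x) (f' := fun x => (derivative (discr p q)).eval x)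
    (fun x _ => ((discr p q).hasDerivAt x).hasDerivWithinAt)
    ((injOn_discr_band hq hn').mono Set.Ioo_subset_Icc_self) chebWeight
  rw [image_discr_band hq hn'] at this
  simpa using this.1 integrableOn_chebWeight

/-- Cauchy–Schwarz for the definite form, followed by the bound of its diagonal by `Δ'`. -/
theorem formKernel_sq_le {x : ℝ} (hx : x ∈ bandSet p q) (m n : ℤ) :
    |(formKernel p q m n).eval x| ≤ |(derivative (discr p q)).eval x| := by
  have det : 4 * ((formKernel p q m m).eval x * (formKernel p q n n).eval x -
      (formKernel p q m n).eval x ^ 2) =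
      (4 - (discr p q).eval x ^ 2) * (green q m n).eval x ^ 2 := by
    simpa using congrArg (eval x) (formKernel_det p q m n)
  have h2 : 0 ≤ (4 - (discr p q).eval x ^ 2) * (green q m n).eval x ^ 2 :=
    mul_nonneg (by simp only [bandSet, Set.mem_ofPred_eq] at hx; linarith) (sq_nonneg _)
  have h3 : (formKernel p q m m).eval x * (formKernel p q n n).eval x ≤
      |(derivative (discr p q)).eval x| ^ 2 := by
    refine (le_abs_self _).trans ?_
    rw [abs_mul, sq]
    exact mul_le_mul (abs_formKernel_self_le hq hx m) (abs_formKernel_self_le hq hx n)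
      (abs_nonneg _) (abs_nonneg _)
  refine abs_le_of_sq_le_sq ?_ (abs_nonneg _)
  linarith

theorem integrableOn_kernel (m n : ℤ) :
    IntegrableOn (fun x => |(derivative (discr p q)).eval x| *
      ((formKernel p q m n).eval x / (derivative (discr p q)).eval x *
        chebWeight ((discr p q).eval x))) (bandSet p q) := by
  refine (integrableOn_chebWeight_discr hq).mono' ?_ ?_
  · unfold chebWeight
    exact Measurable.aestronglyMeasurable (by fun_prop)
  · refine (ae_restrict_iff' (measurableSet_bandSet p q)).2 (.of_forall fun x hx => ?_)
    have hw : 0 ≤ chebWeight ((discr p q).eval x) := inv_nonneg.2 (Real.sqrt_nonneg _)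
    rw [norm_mul, norm_mul, Real.norm_eq_abs, abs_abs, Real.norm_eq_abs, Real.norm_eq_abs,
      abs_of_nonneg hw, abs_div]
    refine mul_le_mul_of_nonneg_left ?_ (abs_nonneg _)
    refine mul_le_of_le_one_left hw ?_
    exact div_le_one_of_le₀ (formKernel_sq_le hq hx m n) (abs_nonneg _)

/-- Write `n = m + r + l p` with `0 ≤ r < p`. Substituting `y = Δ(x)` on each band turns the sum
over bands into Lagrange sums of the two polynomial factors in `formKernel_chebyshev`. Their
coefficients at `p - 1` are `0` and `1` if `r = 0`, and both vanish otherwise; what is left is the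
Chebyshev integral of `T_l`, which vanishes unless `l = 0`. -/
theorem integral_kernel (m n : ℤ) :
    ∫ x in bandSet p q, |(derivative (discr p q)).eval x| *
      ((formKernel p q m n).eval x / (derivative (discr p q)).eval x *
        chebWeight ((discr p q).eval x)) = if m = n then 2 * Real.pi else 0 := by
  have hp := NeZero.pos p
  have int := integrableOn_kernel hq m n
  set G : ℕ → ℝ → ℝ := fun j y => (formKernel p q m n).eval (bandRoot p q j y) /
    (derivative (discr p q)).eval (bandRoot p q j y) * chebWeight y
  have eqOn : ∀ j < p, Set.EqOn (fun x => |(derivative (discr p q)).eval x| *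
      ((formKernel p q m n).eval x / (derivative (discr p q)).eval x *
        chebWeight ((discr p q).eval x)))
      (fun x => |(derivative (discr p q)).eval x| • G j ((discr p q).eval x)) (band p q j) := by
    intro j hj x hx
    simp only [G, bandRoot_discr hq hj hx, smul_eq_mul]
  have hder : ∀ j, ∀ x ∈ band p q j, HasDerivWithinAt (fun x => (discr p q).eval x)
      ((derivative (discr p q)).eval x) (band p q j) x :=
    fun j x _ => ((discr p q).hasDerivAt x).hasDerivWithinAt
  have hG : ∀ j < p, IntegrableOn (G j) (Set.Ioo (-2) 2) := by
    intro j hj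
    rw [← image_discr_band hq hj, integrableOn_image_iff_integrableOn_abs_deriv_smul
      (measurableSet_band p q j) (hder j) ((injOn_discr_band hq hj).mono Set.Ioo_subset_Icc_self)]
    exact (int.mono_set (band_subset hq hj)).congr_fun (eqOn j hj) (measurableSet_band p q j)
  obtain ⟨r, l, hr, hn⟩ : ∃ (r : ℕ) (l : ℤ), r < p ∧ n = m + r + l * p := by
    have h1 := Int.emod_nonneg (n - m) (show (p : ℤ) ≠ 0 by omega)
    have h2 := Int.emod_lt_of_pos (n - m) (show (0 : ℤ) < p by omega)
    refine ⟨((n - m) % p).toNat, (n - m) / p, by omega, ?_⟩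
    rw [Int.toNat_of_nonneg h1]
    have := Int.emod_add_mul_ediv (n - m) p
    linarith
  have hα := (green_degree q m r).1
  have hαd : (green q m (m + r)).degree < p := hα.trans (by exact_mod_cast hr)
  have hαc : (green q m (m + r)).coeff (p - 1) = 0 :=
    coeff_eq_zero_of_degree_lt (hα.trans_le (by exact_mod_cast (by omega : r ≤ p - 1)))
  obtain ⟨-, hβm, hβn⟩ := green_degree q (m + r) (p - 1 - r)
  rw [show m + r + ((p - 1 - r : ℕ) : ℤ) + 1 = m + p by omega] at hβm hβn
  have hβd : (green q (m + r) (m + p)).degree < p := by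
    rw [degree_eq_natDegree hβm.ne_zero, hβn]
    exact_mod_cast (by omega : p - 1 - r < p)
  have hβc : (green q (m + r) (m + p)).coeff (p - 1) = if r = 0 then 1 else 0 := by
    split_ifs with h0
    · have := hβm.coeff_natDegree
      rwa [hβn, h0, Nat.sub_zero, ← h0] at this
    · exact coeff_eq_zero_of_natDegree_lt (by omega)
  have sumG : ∀ y ∈ Set.Ioo (-2 : ℝ) 2, ∑ j ∈ Finset.range p, G j y =
      if r = 0 then (Chebyshev.T ℝ l).eval (y / 2) * chebWeight y else 0 := by
    intro y hy
    have e : ∀ j ∈ Finset.range p, G j y =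
        ((green q m (m + r)).eval (bandRoot p q j y) /
          (derivative (discr p q)).eval (bandRoot p q j y)) *
            ((Chebyshev.T ℝ (l + 1)).eval (y / 2) * chebWeight y) +
        ((green q (m + r) (m + p)).eval (bandRoot p q j y) /
          (derivative (discr p q)).eval (bandRoot p q j y)) *
            ((Chebyshev.T ℝ l).eval (y / 2) * chebWeight y) := by
      intro j hj
      simp only [G, hn, formKernel_chebyshev hq, eval_add, eval_mul, eval_comp, eval_C,
        (bandRoot_mem hq (Finset.mem_range.1 hj) hy).2]
      rw [show (2 : ℝ)⁻¹ * y = y / 2 by ring]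
      ring
    rw [Finset.sum_congr rfl e, Finset.sum_add_distrib, ← Finset.sum_mul, ← Finset.sum_mul,
      sum_bandRoot hq hy hαd, sum_bandRoot hq hy hβd, hαc, hβc]
    split_ifs <;> ring
  rw [bandSet_eq_iUnion hq] at int ⊢
  rw [integral_biUnion_finset _ (fun j _ => measurableSet_band p q j) band_disjoint
    ((integrableOn_finset_iUnion).1 int)]
  have e : ∀ j ∈ Finset.range p, ∫ x in band p q j, |(derivative (discr p q)).eval x| *
      ((formKernel p q m n).eval x / (derivative (discr p q)).eval x *
        chebWeight ((discr p q).eval x)) = ∫ y in Set.Ioo (-2) 2, G j y := by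
    intro j hj
    have hj' := Finset.mem_range.1 hj
    rw [setIntegral_congr_fun (measurableSet_band p q j) (eqOn j hj'), ← image_discr_band hq hj',
      integral_image_eq_integral_abs_deriv_smul (measurableSet_band p q j) (hder j)
        ((injOn_discr_band hq hj').mono Set.Ioo_subset_Icc_self)]
  rw [Finset.sum_congr rfl e, ← integral_finsetSum _ fun j hj => hG j (Finset.mem_range.1 hj),
    setIntegral_congr_fun measurableSet_Ioo sumG]
  have hmn : m = n ↔ r = 0 ∧ l = 0 := by
    rw [hn]
    constructor
    · intro h
      have h' : (r : ℤ) + l * p = 0 := by linarith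
      have hl : l = 0 := by
        by_contra hl
        rcases lt_or_gt_of_ne hl with h1 | h1
        · nlinarith
        · nlinarith
      rw [hl] at h'
      exact ⟨by simpa using h', hl⟩
    · rintro ⟨h1, h2⟩
      simp [h1, h2]
  by_cases h0 : r = 0
  · simp only [h0, if_true, integral_chebyshev_chebWeight, hmn, true_and]
  · simp [h0, hmn]

end Integral

end Armchair
end


noncomputable section

set_option linter.unusedSectionVars false

namespace Armchair

open Polynomial

/-! ## Determination by moments -/

section Moments

variable {F : Type} [NormedAddCommGroup F] [NormedSpace ℝ F] {μ : Measure ℝ} {a b : ℝ}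

theorem integrable_continuous_smul (hμ : μ (Set.Icc a b)ᶜ = 0) {f : ℝ → F} (hf : Integrable f μ)
    {g : ℝ → ℝ} (hg : Continuous g) : Integrable (fun x => g x • f x) μ := by
  obtain ⟨C, hC⟩ := isCompact_Icc.exists_bound_of_continuousOn (s := Set.Icc a b) hg.continuousOn
  refine (hf.norm.const_mul C).mono' (hg.aestronglyMeasurable.smul hf.1) ?_
  filter_upwards [show ∀ᵐ x ∂μ, x ∈ Set.Icc a b from hμ] with x hx
  rw [norm_smul]
  exact mul_le_mul_of_nonneg_right (hC x hx) (norm_nonneg _)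

theorem norm_integral_sub_polynomial_le (hμ : μ (Set.Icc a b)ᶜ = 0) {f : ℝ → F}
    (hf : Integrable f μ) {g : ℝ → ℝ} (hg : Continuous g) {ε : ℝ} {P : ℝ[X]}
    (hP : ∀ x ∈ Set.Icc a b, |P.eval x - g x| < ε) :
    ‖∫ x, P.eval x • f x ∂μ - ∫ x, g x • f x ∂μ‖ ≤ ε * ∫ x, ‖f x‖ ∂μ := by
  rw [← integral_sub (integrable_continuous_smul hμ hf P.continuous)
    (integrable_continuous_smul hμ hf hg), ← integral_const_mul]
  refine norm_integral_le_of_norm_le (hf.norm.const_mul ε) ?_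
  filter_upwards [show ∀ᵐ x ∂μ, x ∈ Set.Icc a b from hμ] with x hx
  rw [← sub_smul, norm_smul]
  exact mul_le_mul_of_nonneg_right (hP x hx).le (norm_nonneg _)

theorem integral_polynomial_smul (hμ : μ (Set.Icc a b)ᶜ = 0) {f : ℝ → F}
    (hf : Integrable f μ) (P : ℝ[X]) :
    ∫ x, P.eval x • f x ∂μ = P.sum fun n c => c • ∫ x, x ^ n • f x ∂μ := by
  simp only [eval_eq_sum, Polynomial.sum, Finset.sum_smul, mul_smul]
  rw [integral_finsetSum]
  · exact Finset.sum_congr rfl fun n _ => integral_smul _ _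
  · exact fun n _ => Integrable.smul (P.coeff n)
      (integrable_continuous_smul hμ hf (continuous_pow n))

theorem integral_add_add_const_mul {f g h : ℝ → ℂ} (hf : Integrable f μ) (hg : Integrable g μ)
    (hh : Integrable h μ) (r : ℂ) :
    ∫ x, (f x + g x + r * h x) ∂μ = ∫ x, f x ∂μ + ∫ x, g x ∂μ + r * ∫ x, h x ∂μ := by
  rw [integral_add (f := fun x => f x + g x) (hf.add hg) (hh.const_mul r), integral_add hf hg,
    integral_const_mul]

/-- Weierstrass approximation: on a compact interval carrying the measure, vanishing moments
annihilate every smooth test function. -/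
theorem ae_eq_zero_of_moments [CompleteSpace F] (hμ : μ (Set.Icc a b)ᶜ = 0) {f : ℝ → F}
    (hf : Integrable f μ) (h : ∀ n : ℕ, ∫ x, x ^ n • f x ∂μ = 0) : f =ᵐ[μ] 0 := by
  refine ae_eq_zero_of_integral_contDiff_smul_eq_zero hf.locallyIntegrable fun g hg _ => ?_
  by_contra hne
  have pos : 0 < ‖∫ x, g x • f x ∂μ‖ := norm_pos_iff.2 hne
  have hI : 0 ≤ ∫ x, ‖f x‖ ∂μ := integral_nonneg fun x => norm_nonneg _
  -- Chosen so that the approximation error is at most half of the nonzero integral.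
  set ε := ‖∫ x, g x • f x ∂μ‖ / (2 * (∫ x, ‖f x‖ ∂μ + 1))
  have hε : 0 < ε := by positivity
  obtain ⟨P, hP⟩ := exists_polynomial_near_of_continuousOn a b g hg.continuous.continuousOn ε hε
  have := norm_integral_sub_polynomial_le hμ hf hg.continuous hP
  rw [integral_polynomial_smul hμ hf] at this
  simp only [h, smul_zero, Polynomial.sum, Finset.sum_const_zero, zero_sub, norm_neg] at this
  have e : ε * (2 * (∫ x, ‖f x‖ ∂μ + 1)) = ‖∫ x, g x • f x ∂μ‖ :=
    div_mul_cancel₀ _ (by positivity)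
  nlinarith

/-- Finite measures with compact support are determined by their moments. -/
theorem measure_ext_of_moments {μ ν : Measure ℝ} [IsFiniteMeasure μ] [IsFiniteMeasure ν]
    (hμ : μ (Set.Icc a b)ᶜ = 0) (hν : ν (Set.Icc a b)ᶜ = 0)
    (h : ∀ n : ℕ, ∫ x, x ^ n ∂μ = ∫ x, x ^ n ∂ν) : μ = ν := by
  refine ext_of_forall_integral_eq_of_IsFiniteMeasure fun g => ?_
  by_contra hne
  have iμ : Integrable (fun _ : ℝ => (1 : ℝ)) μ := integrable_const _
  have iν : Integrable (fun _ : ℝ => (1 : ℝ)) ν := integrable_const _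
  have pos : 0 < |∫ x, g x ∂μ - ∫ x, g x ∂ν| := abs_pos.2 (sub_ne_zero.2 hne)
  set A := ∫ x, ‖(1 : ℝ)‖ ∂μ
  set B := ∫ x, ‖(1 : ℝ)‖ ∂ν
  have hA : 0 ≤ A := integral_nonneg fun x => norm_nonneg _
  have hB : 0 ≤ B := integral_nonneg fun x => norm_nonneg _
  set ε := |∫ x, g x ∂μ - ∫ x, g x ∂ν| / (2 * (A + B + 1))
  have hε : 0 < ε := by positivity
  obtain ⟨P, hP⟩ := exists_polynomial_near_of_continuousOn a b g g.continuous.continuousOn ε hε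
  have h1 := norm_integral_sub_polynomial_le hμ iμ g.continuous hP
  have h2 := norm_integral_sub_polynomial_le hν iν g.continuous hP
  rw [integral_polynomial_smul hμ iμ] at h1
  rw [integral_polynomial_smul hν iν] at h2
  simp only [smul_eq_mul, mul_one, h] at h1 h2
  replace h1 : |(P.sum fun n c => c * ∫ x, x ^ n ∂ν) - ∫ x, g x ∂μ| ≤ ε * A := h1
  replace h2 : |(P.sum fun n c => c * ∫ x, x ^ n ∂ν) - ∫ x, g x ∂ν| ≤ ε * B := h2
  have e : ε * (2 * (A + B + 1)) = |∫ x, g x ∂μ - ∫ x, g x ∂ν| :=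
    div_mul_cancel₀ _ (by positivity)
  have tri := abs_sub_le (∫ x, g x ∂μ) (P.sum fun n c => c * ∫ x, x ^ n ∂ν) (∫ x, g x ∂ν)
  rw [abs_sub_comm (∫ x, g x ∂μ) (P.sum fun n c => c * ∫ x, x ^ n ∂ν)] at tri
  nlinarith

end Moments

/-! ## The Bloch basis -/

/-- The value space of the spectral representation of `J(q)`. -/
abbrev C2 : Type := EuclideanSpace ℂ (Fin 2)

/-- `sin` of the quasimomentum. -/
def sinQuasi (p : ℕ) (q : ℤ → ℝ) (x : ℝ) : ℝ := √(1 - ((discr p q).eval x / 2) ^ 2)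

/-- The normalization of the Bloch vectors. -/
def blochScale (p : ℕ) (q : ℤ → ℝ) (x : ℝ) : ℝ :=
  (√(|(phi q p).eval x| * (2 * Real.pi * sinQuasi p q x)))⁻¹

/-- The first component of the Bloch vector. -/
def blochFst (p : ℕ) (q : ℤ → ℝ) (n : ℤ) (x : ℝ) : ℝ :=
  blochScale p q x * ((phi q p).eval x * (theta q n).eval x +
    2⁻¹ * ((phi q (p + 1)).eval x - (theta q p).eval x) * (phi q n).eval x)

/-- The second component of the Bloch vector. -/
def blochSnd (p : ℕ) (q : ℤ → ℝ) (n : ℤ) (x : ℝ) : ℝ :=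
  blochScale p q x * (sinQuasi p q x * (phi q n).eval x)

/-- Real generalized eigenvectors of `J(q)`: `n ↦ blochVec p q n x` solves `J u = x u`. -/
def blochVec (p : ℕ) (q : ℤ → ℝ) (n : ℤ) (x : ℝ) : C2 :=
  !₂[(blochFst p q n x : ℂ), (blochSnd p q n x : ℂ)]

theorem measurable_blochVec (p : ℕ) (q : ℤ → ℝ) (n : ℤ) : Measurable (blochVec p q n) := by
  have h1 : Measurable (blochFst p q n) := by
    unfold blochFst blochScale sinQuasi; fun_prop
  have h2 : Measurable (blochSnd p q n) := by
    unfold blochSnd blochScale sinQuasi; fun_prop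
  refine (PiLp.continuous_toLp 2 _).measurable.comp (measurable_pi_iff.2 fun i => ?_)
  fin_cases i
  · exact Complex.measurable_ofReal.comp h1
  · exact Complex.measurable_ofReal.comp h2

theorem inner_real_vec (a b c d : ℝ) :
    inner ℂ (!₂[(a : ℂ), (b : ℂ)] : C2) !₂[(c : ℂ), (d : ℂ)] = ((a * c + b * d : ℝ) : ℂ) := by
  simp [PiLp.inner_apply]
  ring

theorem blochVec_recurrence (p : ℕ) (q : ℤ → ℝ) (n : ℤ) (x : ℝ) :
    (x : ℂ) • blochVec p q n x =
      blochVec p q (n + 1) x + blochVec p q (n - 1) x + (q n : ℂ) • blochVec p q n x := by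
  have h1 := isSol_eval q x (isSol_theta q) n
  have h2 := isSol_eval q x (isSol_phi q) n
  have e1 : x * blochFst p q n x =
      blochFst p q (n + 1) x + blochFst p q (n - 1) x + q n * blochFst p q n x := by
    simp only [blochFst]
    linear_combination -blochScale p q x * (phi q p).eval x * h1 - blochScale p q x *
      (2⁻¹ * ((phi q (p + 1)).eval x - (theta q p).eval x)) * h2
  have e2 : x * blochSnd p q n x =
      blochSnd p q (n + 1) x + blochSnd p q (n - 1) x + q n * blochSnd p q n x := by
    simp only [blochSnd]
    linear_combination -blochScale p q x * sinQuasi p q x * h2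
  ext i
  fin_cases i
  · have := congrArg Complex.ofReal e1
    push_cast at this
    simpa [blochVec] using this
  · have := congrArg Complex.ofReal e2
    push_cast at this
    simpa [blochVec] using this

section Basis

variable {p : ℕ} [NeZero p] {q : ℤ → ℝ} (hq : ∀ n, q (n + p) = q n)
include hq

omit [NeZero p] hq in
theorem sinQuasi_pos {x : ℝ} (hx : x ∈ bandSet p q) : 0 < sinQuasi p q x := by
  simp only [bandSet, Set.mem_ofPred_eq] at hx
  exact Real.sqrt_pos.2 (by nlinarith)

omit [NeZero p] in
theorem phi_period_ne_zero {x : ℝ} (hx : x ∈ bandSet p q) : (phi q p).eval x ≠ 0 := by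
  have h := formKernel_mul_self_pos hq hx 0 0
  intro h0
  simp [formKernel, h0] at h

/-- The Bloch components complete the square: `phi q p` times the form is a sum of two squares, the
second with coefficient `sinQuasi² = 1 - Δ²/4`. As `phi q p` is the form at site `0`, its sign is
that of `Δ'`, so normalizing by `|phi q p|` produces the factor `|Δ'| / Δ'`. -/
theorem inner_blochVec {x : ℝ} (hx : x ∈ bandSet p q) (m n : ℤ) :
    inner ℂ (blochVec p q m x) (blochVec p q n x) =
      (((2 * Real.pi)⁻¹ * (|(derivative (discr p q)).eval x| *
      ((formKernel p q m n).eval x / (derivative (discr p q)).eval x *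
        chebWeight ((discr p q).eval x))) : ℝ) : ℂ) := by
  have hs := sinQuasi_pos hx
  have hb := phi_period_ne_zero hq hx
  have hd := derivative_discr_ne_zero hq hx
  have hsign := derivative_discr_mul_formKernel_pos hq hx 0
  have hw : chebWeight ((discr p q).eval x) = (sinQuasi p q x)⁻¹ := rfl
  rw [blochVec, blochVec, inner_real_vec, hw]
  congr 1
  have hsc : blochScale p q x ^ 2 = (|(phi q p).eval x| * (2 * Real.pi * sinQuasi p q x))⁻¹ := by
    rw [blochScale, inv_pow, Real.sq_sqrt (by positivity)]
  have hs2 : sinQuasi p q x ^ 2 = 1 - ((discr p q).eval x / 2) ^ 2 := by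
    refine Real.sq_sqrt ?_
    simp only [bandSet, Set.mem_ofPred_eq] at hx
    nlinarith
  have w := congrArg (eval x) (theta_phi_wronskian q p)
  simp only [eval_sub, eval_mul, eval_one] at w
  have num : blochFst p q m x * blochFst p q n x + blochSnd p q m x * blochSnd p q n x =
      blochScale p q x ^ 2 * ((phi q p).eval x * (formKernel p q m n).eval x) := by
    simp only [blochFst, blochSnd, formKernel, eval_sub, eval_add, eval_mul, eval_C]
    have : (discr p q).eval x = (theta q p).eval x + (phi q (p + 1)).eval x := by simp [discr]
    rw [this] at hs2
    linear_combination blochScale p q x ^ 2 * ((phi q m).eval x * (phi q n).eval x) * hs2 -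
      blochScale p q x ^ 2 * ((phi q m).eval x * (phi q n).eval x) * w
  rw [num, hsc]
  have sgn : (phi q p).eval x / |(phi q p).eval x| =
      |(derivative (discr p q)).eval x| / (derivative (discr p q)).eval x := by
    have e0 : (formKernel p q 0 0).eval x = (phi q p).eval x := by simp [formKernel]
    rw [e0] at hsign
    rcases pos_and_pos_or_neg_and_neg_of_mul_pos hsign with ⟨h1, h2⟩ | ⟨h1, h2⟩
    · rw [abs_of_pos h1, abs_of_pos h2, div_self h1.ne', div_self h2.ne']
    · rw [abs_of_neg h1, abs_of_neg h2, neg_div, div_neg, div_self h1.ne, div_self h2.ne]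
  have : (phi q p).eval x = |(phi q p).eval x| * (|(derivative (discr p q)).eval x| /
      (derivative (discr p q)).eval x) := by
    rw [← sgn, mul_div_cancel₀ _ (abs_ne_zero.2 hb)]
  have hb' := abs_ne_zero.2 hb
  nth_rw 2 [this]
  field_simp

/-- The spectral representation space of `J(q)`. -/
abbrev SpecSpace (p : ℕ) (q : ℤ → ℝ) : Type := Lp C2 2 (volume.restrict (bandSet p q))

theorem memLp_blochVec (n : ℤ) : MemLp (blochVec p q n) 2 (volume.restrict (bandSet p q)) := by
  rw [memLp_two_iff_integrable_sq_norm (measurable_blochVec p q n).aestronglyMeasurable]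
  have := (integrableOn_kernel hq n n).const_mul (2 * Real.pi)⁻¹
  refine IntegrableOn.congr_fun this (fun x hx => ?_) (measurableSet_bandSet p q)
  have h := inner_blochVec hq hx n n
  rw [inner_self_eq_norm_sq_to_K] at h
  apply Complex.ofReal_injective
  refine h.symm.trans ?_
  rw [Complex.ofReal_pow]
  rfl

/-- The Bloch vectors as elements of the spectral representation space. -/
def blochLp (n : ℤ) : SpecSpace p q := (memLp_blochVec hq n).toLp

theorem inner_blochLp (n : ℤ) (g : SpecSpace p q) :
    inner ℂ (blochLp hq n) g = ∫ x in bandSet p q, inner ℂ (blochVec p q n x) (g x) := by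
  rw [L2.inner_def]
  refine integral_congr_ae ?_
  filter_upwards [(memLp_blochVec hq n).coeFn_toLp] with x hx
  rw [blochLp, hx]

theorem orthonormal_blochLp : Orthonormal ℂ (blochLp hq) := by
  rw [orthonormal_iff_ite]
  intro m n
  rw [inner_blochLp]
  have : ∫ x in bandSet p q, inner ℂ (blochVec p q m x) (blochLp hq n x) =
      ∫ x in bandSet p q, (((2 * Real.pi)⁻¹ * (|(derivative (discr p q)).eval x| *
      ((formKernel p q m n).eval x / (derivative (discr p q)).eval x *
        chebWeight ((discr p q).eval x))) : ℝ) : ℂ) := by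
    refine integral_congr_ae ?_
    filter_upwards [(memLp_blochVec hq n).coeFn_toLp,
      ae_restrict_mem (measurableSet_bandSet p q)] with x hx hx'
    rw [blochLp, hx, inner_blochVec hq hx']
  rw [this, integral_complex_ofReal, integral_const_mul, integral_kernel hq]
  split_ifs
  · rw [inv_mul_cancel₀ (by positivity)]; simp
  · simp

theorem bandSet_subset_Icc : bandSet p q ⊆ Set.Icc (zPlus p q 0) (zMinus p q p) := by
  intro x hx
  by_contra h
  rw [Set.mem_Icc, not_and_or, not_le, not_le] at h
  simp only [bandSet, Set.mem_ofPred_eq] at hx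
  rcases h with h | h
  · exact absurd hx (not_lt.2 (discr_sq_gt_of_lt hq h).le)
  · exact absurd hx (not_lt.2 (discr_sq_gt_of_gt hq h).le)

theorem restrict_bandSet_compl_Icc :
    volume.restrict (bandSet p q) (Set.Icc (zPlus p q 0) (zMinus p q p))ᶜ = 0 := by
  rw [Measure.restrict_apply measurableSet_Icc.compl]
  have : (Set.Icc (zPlus p q 0) (zMinus p q p))ᶜ ∩ bandSet p q = ∅ := by
    rw [← Set.disjoint_iff_inter_eq_empty]
    exact Set.disjoint_compl_left_iff_subset.2 (bandSet_subset_Icc hq)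
  rw [this, measure_empty]

/-- If `g` is orthogonal to all Bloch vectors, the recurrence trades a factor `x` for neighbouring
sites, so all moments of `⟨blochVec n x, g x⟩` vanish and this function is zero almost everywhere.
The vectors at `n = 0, 1` already span `ℂ²`: the one at `0` has no second component, the one at `1`
a nonzero one. -/
theorem span_blochLp_orthogonal : (Submodule.span ℂ (Set.range (blochLp hq)))ᗮ = ⊥ := by
  rw [Submodule.eq_bot_iff]
  intro g hg
  have hg0 : ∀ n, ∫ x in bandSet p q, inner ℂ (blochVec p q n x) (g x) = 0 := fun n => by
    rw [← inner_blochLp hq]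
    exact (Submodule.mem_orthogonal _ _).1 hg _ (Submodule.subset_span ⟨n, rfl⟩)
  have int : ∀ n, Integrable (fun x => inner ℂ (blochVec p q n x) (g x))
      (volume.restrict (bandSet p q)) := fun n => by
    refine (L2.integrable_inner (𝕜 := ℂ) (blochLp hq n) g).congr ?_
    filter_upwards [(memLp_blochVec hq n).coeFn_toLp] with x hx
    rw [blochLp, hx]
  have hμ := restrict_bandSet_compl_Icc hq
  have int' := fun n (j : ℕ) => integrable_continuous_smul hμ (int n) (continuous_pow j)
  have mom : ∀ (j : ℕ) n, ∫ x in bandSet p q, x ^ j • inner ℂ (blochVec p q n x) (g x) = 0 := by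
    intro j
    induction j with
    | zero => simpa using hg0
    | succ j ih =>
      intro n
      have e : ∀ x, x ^ (j + 1) • inner ℂ (blochVec p q n x) (g x) =
          x ^ j • inner ℂ (blochVec p q (n + 1) x) (g x) +
          x ^ j • inner ℂ (blochVec p q (n - 1) x) (g x) +
          (q n : ℂ) * (x ^ j • inner ℂ (blochVec p q n x) (g x)) := by
        intro x
        have h := congrArg (fun u => inner ℂ u (g x)) (blochVec_recurrence p q n x)
        simp only [inner_add_left, inner_smul_left, Complex.conj_ofReal] at h
        simp only [Complex.real_smul, Complex.ofReal_pow, Complex.ofReal_mul, pow_succ]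
        linear_combination (x : ℂ) ^ j * h
      simp only [e]
      rw [integral_add_add_const_mul (int' _ _) (int' _ _) (int' _ _), ih, ih, ih]
      simp
  have z := fun n => ae_eq_zero_of_moments hμ (int n) (fun j => mom j n)
  rw [Lp.eq_zero_iff_ae_eq_zero]
  filter_upwards [z 0, z 1, ae_restrict_mem (measurableSet_bandSet p q)] with x h0 h1 hx
  have hs := sinQuasi_pos hx
  have hb := phi_period_ne_zero hq hx
  have hsc : blochScale p q x ≠ 0 := by
    have : 0 < |(phi q p).eval x| := abs_pos.2 hb
    exact (inv_pos.2 (Real.sqrt_pos.2 (by positivity))).ne'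
  simp only [blochVec, PiLp.inner_apply, Fin.sum_univ_two, blochFst, blochSnd, theta_zero,
    phi_zero, theta_one, phi_one, Pi.zero_apply, eval_one, eval_zero, mul_one, mul_zero, add_zero,
    zero_add, RCLike.inner_apply] at h0 h1
  have g0 : g x 0 = 0 := by simpa [hsc, hb] using h0
  have g1 : g x 1 = 0 := by simpa [hsc, hs.ne', g0] using h1
  ext i
  fin_cases i
  · exact g0
  · exact g1

/-- The Hilbert basis of Bloch vectors. -/
def blochBasis : HilbertBasis ℤ ℂ (SpecSpace p q) :=
  HilbertBasis.mkOfOrthogonalEqBot (orthonormal_blochLp hq) (span_blochLp_orthogonal hq)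

theorem blochBasis_repr (g : SpecSpace p q) (n : ℤ) :
    (blochBasis hq).repr g n = ∫ x in bandSet p q, inner ℂ (blochVec p q n x) (g x) := by
  rw [HilbertBasis.repr_apply_apply, ← inner_blochLp hq, blochBasis,
    HilbertBasis.coe_mkOfOrthogonalEqBot]

/-- In the Bloch basis, multiplication by `x` acts as the Schrödinger operator. -/
theorem blochBasis_repr_mul {g h : SpecSpace p q}
    (hgh : h =ᵐ[volume.restrict (bandSet p q)] fun x => (x : ℂ) • g x) (n : ℤ) :
    (blochBasis hq).repr h n = (blochBasis hq).repr g (n + 1) + (blochBasis hq).repr g (n - 1) +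
      (q n : ℂ) * (blochBasis hq).repr g n := by
  have int : ∀ n, Integrable (fun x => inner ℂ (blochVec p q n x) (g x))
      (volume.restrict (bandSet p q)) := fun n => by
    refine (L2.integrable_inner (𝕜 := ℂ) (blochLp hq n) g).congr ?_
    filter_upwards [(memLp_blochVec hq n).coeFn_toLp] with x hx
    rw [blochLp, hx]
  simp only [blochBasis_repr hq]
  rw [← integral_add_add_const_mul (int _) (int _) (int _)]
  refine integral_congr_ae ?_
  filter_upwards [hgh] with x hx
  have h := congrArg (fun u => inner ℂ u (g x)) (blochVec_recurrence p q n x)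
  simp only [inner_add_left, inner_smul_left, Complex.conj_ofReal] at h
  rw [hx, inner_smul_right, h]

end Basis

end Armchair
end


noncomputable section

set_option linter.unusedSectionVars false

namespace Armchair

/-! ## Lebesgue spaces of vector functions on the line -/

section LpTools

variable {F F' : Type} [NormedAddCommGroup F] [InnerProductSpace ℂ F]
  [NormedAddCommGroup F'] [InnerProductSpace ℂ F']

theorem lp_two_norm_sq {ν : Measure ℝ} (g : Lp F 2 ν) : ‖g‖ ^ 2 = ∫ x, ‖g x‖ ^ 2 ∂ν := by
  have := L2.inner_def (𝕜 := ℂ) g g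
  simp only [inner_self_eq_norm_sq_to_K] at this
  rw [← @RCLike.ofReal_inj ℂ, ← integral_ofReal]
  push_cast
  exact this

theorem integrable_norm_sq {ν : Measure ℝ} (g : Lp F 2 ν) : Integrable (fun x => ‖g x‖ ^ 2) ν :=
  (memLp_two_iff_integrable_sq_norm (Lp.aestronglyMeasurable g)).1 (Lp.memLp g)

theorem exists_continuous_smul_Lp {ν : Measure ℝ} {a b : ℝ} (hν : ν (Set.Icc a b)ᶜ = 0)
    {φ : ℝ → ℝ} (hφ : Continuous φ) (g : Lp F 2 ν) :
    ∃ h : Lp F 2 ν, h =ᵐ[ν] fun x => (φ x : ℂ) • g x := by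
  obtain ⟨C, hC⟩ := isCompact_Icc.exists_bound_of_continuousOn (s := Set.Icc a b) hφ.continuousOn
  have : MemLp (fun x => (φ x : ℂ) • g x) 2 ν := by
    refine MemLp.of_le_mul (g := g) (c := C) (Lp.memLp g)
      ((Complex.continuous_ofReal.comp hφ).aestronglyMeasurable.smul (Lp.aestronglyMeasurable g)) ?_
    filter_upwards [show ∀ᵐ x ∂ν, x ∈ Set.Icc a b from hν] with x hx
    rw [norm_smul, Complex.norm_real]
    exact mul_le_mul_of_nonneg_right (hC x hx) (norm_nonneg _)
  exact ⟨this.toLp, this.coeFn_toLp⟩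

theorem memLp_transplant {ν ν' : Measure ℝ} {D : Set ℝ} (hD : MeasurableSet D)
    (hle : ν'.restrict D ≤ ν) (L : F →L[ℂ] F') (g : Lp F 2 ν) :
    MemLp (D.indicator fun x => L (g x)) 2 ν' :=
  (memLp_indicator_iff_restrict hD).2 ((L.comp_memLp' (Lp.memLp g)).mono_measure hle)

/-- Restriction to `D`, followed by a linear map of the values, between Lebesgue spaces. -/
def transplant {ν ν' : Measure ℝ} {D : Set ℝ} (hD : MeasurableSet D)
    (hle : ν'.restrict D ≤ ν) (L : F →L[ℂ] F') : Lp F 2 ν →ₗ[ℂ] Lp F' 2 ν' where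
  toFun g := (memLp_transplant hD hle L g).toLp
  map_add' g h := by
    rw [← MemLp.toLp_add, MemLp.toLp_eq_toLp_iff]
    have := (ae_restrict_iff' hD).1 (ae_mono hle (Lp.coeFn_add g h))
    filter_upwards [this] with x hx
    by_cases hxD : x ∈ D
    · simp only [Set.indicator_of_mem hxD, Pi.add_apply, hx hxD, map_add]
    · simp [hxD]
  map_smul' c g := by
    rw [RingHom.id_apply, ← MemLp.toLp_const_smul, MemLp.toLp_eq_toLp_iff]
    have := (ae_restrict_iff' hD).1 (ae_mono hle (Lp.coeFn_smul c g))
    filter_upwards [this] with x hx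
    by_cases hxD : x ∈ D
    · simp only [Set.indicator_of_mem hxD, Pi.smul_apply, hx hxD, map_smul]
    · simp [hxD]

theorem transplant_ae {ν ν' : Measure ℝ} {D : Set ℝ} (hD : MeasurableSet D)
    (hle : ν'.restrict D ≤ ν) (L : F →L[ℂ] F') (g : Lp F 2 ν) :
    transplant hD hle L g =ᵐ[ν'] D.indicator fun x => L (g x) :=
  (memLp_transplant hD hle L g).coeFn_toLp

end LpTools

/-! ## Symmetric operators: the spectrum and approximate eigenvectors -/

section Spectrum

variable {E : Type} [NormedAddCommGroup E] [InnerProductSpace ℂ E] [CompleteSpace E]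

/-- A lower bound makes `l - A` injective with closed range; by symmetry the orthogonal complement
of the range is the kernel, hence zero, so the range is everything. -/
theorem notMem_spectrum_iff {A : E →L[ℂ] E} (hA : ∀ f g, inner ℂ (A f) g = inner ℂ f (A g))
    (l : ℝ) : l ∉ spectrum ℝ A ↔ ∃ ε > 0, ∀ f, ε * ‖f‖ ≤ ‖A f - (l : ℂ) • f‖ := by
  have hT : ∀ f, (algebraMap ℝ (E →L[ℂ] E) l - A) f = (l : ℂ) • f - A f := fun f => by
    simp [Algebra.algebraMap_eq_smul_one]
  set T : E →L[ℂ] E := algebraMap ℝ (E →L[ℂ] E) l - A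
  have hsym : ∀ f g, inner ℂ (T f) g = inner ℂ f (T g) := fun f g => by
    rw [hT, hT, inner_sub_left, inner_sub_right, inner_smul_left, inner_smul_right, hA,
      Complex.conj_ofReal]
  rw [spectrum.notMem_iff]
  change IsUnit T ↔ _
  constructor
  · rintro ⟨u, hu⟩
    refine ⟨(‖(↑u⁻¹ : E →L[ℂ] E)‖ + 1)⁻¹, by positivity, fun f => ?_⟩
    have h1 : (↑u⁻¹ : E →L[ℂ] E) (T f) = f := by
      rw [← hu, ← mul_apply_eq_comp, Units.inv_mul, one_apply_eq_self]
    have h2 := (↑u⁻¹ : E →L[ℂ] E).le_opNorm (T f)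
    rw [h1, hT, norm_sub_rev] at h2
    rw [inv_mul_le_iff₀ (by positivity)]
    nlinarith [norm_nonneg (A f - (l : ℂ) • f)]
  · rintro ⟨ε, hε, h⟩
    have hb : ∀ f, ‖f‖ ≤ ε⁻¹ * ‖T f‖ := fun f => by
      rw [hT, norm_sub_rev, le_inv_mul_iff₀ hε]
      exact h f
    have anti : AntilipschitzWith ⟨ε⁻¹, (inv_pos.2 hε).le⟩ T :=
      ContinuousLinearMap.antilipschitz_of_bound T hb
    rw [ContinuousLinearMap.isUnit_iff_bijective]
    refine ⟨anti.injective, ?_⟩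
    have closed : IsClosed (Set.range T) := anti.isClosed_range T.uniformContinuous
    have top : (LinearMap.range T.toLinearMap).topologicalClosure = ⊤ := by
      rw [Submodule.topologicalClosure_eq_top_iff, Submodule.eq_bot_iff]
      intro f hf
      refine anti.injective ?_
      rw [map_zero, ← inner_self_eq_zero (𝕜 := ℂ), hsym]
      rw [← inner_conj_symm]
      have := (Submodule.mem_orthogonal _ _).1 hf (T (T f)) ⟨T f, rfl⟩
      rw [this, map_zero]
    have e : (LinearMap.range T.toLinearMap).topologicalClosure = LinearMap.range T.toLinearMap :=
      IsClosed.submodule_topologicalClosure_eq closed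
    rw [e] at top
    exact LinearMap.range_eq_top.1 top

theorem spectrum_subset_Icc {A : E →L[ℂ] E} (hA : ∀ f g, inner ℂ (A f) g = inner ℂ f (A g)) :
    spectrum ℝ A ⊆ Set.Icc (-‖A‖) ‖A‖ := by
  intro l hl
  rw [Set.mem_Icc, ← abs_le]
  by_contra! h
  refine ((notMem_spectrum_iff hA l).2 ⟨|l| - ‖A‖, sub_pos.2 h, fun f => ?_⟩) hl
  have h1 := norm_sub_norm_le ((l : ℂ) • f) (A f)
  rw [norm_smul, Complex.norm_real, Real.norm_eq_abs] at h1
  have h2 := A.le_opNorm f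
  rw [norm_sub_rev]
  linarith

end Spectrum

/-! ## Operators with two bands of Lebesgue spectrum -/

section Model

variable {E : Type} [NormedAddCommGroup E] [InnerProductSpace ℂ E] [CompleteSpace E]

/-- A symmetric operator `A` which is the orthogonal sum of the multiplications by `x` in
`L²(B₁; ℂ²)` and `L²(B₂; ℂ²)` and of a remainder. -/
structure TwoBandModel (A : E →L[ℂ] E) (B₁ B₂ : Set ℝ) where
  symm : ∀ f g, inner ℂ (A f) g = inner ℂ f (A g)
  open₁ : IsOpen B₁
  open₂ : IsOpen B₂
  null₁ : volume (closure B₁ \ B₁) = 0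
  null₂ : volume (closure B₂ \ B₂) = 0
  bdd : ∃ a b, B₁ ⊆ Set.Icc a b ∧ B₂ ⊆ Set.Icc a b
  W₁ : Lp C2 2 (volume.restrict B₁) →ₗᵢ[ℂ] E
  W₂ : Lp C2 2 (volume.restrict B₂) →ₗᵢ[ℂ] E
  rest : Submodule ℂ E
  mul₁ : ∀ g h : Lp C2 2 (volume.restrict B₁),
    h =ᵐ[volume.restrict B₁] (fun x => (x : ℂ) • g x) → A (W₁ g) = W₁ h
  mul₂ : ∀ g h : Lp C2 2 (volume.restrict B₂),
    h =ᵐ[volume.restrict B₂] (fun x => (x : ℂ) • g x) → A (W₂ g) = W₂ h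
  map_rest : ∀ f ∈ rest, A f ∈ rest
  orth : ∀ g₁ g₂, inner ℂ (W₁ g₁) (W₂ g₂) = 0
  orth₁ : ∀ g, ∀ f ∈ rest, inner ℂ (W₁ g) f = 0
  orth₂ : ∀ g, ∀ f ∈ rest, inner ℂ (W₂ g) f = 0
  decomp : ∀ f, ∃ g₁ g₂, ∃ r ∈ rest, f = W₁ g₁ + W₂ g₂ + r

theorem norm_sq_add_add {a b c : E} (hab : inner ℂ a b = 0) (hac : inner ℂ a c = 0)
    (hbc : inner ℂ b c = 0) : ‖a + b + c‖ ^ 2 = ‖a‖ ^ 2 + ‖b‖ ^ 2 + ‖c‖ ^ 2 := by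
  have h1 := norm_add_sq_eq_norm_sq_add_norm_sq_of_inner_eq_zero (𝕜 := ℂ) (a + b) c
    (by rw [inner_add_left, hac, hbc, add_zero])
  have h2 := norm_add_sq_eq_norm_sq_add_norm_sq_of_inner_eq_zero (𝕜 := ℂ) a b hab
  simp only [sq] at *
  rw [h1, h2]

theorem restrict_compl_Icc {B : Set ℝ} {a b : ℝ} (h : B ⊆ Set.Icc a b) :
    volume.restrict B (Set.Icc a b)ᶜ = 0 := by
  rw [Measure.restrict_apply measurableSet_Icc.compl, Set.disjoint_iff_inter_eq_empty.1
    (Set.disjoint_compl_left_iff_subset.2 h), measure_empty]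

/-- Powers of an operator that is unitarily equivalent to multiplication by `x`. -/
theorem exists_pow_apply {A : E →L[ℂ] E} {B : Set ℝ} {a b : ℝ} (hB : B ⊆ Set.Icc a b)
    (W : Lp C2 2 (volume.restrict B) →ₗᵢ[ℂ] E)
    (hW : ∀ g h : Lp C2 2 (volume.restrict B),
      h =ᵐ[volume.restrict B] (fun x => (x : ℂ) • g x) → A (W g) = W h) (c : ℝ)
    (g : Lp C2 2 (volume.restrict B)) (n : ℕ) : ∃ h : Lp C2 2 (volume.restrict B),
      h =ᵐ[volume.restrict B] (fun x => ((x - c : ℝ) : ℂ) ^ n • g x) ∧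
        ((A - (c : ℂ) • 1) ^ n) (W g) = W h := by
  induction n with
  | zero => exact ⟨g, by simp, by simp⟩
  | succ n ih =>
    obtain ⟨h, h1, h2⟩ := ih
    obtain ⟨k, hk⟩ := exists_continuous_smul_Lp (restrict_compl_Icc hB) continuous_id h
    refine ⟨k - (c : ℂ) • h, ?_, ?_⟩
    · filter_upwards [h1, hk, Lp.coeFn_sub k ((c : ℂ) • h), Lp.coeFn_smul (c : ℂ) h]
        with x e1 e2 e3 e4
      rw [e3, Pi.sub_apply, e2, e4, Pi.smul_apply, e1, pow_succ', id, mul_smul,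
        Complex.ofReal_sub, sub_smul]
    · rw [pow_succ', mul_apply_eq_comp, h2]
      rw [sub_apply, smul_apply, one_apply_eq_self,
        hW h k hk, map_sub, map_smul]

namespace TwoBandModel

variable {A : E →L[ℂ] E} {B₁ B₂ : Set ℝ}

/-- The same model with the two bands exchanged. -/
def swap (M : TwoBandModel A B₁ B₂) : TwoBandModel A B₂ B₁ where
  symm := M.symm
  open₁ := M.open₂
  open₂ := M.open₁
  null₁ := M.null₂
  null₂ := M.null₁
  bdd := let ⟨a, b, h⟩ := M.bdd; ⟨a, b, h.2, h.1⟩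
  W₁ := M.W₂
  W₂ := M.W₁
  rest := M.rest
  mul₁ := M.mul₂
  mul₂ := M.mul₁
  map_rest := M.map_rest
  orth g₁ g₂ := by rw [← inner_conj_symm, M.orth, map_zero]
  orth₁ := M.orth₂
  orth₂ := M.orth₁
  decomp f := by
    obtain ⟨g₁, g₂, r, hr, h⟩ := M.decomp f
    exact ⟨g₂, g₁, r, hr, by rw [h, add_comm (M.W₁ g₁)]⟩

/-- Approximate eigenvectors: the indicator of the part of the band within `ε / 2` of `l`. That part
is open and nonempty, hence of positive measure. -/
theorem closure_subset_spectrum (M : TwoBandModel A B₁ B₂) : closure B₁ ⊆ spectrum ℝ A := by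
  intro l hl
  by_contra h
  obtain ⟨ε, hε, h⟩ := (notMem_spectrum_iff M.symm l).1 h
  obtain ⟨x, hx⟩ := mem_closure_iff.1 hl (Set.Ioo (l - ε / 2) (l + ε / 2)) isOpen_Ioo
    (by constructor <;> linarith)
  set V := Set.Ioo (l - ε / 2) (l + ε / 2) ∩ B₁ with hV
  have oV : IsOpen V := isOpen_Ioo.inter M.open₁
  have posV : volume V ≠ 0 := (oV.measure_pos volume ⟨x, hx⟩).ne'
  have finV : volume V ≠ ∞ :=
    ((measure_mono Set.inter_subset_left).trans_lt measure_Ioo_lt_top).ne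
  have eV : volume.restrict B₁ V = volume V := by
    rw [Measure.restrict_apply oV.measurableSet, hV, Set.inter_assoc, Set.inter_self]
  set e : C2 := EuclideanSpace.single 0 1
  have he : ‖e‖ = 1 := by simp [e]
  set g : Lp C2 2 (volume.restrict B₁) :=
    indicatorConstLp 2 oV.measurableSet (by rw [eV]; exact finV) e with hg
  have gpos : 0 < ‖g‖ := by
    rw [hg, norm_indicatorConstLp (by norm_num) (by norm_num), he, one_mul, Measure.real, eV]
    exact Real.rpow_pos_of_pos (ENNReal.toReal_pos posV finV) _
  obtain ⟨a, b, hB, -⟩ := M.bdd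
  obtain ⟨k, hk⟩ := exists_continuous_smul_Lp (restrict_compl_Icc hB) continuous_id g
  have h1 := h (M.W₁ g)
  rw [M.mul₁ g k hk, ← map_smul, ← map_sub, LinearIsometry.norm_map, LinearIsometry.norm_map] at h1
  have h2 : ‖k - (l : ℂ) • g‖ ≤ ε / 2 * ‖g‖ := by
    refine Lp.norm_le_mul_norm_of_ae_le_mul ?_
    filter_upwards [hk, Lp.coeFn_sub k ((l : ℂ) • g), Lp.coeFn_smul (l : ℂ) g,
      indicatorConstLp_coeFn (p := 2) (hs := oV.measurableSet)
        (hμs := (by rw [eV]; exact finV : volume.restrict B₁ V ≠ ∞)) (c := e)] with x e1 e2 e3 e4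
    rw [e2, Pi.sub_apply, e1, e3, Pi.smul_apply, ← sub_smul, norm_smul, id, ← Complex.ofReal_sub,
      Complex.norm_real, Real.norm_eq_abs]
    by_cases hx : x ∈ V
    · refine mul_le_mul_of_nonneg_right ?_ (norm_nonneg _)
      rw [abs_le]
      constructor <;> linarith [hx.1.1, hx.1.2]
    · rw [hg, e4]
      simp [hx]
  nlinarith

theorem norm_sub_smul_ge {B : Set ℝ} {W : Lp C2 2 (volume.restrict B) →ₗᵢ[ℂ] E} {a b : ℝ}
    (hB : MeasurableSet B) (hab : B ⊆ Set.Icc a b)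
    (hW : ∀ g h : Lp C2 2 (volume.restrict B),
      h =ᵐ[volume.restrict B] (fun x => (x : ℂ) • g x) → A (W g) = W h) {l : ℝ}
    (hl : l ∉ closure B) : ∃ d > 0, ∀ g, d * ‖g‖ ≤ ‖A (W g) - (l : ℂ) • W g‖ := by
  obtain ⟨d, hd, hd'⟩ := Metric.isOpen_iff.1 isClosed_closure.isOpen_compl l hl
  refine ⟨d, hd, fun g => ?_⟩
  obtain ⟨k, hk⟩ := exists_continuous_smul_Lp (restrict_compl_Icc hab) continuous_id g
  rw [hW g k hk, ← map_smul, ← map_sub, LinearIsometry.norm_map, ← le_inv_mul_iff₀ hd]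
  refine Lp.norm_le_mul_norm_of_ae_le_mul ?_
  filter_upwards [hk, Lp.coeFn_sub k ((l : ℂ) • g), Lp.coeFn_smul (l : ℂ) g,
    ae_restrict_mem hB] with x e1 e2 e3 hx
  rw [e2, Pi.sub_apply, e1, e3, Pi.smul_apply, ← sub_smul, norm_smul, id, ← Complex.ofReal_sub,
    Complex.norm_real, Real.norm_eq_abs, le_inv_mul_iff₀ hd]
  refine mul_le_mul_of_nonneg_right ?_ (norm_nonneg _)
  by_contra! h
  exact hd' (by rwa [Metric.mem_ball, Real.dist_eq]) (subset_closure hx)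

theorem norm_sq_decomp (M : TwoBandModel A B₁ B₂) (g₁ : Lp C2 2 (volume.restrict B₁))
    (g₂ : Lp C2 2 (volume.restrict B₂)) {r : E} (hr : r ∈ M.rest) :
    ‖M.W₁ g₁ + M.W₂ g₂ + r‖ ^ 2 = ‖g₁‖ ^ 2 + ‖g₂‖ ^ 2 + ‖r‖ ^ 2 := by
  rw [norm_sq_add_add (M.orth _ _) (M.orth₁ _ _ hr) (M.orth₂ _ _ hr), LinearIsometry.norm_map,
    LinearIsometry.norm_map]

variable (M : TwoBandModel A B₁ B₂) {K : Set ℝ} {c s ρ : ℝ}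

/-- Away from the remainder's spectrum, the spectrum is the union of the closed bands. -/
theorem spectrum_inter (hs : ∀ f ∈ M.rest, s * ‖f‖ ≤ ‖A f - (c : ℂ) • f‖) (hρ : ρ < s)
    (hK : K ⊆ Metric.closedBall c ρ) : spectrum ℝ A ∩ K = (closure B₁ ∪ closure B₂) ∩ K := by
  obtain ⟨a, b, hB₁, hB₂⟩ := M.bdd
  apply Set.Subset.antisymm
  · rintro l ⟨hl, hlK⟩
    refine ⟨?_, hlK⟩
    by_contra hne
    rw [Set.mem_union, not_or] at hne
    refine (notMem_spectrum_iff M.symm l).2 ?_ hl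
    obtain ⟨d₁, hd₁, h₁⟩ := norm_sub_smul_ge M.open₁.measurableSet hB₁ M.mul₁ hne.1
    obtain ⟨d₂, hd₂, h₂⟩ := norm_sub_smul_ge M.open₂.measurableSet hB₂ M.mul₂ hne.2
    -- The bound on the remainder is known at the centre `c`; moving to `l` costs at most `ρ < s`.
    have h₃ : ∀ f ∈ M.rest, (s - ρ) * ‖f‖ ≤ ‖A f - (l : ℂ) • f‖ := by
      intro f hf
      have e : A f - (c : ℂ) • f = (A f - (l : ℂ) • f) + ((l - c : ℝ) : ℂ) • f := by
        rw [Complex.ofReal_sub, sub_smul]; abel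
      have h1 := hs f hf
      have h2 := norm_add_le (A f - (l : ℂ) • f) (((l - c : ℝ) : ℂ) • f)
      rw [← e, norm_smul, Complex.norm_real, Real.norm_eq_abs] at h2
      have h3 : |l - c| ≤ ρ := by simpa [Real.dist_eq] using hK hlK
      have := mul_le_mul_of_nonneg_right h3 (norm_nonneg f)
      linarith
    set d := min (min d₁ d₂) (s - ρ)
    have hd : 0 < d := lt_min (lt_min hd₁ hd₂) (sub_pos.2 hρ)
    refine ⟨d, hd, fun f => ?_⟩
    obtain ⟨g₁, g₂, r, hr, rfl⟩ := M.decomp f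
    obtain ⟨k₁, hk₁⟩ := exists_continuous_smul_Lp (restrict_compl_Icc hB₁) continuous_id g₁
    obtain ⟨k₂, hk₂⟩ := exists_continuous_smul_Lp (restrict_compl_Icc hB₂) continuous_id g₂
    have b₁ := h₁ g₁
    have b₂ := h₂ g₂
    rw [M.mul₁ _ _ hk₁, ← map_smul, ← map_sub, LinearIsometry.norm_map] at b₁
    rw [M.mul₂ _ _ hk₂, ← map_smul, ← map_sub, LinearIsometry.norm_map] at b₂
    have b₃ := h₃ r hr
    have e : A (M.W₁ g₁ + M.W₂ g₂ + r) - (l : ℂ) • (M.W₁ g₁ + M.W₂ g₂ + r) =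
        M.W₁ (k₁ - (l : ℂ) • g₁) + M.W₂ (k₂ - (l : ℂ) • g₂) + (A r - (l : ℂ) • r) := by
      simp only [map_add, M.mul₁ _ _ hk₁, M.mul₂ _ _ hk₂, map_sub, map_smul, smul_add]
      abel
    have hr' : A r - (l : ℂ) • r ∈ M.rest :=
      M.rest.sub_mem (M.map_rest r hr) (M.rest.smul_mem _ hr)
    have le : ∀ {t x y : ℝ}, d ≤ t → 0 ≤ x → t * x ≤ y → (d * x) ^ 2 ≤ y ^ 2 :=
      fun ht hx hy => pow_le_pow_left₀ (mul_nonneg hd.le hx)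
        ((mul_le_mul_of_nonneg_right ht hx).trans hy) 2
    refine abs_le_of_sq_le_sq' ?_ (norm_nonneg _) |>.2
    rw [e, mul_pow, M.norm_sq_decomp _ _ hr', M.norm_sq_decomp _ _ hr]
    have c₁ := le ((min_le_left _ _).trans (min_le_left _ _)) (norm_nonneg _) b₁
    have c₂ := le ((min_le_left _ _).trans (min_le_right _ _)) (norm_nonneg _) b₂
    have c₃ := le (min_le_right _ _) (norm_nonneg _) b₃
    simp only [mul_pow] at c₁ c₂ c₃
    linarith
  · rintro l ⟨hl | hl, hlK⟩
    · exact ⟨M.closure_subset_spectrum hl, hlK⟩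
    · exact ⟨M.swap.closure_subset_spectrum hl, hlK⟩

end TwoBandModel

end Model

end Armchair
end


noncomputable section

set_option linter.unusedSectionVars false

namespace Armchair

/-! ## Spectral subspaces and multiplicities -/

section SpecMeasure

variable {B : Set ℝ}

/-- The measure `‖g‖² dx` on `B`. -/
def densityMeasure (g : Lp C2 2 (volume.restrict B)) : Measure ℝ :=
  (volume.restrict B).withDensity fun x => ENNReal.ofReal (‖g x‖ ^ 2)

theorem aemeasurable_density (g : Lp C2 2 (volume.restrict B)) :
    AEMeasurable (fun x => ENNReal.ofReal (‖g x‖ ^ 2)) (volume.restrict B) :=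
  ((Lp.aestronglyMeasurable g).norm.aemeasurable.pow_const 2).ennreal_ofReal

instance (g : Lp C2 2 (volume.restrict B)) : IsFiniteMeasure (densityMeasure g) :=
  isFiniteMeasure_withDensity_ofReal (integrable_norm_sq g).2

theorem densityMeasure_absolutelyContinuous (g : Lp C2 2 (volume.restrict B)) :
    densityMeasure g ≪ volume.restrict B := withDensity_absolutelyContinuous _ _

theorem integral_densityMeasure (g : Lp C2 2 (volume.restrict B)) (φ : ℝ → ℝ) :
    ∫ x, φ x ∂densityMeasure g = ∫ x in B, φ x * ‖g x‖ ^ 2 := by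
  rw [densityMeasure, integral_withDensity_eq_integral_toReal_smul₀ (aemeasurable_density g)
    (.of_forall fun x => ENNReal.ofReal_lt_top)]
  refine integral_congr_ae (.of_forall fun x => ?_)
  simp only [smul_eq_mul, ENNReal.toReal_ofReal (sq_nonneg ‖g x‖)]
  ring

theorem densityMeasure_compl_eq_zero {S : Set ℝ} (g : Lp C2 2 (volume.restrict B)) :
    densityMeasure g Sᶜ = 0 ↔ ∀ᵐ x ∂volume.restrict B, x ∉ S → g x = 0 := by
  rw [densityMeasure, withDensity_apply_eq_zero' (aemeasurable_density g), ae_iff]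
  have : {x | ENNReal.ofReal (‖g x‖ ^ 2) ≠ 0} ∩ Sᶜ = {x | ¬(x ∉ S → g x = 0)} := by
    ext x
    simp only [Set.mem_inter_iff, Set.mem_ofPred_eq, Set.mem_compl_iff, ne_eq,
      ENNReal.ofReal_eq_zero, not_le, Classical.not_imp]
    rw [and_comm]
    refine and_congr_right fun _ => ?_
    rw [sq_pos_iff, ne_eq, norm_eq_zero]
  rw [this]

theorem inner_pow_smul {g h : Lp C2 2 (volume.restrict B)} {φ : ℝ → ℝ}
    (hh : h =ᵐ[volume.restrict B] fun x => (φ x : ℂ) • g x) :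
    inner ℂ g h = ((∫ x, φ x ∂densityMeasure g : ℝ) : ℂ) := by
  rw [integral_densityMeasure, L2.inner_def, ← integral_complex_ofReal]
  refine integral_congr_ae ?_
  filter_upwards [hh] with x hx
  rw [hx, inner_smul_right, inner_self_eq_norm_sq_to_K]
  push_cast
  rfl

end SpecMeasure

section Model

variable {E : Type} [NormedAddCommGroup E] [InnerProductSpace ℂ E] [CompleteSpace E]

theorem inner_pow_symm {T : E →L[ℂ] E} (hT : ∀ f g, inner ℂ (T f) g = inner ℂ f (T g)) (n : ℕ)
    (f g : E) : inner ℂ ((T ^ n) f) g = inner ℂ f ((T ^ n) g) := by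
  induction n generalizing f with
  | zero => simp
  | succ n ih =>
    rw [pow_succ, mul_apply_eq_comp, ih, hT, ← mul_apply_eq_comp, ← pow_succ', ← pow_succ]

/-- Moments of a spectral measure about a point `c`. -/
theorem IsSpectralMeasure.shifted_moment {A : E →L[ℂ] E} {f : E} {μ : Measure ℝ}
    (hA : ∀ f g, inner ℂ (A f) g = inner ℂ f (A g)) (h : IsSpectralMeasure A f μ) (c : ℝ) (k : ℕ) :
    inner ℂ f (((A - (c : ℂ) • 1) ^ k) f) = ((∫ x, (x - c) ^ k ∂μ : ℝ) : ℂ) := by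
  obtain ⟨hfin, hsupp, hmom⟩ := h
  have hμ : μ (Set.Icc (-‖A‖) ‖A‖)ᶜ = 0 :=
    measure_mono_null (Set.compl_subset_compl.2 (spectrum_subset_Icc hA)) hsupp
  have int : ∀ φ : ℝ → ℝ, Continuous φ → Integrable φ μ := fun φ hφ => by
    simpa using integrable_continuous_smul hμ (integrable_const (1 : ℝ)) hφ
  -- The extra factor `A ^ n` is what lets the induction on `k` close: expanding one factor `A - c`
  -- only changes `n` and `k`.
  have key : ∀ n : ℕ, inner ℂ f ((A ^ n * (A - (c : ℂ) • 1) ^ k) f) =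
      ((∫ x, x ^ n * (x - c) ^ k ∂μ : ℝ) : ℂ) := by
    induction k with
    | zero =>
      intro n
      simp only [pow_zero, mul_one]
      exact (hmom n).symm
    | succ k ih =>
      intro n
      have e : A ^ n * (A - (c : ℂ) • 1) ^ (k + 1) =
          A ^ (n + 1) * (A - (c : ℂ) • 1) ^ k - (c : ℂ) • (A ^ n * (A - (c : ℂ) • 1) ^ k) := by
        rw [pow_succ' (A - (c : ℂ) • 1) k, ← mul_assoc, mul_sub, ← pow_succ, mul_smul_comm, mul_one,
          sub_mul, smul_mul_assoc]
      rw [e, sub_apply, smul_apply, inner_sub_right, inner_smul_right, ih, ih]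
      have e2 : ∀ x : ℝ, x ^ n * (x - c) ^ (k + 1) =
          x ^ (n + 1) * (x - c) ^ k - c * (x ^ n * (x - c) ^ k) := fun x => by ring
      simp only [e2]
      rw [integral_sub (int _ (by fun_prop)) (int _ (by fun_prop)), integral_const_mul]
      push_cast
      rfl
  simpa using key 0

namespace TwoBandModel

variable {A : E →L[ℂ] E} {B₁ B₂ : Set ℝ} (M : TwoBandModel A B₁ B₂) {K S : Set ℝ} {c s ρ : ℝ}

theorem moment (g₁ : Lp C2 2 (volume.restrict B₁)) (g₂ : Lp C2 2 (volume.restrict B₂)) (n : ℕ) :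
    inner ℂ (M.W₁ g₁ + M.W₂ g₂) ((A ^ n) (M.W₁ g₁ + M.W₂ g₂)) =
      ((∫ x, x ^ n ∂(densityMeasure g₁ + densityMeasure g₂) : ℝ) : ℂ) := by
  obtain ⟨a, b, hB₁, hB₂⟩ := M.bdd
  obtain ⟨h₁, e₁, f₁⟩ := exists_pow_apply hB₁ M.W₁ M.mul₁ 0 g₁ n
  obtain ⟨h₂, e₂, f₂⟩ := exists_pow_apply hB₂ M.W₂ M.mul₂ 0 g₂ n
  simp only [Complex.ofReal_zero, zero_smul, sub_zero] at e₁ e₂ f₁ f₂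
  have int : ∀ (μ : Measure ℝ) [IsFiniteMeasure μ], μ (Set.Icc a b)ᶜ = 0 →
      Integrable (fun x => x ^ n) μ := fun μ _ hμ => by
    simpa using integrable_continuous_smul hμ (integrable_const (1 : ℝ)) (continuous_pow n)
  rw [integral_add_measure
    (int _ (densityMeasure_absolutelyContinuous _ (restrict_compl_Icc hB₁)))
    (int _ (densityMeasure_absolutelyContinuous _ (restrict_compl_Icc hB₂)))]
  have h21 : inner ℂ (M.W₂ g₂) (M.W₁ h₁) = 0 := M.swap.orth g₂ h₁
  rw [map_add, f₁, f₂, inner_add_left, inner_add_right, inner_add_right, M.orth, h21,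
    LinearIsometry.inner_map_map, LinearIsometry.inner_map_map,
    inner_pow_smul (φ := fun x => x ^ n) (by simpa using e₁),
    inner_pow_smul (φ := fun x => x ^ n) (by simpa using e₂)]
  push_cast
  ring

theorem isSpectralMeasure (g₁ : Lp C2 2 (volume.restrict B₁)) (g₂ : Lp C2 2 (volume.restrict B₂)) :
    IsSpectralMeasure A (M.W₁ g₁ + M.W₂ g₂) (densityMeasure g₁ + densityMeasure g₂) := by
  refine ⟨inferInstance, ?_, fun n => (M.moment g₁ g₂ n).symm⟩
  rw [Measure.add_apply, add_eq_zero]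
  have key : ∀ {B : Set ℝ}, B ⊆ spectrum ℝ A → volume.restrict B (spectrum ℝ A)ᶜ = 0 := by
    intro B hB
    have : MeasurableSet (spectrum ℝ A)ᶜ := by
      refine MeasurableSet.compl ?_
      have : IsClosed (spectrum ℝ A) := spectrum.isClosed (𝕜 := ℝ) A
      exact this.measurableSet
    rw [Measure.restrict_apply this, Set.disjoint_iff_inter_eq_empty.1
      (Set.disjoint_compl_left_iff_subset.2 hB), measure_empty]
  exact ⟨densityMeasure_absolutelyContinuous _
      (key (subset_closure.trans M.closure_subset_spectrum)),
    densityMeasure_absolutelyContinuous _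
      (key (subset_closure.trans M.swap.closure_subset_spectrum))⟩

/-- A vector whose spectral measure lives away from the remainder has no component there. -/
theorem rest_eq_zero (hs : ∀ f ∈ M.rest, s * ‖f‖ ≤ ‖A f - (c : ℂ) • f‖) (hρ : ρ < s)
    (hρ0 : 0 ≤ ρ) (hK : K ⊆ Metric.closedBall c ρ) {g₁ : Lp C2 2 (volume.restrict B₁)}
    {g₂ : Lp C2 2 (volume.restrict B₂)} {r : E} (hr : r ∈ M.rest) {μ : Measure ℝ}
    (hμ : IsSpectralMeasure A (M.W₁ g₁ + M.W₂ g₂ + r) μ) (hμK : μ Kᶜ = 0) : r = 0 := by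
  obtain ⟨a, b, hB₁, hB₂⟩ := M.bdd
  have hs0 : 0 < s := hρ0.trans_lt hρ
  set T : E →L[ℂ] E := A - (c : ℂ) • 1 with hT
  have Tsymm : ∀ f g, inner ℂ (T f) g = inner ℂ f (T g) := fun f g => by
    simp only [hT, sub_apply, smul_apply, one_apply_eq_self, inner_sub_left, inner_sub_right,
      inner_smul_left, inner_smul_right, M.symm, Complex.conj_ofReal]
  have Tr : ∀ n, (T ^ n) r ∈ M.rest ∧ s ^ n * ‖r‖ ≤ ‖(T ^ n) r‖ := by
    intro n
    induction n with
    | zero => simpa using hr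
    | succ n ih =>
      rw [pow_succ' T, mul_apply_eq_comp]
      have e : T ((T ^ n) r) = A ((T ^ n) r) - (c : ℂ) • (T ^ n) r := by
        simp [hT]
      refine ⟨?_, ?_⟩
      · rw [e]
        exact M.rest.sub_mem (M.map_rest _ ih.1) (M.rest.smul_mem _ ih.1)
      · rw [e]
        refine le_trans ?_ (hs _ ih.1)
        rw [pow_succ', mul_assoc]
        exact mul_le_mul_of_nonneg_left ih.2 hs0.le
  have fin : IsFiniteMeasure μ := hμ.1
  set m : ℝ := μ.real Set.univ
  -- `(A - c) ^ n` expands the remainder by at least `s ^ n`, while a spectral measure carried by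
  -- the ball of radius `ρ` lets the whole vector grow by at most `ρ ^ n`. As the components stay
  -- orthogonal, `(ρ / s) ^ (2n)` bounds `‖r‖²` up to the constant `m`.
  have bound : ∀ n : ℕ, ‖r‖ ^ 2 ≤ ((ρ / s) ^ 2) ^ n * m := by
    intro n
    obtain ⟨h₁, -, f₁⟩ := exists_pow_apply hB₁ M.W₁ M.mul₁ c g₁ n
    obtain ⟨h₂, -, f₂⟩ := exists_pow_apply hB₂ M.W₂ M.mul₂ c g₂ n
    have e1 : ‖(T ^ n) (M.W₁ g₁ + M.W₂ g₂ + r)‖ ^ 2 = ∫ x, (x - c) ^ (n + n) ∂μ := by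
      have := hμ.shifted_moment M.symm c (n + n)
      rw [← hT, pow_add, mul_apply_eq_comp, ← inner_pow_symm Tsymm, inner_self_eq_norm_sq_to_K]
        at this
      apply Complex.ofReal_injective
      rw [Complex.ofReal_pow]
      exact this
    have e2 : ‖(T ^ n) r‖ ^ 2 ≤ ‖(T ^ n) (M.W₁ g₁ + M.W₂ g₂ + r)‖ ^ 2 := by
      rw [map_add, map_add, f₁, f₂, M.norm_sq_decomp _ _ (Tr n).1]
      nlinarith [sq_nonneg ‖h₁‖, sq_nonneg ‖h₂‖]
    have e3 : ∫ x, (x - c) ^ (n + n) ∂μ ≤ (ρ ^ 2) ^ n * m := by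
      refine (le_abs_self _).trans ?_
      refine norm_integral_le_of_norm_le_const (f := fun x => (x - c) ^ (n + n)) ?_
      filter_upwards [show ∀ᵐ x ∂μ, x ∈ K from hμK] with x hx
      have : |x - c| ≤ ρ := by simpa [Real.dist_eq] using hK hx
      rw [Real.norm_eq_abs, abs_pow, ← two_mul, pow_mul]
      exact pow_le_pow_left₀ (sq_nonneg _) (pow_le_pow_left₀ (abs_nonneg _) this 2) n
    have e4 : (s ^ n * ‖r‖) ^ 2 ≤ ‖(T ^ n) r‖ ^ 2 :=
      pow_le_pow_left₀ (by positivity) (Tr n).2 2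
    have hpos : 0 < (s ^ n) ^ 2 := by positivity
    have e5 : (s ^ n) ^ 2 * ‖r‖ ^ 2 ≤ (ρ ^ 2) ^ n * m := by
      rw [← mul_pow]; linarith
    rw [div_pow, div_pow, div_mul_eq_mul_div, le_div_iff₀ (by positivity)]
    calc ‖r‖ ^ 2 * (s ^ 2) ^ n = (s ^ n) ^ 2 * ‖r‖ ^ 2 := by rw [← pow_mul, ← pow_mul]; ring_nf
      _ ≤ _ := e5
  have lim : Filter.Tendsto (fun n : ℕ => ((ρ / s) ^ 2) ^ n * m) Filter.atTop (nhds 0) := by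
    have h1 : (ρ / s) ^ 2 < 1 :=
      pow_lt_one₀ (div_nonneg hρ0 hs0.le) ((div_lt_one hs0).2 hρ) two_ne_zero
    simpa using (tendsto_pow_atTop_nhds_zero_of_lt_one (sq_nonneg _) h1).mul_const m
  have := ge_of_tendsto' lim bound
  have h0 : ‖r‖ = 0 := by nlinarith [norm_nonneg r]
  exact norm_eq_zero.1 h0

/-- The spectral subspace of a set away from the spectrum of the remainder. -/
theorem mem_spectralSubspace_iff (hs : ∀ f ∈ M.rest, s * ‖f‖ ≤ ‖A f - (c : ℂ) • f‖) (hρ : ρ < s)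
    (hρ0 : 0 ≤ ρ) (hS : S ⊆ Metric.closedBall c ρ) (f : E) :
    f ∈ spectralSubspace A S ↔ ∃ (g₁ : Lp C2 2 (volume.restrict B₁))
      (g₂ : Lp C2 2 (volume.restrict B₂)), f = M.W₁ g₁ + M.W₂ g₂ ∧
        (∀ᵐ x ∂volume.restrict B₁, x ∉ S → g₁ x = 0) ∧
        (∀ᵐ x ∂volume.restrict B₂, x ∉ S → g₂ x = 0) := by
  constructor
  · rintro ⟨μ, hμ, hμS⟩
    obtain ⟨g₁, g₂, r, hr, rfl⟩ := M.decomp f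
    have r0 := M.rest_eq_zero hs hρ hρ0 hS hr hμ hμS
    rw [r0, add_zero] at hμ ⊢
    have hm := M.isSpectralMeasure g₁ g₂
    have supp := spectrum_subset_Icc M.symm
    have f1 := hμ.1
    -- The witness in the definition of the spectral subspace is an arbitrary measure; its moments
    -- and compact support identify it.
    have eq : μ = densityMeasure g₁ + densityMeasure g₂ := by
      refine measure_ext_of_moments (a := -‖A‖) (b := ‖A‖)
        (measure_mono_null (Set.compl_subset_compl.2 supp) hμ.2.1)
        (measure_mono_null (Set.compl_subset_compl.2 supp) hm.2.1) fun n => ?_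
      exact_mod_cast (hμ.2.2 n).trans (hm.2.2 n).symm
    rw [eq, Measure.add_apply, add_eq_zero] at hμS
    exact ⟨g₁, g₂, rfl, (densityMeasure_compl_eq_zero g₁).1 hμS.1,
      (densityMeasure_compl_eq_zero g₂).1 hμS.2⟩
  · rintro ⟨g₁, g₂, rfl, h₁, h₂⟩
    refine ⟨_, M.isSpectralMeasure g₁ g₂, ?_⟩
    rw [Measure.add_apply, add_eq_zero]
    exact ⟨(densityMeasure_compl_eq_zero g₁).2 h₁, (densityMeasure_compl_eq_zero g₂).2 h₂⟩

/-- Criterion for uniform multiplicity: `D₁`, `D₂` are (up to null sets) the parts of `S` in the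
two bands, and the maps `L₁`, `L₂` split `ℂᵐ` accordingly. -/
theorem hasMultiplicity_of_split (hs : ∀ f ∈ M.rest, s * ‖f‖ ≤ ‖A f - (c : ℂ) • f‖) (hρ : ρ < s)
    (hρ0 : 0 ≤ ρ) (hS : S ⊆ Metric.closedBall c ρ) {m : ℕ} {D₁ D₂ : Set ℝ}
    (hD₁ : MeasurableSet D₁) (hD₂ : MeasurableSet D₂) (hDB₁ : D₁ ⊆ B₁) (hDB₂ : D₂ ⊆ B₂)
    (hDS₁ : D₁ ⊆ S) (hDS₂ : D₂ ⊆ S) (hn₁ : volume ((S ∩ B₁) \ D₁) = 0)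
    (hn₂ : volume ((S ∩ B₂) \ D₂) = 0) (L₁ L₂ : EuclideanSpace ℂ (Fin m) →L[ℂ] C2)
    (J₁ J₂ : C2 →L[ℂ] EuclideanSpace ℂ (Fin m)) (h₁ : ∀ v, L₁ (J₁ v) = v)
    (h₂ : ∀ v, L₂ (J₂ v) = v)
    (h₁₂ : ∀ x ∈ D₁ ∩ D₂, ∀ v, L₁ (J₂ v) = 0 ∧ L₂ (J₁ v) = 0)
    (hnorm : ∀ x ∈ D₁ ∪ D₂, ∀ v, D₁.indicator (fun _ => ‖L₁ v‖ ^ 2) x +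
      D₂.indicator (fun _ => ‖L₂ v‖ ^ 2) x = ‖v‖ ^ 2) : HasMultiplicity A S m := by
  obtain ⟨a, b, hB₁, hB₂⟩ := M.bdd
  set T := D₁ ∪ D₂ with hTdef
  have hT : MeasurableSet T := hD₁.union hD₂
  have hTab : T ⊆ Set.Icc a b := Set.union_subset (hDB₁.trans hB₁) (hDB₂.trans hB₂)
  -- Lebesgue measure on `D₁ ∪ D₂` rather than on `S`: points of `S` off the chosen parts carry no
  -- spectral mass.
  set ν : Measure ℝ := volume.restrict T with hν
  have hνfin : IsFiniteMeasure ν :=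
    ⟨by rw [hν, Measure.restrict_apply_univ]; exact (measure_mono hTab).trans_lt measure_Icc_lt_top⟩
  have le : ∀ {B D : Set ℝ}, MeasurableSet D → D ⊆ T →
      (volume.restrict B).restrict D ≤ ν := by
    intro B D hD hDT
    rw [Measure.restrict_restrict hD]
    exact Measure.restrict_mono_set _ (Set.inter_subset_left.trans hDT)
  have le' : ∀ {B D : Set ℝ}, MeasurableSet D → D ⊆ B →
      ν.restrict D ≤ volume.restrict B := by
    intro B D hD hDB
    rw [hν, Measure.restrict_restrict hD]
    exact Measure.restrict_mono_set _ (Set.inter_subset_left.trans hDB)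
  have l₁ := le (B := B₁) hD₁ Set.subset_union_left
  have l₂ := le (B := B₂) hD₂ Set.subset_union_right
  have k₁ := le' hD₁ hDB₁
  have k₂ := le' hD₂ hDB₂
  set T₁ := transplant hD₁ l₁ L₁
  set T₂ := transplant hD₂ l₂ L₂
  have norm_part : ∀ {B D : Set ℝ} (hD : MeasurableSet D) (hDB : D ⊆ B) (hDT : D ⊆ T)
      (L : EuclideanSpace ℂ (Fin m) →L[ℂ] C2) (g : Lp (EuclideanSpace ℂ (Fin m)) 2 ν),
      Integrable (fun x => D.indicator (fun x => ‖L (g x)‖ ^ 2) x) ν ∧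
      ‖transplant (ν' := volume.restrict B) hD (le hD hDT) L g‖ ^ 2 =
        ∫ x, D.indicator (fun x => ‖L (g x)‖ ^ 2) x ∂ν := by
    intro B D hD hDB hDT L g
    have i1 : Integrable (fun x => ‖L (g x)‖ ^ 2) ν :=
      (memLp_two_iff_integrable_sq_norm (L.continuous.comp_aestronglyMeasurable
        (Lp.aestronglyMeasurable g))).1 (L.comp_memLp' (Lp.memLp g))
    refine ⟨i1.indicator hD, ?_⟩
    have e : ∫ x, D.indicator (fun x => ‖L (g x)‖ ^ 2) x ∂ν =
        ∫ x in B, D.indicator (fun x => ‖L (g x)‖ ^ 2) x := by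
      have eD : ν.restrict D = (volume.restrict B).restrict D := by
        rw [hν, Measure.restrict_restrict hD, Measure.restrict_restrict hD,
          Set.inter_eq_left.2 hDT, Set.inter_eq_left.2 hDB]
      rw [integral_indicator hD, integral_indicator hD, eD]
    rw [lp_two_norm_sq, e]
    refine integral_congr_ae ?_
    filter_upwards [transplant_ae (ν' := volume.restrict B) hD (le hD hDT) L g] with x hx
    rw [hx]
    by_cases hxD : x ∈ D <;> simp [hxD]
  refine ⟨ν, hνfin, ?_, ⟨M.W₁.toLinearMap ∘ₗ T₁ + M.W₂.toLinearMap ∘ₗ T₂, fun g => ?_⟩, ?_, ?_⟩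
  · refine measure_mono_null (Set.compl_subset_compl.2 (Set.union_subset hDS₁ hDS₂)) ?_
    rw [hν, Measure.restrict_apply hT.compl, Set.compl_inter_self, measure_empty]
  · have e := M.norm_sq_decomp (T₁ g) (T₂ g) M.rest.zero_mem
    rw [add_zero, norm_zero] at e
    obtain ⟨i₁, n₁⟩ := norm_part (B := B₁) hD₁ hDB₁ Set.subset_union_left L₁ g
    obtain ⟨i₂, n₂⟩ := norm_part (B := B₂) hD₂ hDB₂ Set.subset_union_right L₂ g
    rw [n₁, n₂, ← integral_add i₁ i₂] at e
    change ‖M.W₁ (T₁ g) + M.W₂ (T₂ g)‖ = ‖g‖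
    rw [← sq_eq_sq₀ (norm_nonneg _) (norm_nonneg _), e, lp_two_norm_sq]
    simp only [ne_eq, OfNat.ofNat_ne_zero, not_false_eq_true, zero_pow, add_zero]
    refine integral_congr_ae ?_
    filter_upwards [ae_restrict_mem hT] with x hx
    rw [← hnorm x hx (g x)]
    rfl
  · ext f
    rw [M.mem_spectralSubspace_iff hs hρ hρ0 hS]
    constructor
    · rintro ⟨g, rfl⟩
      refine ⟨T₁ g, T₂ g, rfl, ?_, ?_⟩
      · filter_upwards [transplant_ae hD₁ l₁ L₁ g] with x hx hxS
        rw [hx, Set.indicator_of_notMem fun h => hxS (hDS₁ h)]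
      · filter_upwards [transplant_ae hD₂ l₂ L₂ g] with x hx hxS
        rw [hx, Set.indicator_of_notMem fun h => hxS (hDS₂ h)]
    · rintro ⟨g₁, g₂, rfl, z₁, z₂⟩
      -- The preimage glues the two components along `J₁` and `J₂`. On the overlap the ranges of
      -- `J₁` and `J₂` do not disturb each other, by `h₁₂`; off the overlap only one term is
      -- present.
      set g := transplant hD₁ k₁ J₁ g₁ + transplant hD₂ k₂ J₂ g₂ with hg
      have hgae : g =ᵐ[ν] fun x => D₁.indicator (fun x => J₁ (g₁ x)) x +
          D₂.indicator (fun x => J₂ (g₂ x)) x := by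
        filter_upwards [Lp.coeFn_add (transplant hD₁ k₁ J₁ g₁) (transplant hD₂ k₂ J₂ g₂),
          transplant_ae hD₁ k₁ J₁ g₁, transplant_ae hD₂ k₂ J₂ g₂] with x e1 e2 e3
        rw [hg, e1, Pi.add_apply, e2, e3]
      have null : ∀ {B D : Set ℝ}, MeasurableSet B → volume ((S ∩ B) \ D) = 0 →
          ∀ᵐ x ∂volume.restrict B, x ∈ S → x ∈ D := by
        intro B D hB h
        rw [ae_restrict_iff' hB, ae_iff]
        refine measure_mono_null ?_ h
        intro x hx
        simp only [Set.mem_ofPred_eq, Classical.not_imp] at hx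
        exact ⟨⟨hx.2.1, hx.1⟩, hx.2.2⟩
      have t₁ : T₁ g = g₁ := by
        refine Lp.ext ?_
        filter_upwards [transplant_ae hD₁ l₁ L₁ g, (ae_restrict_iff' hD₁).1 (ae_mono l₁ hgae),
          null M.open₁.measurableSet hn₁, z₁] with x e1 e2 e3 e4
        rw [e1]
        by_cases hx : x ∈ D₁
        · rw [Set.indicator_of_mem hx, e2 hx, Set.indicator_of_mem hx, map_add, h₁]
          by_cases hx2 : x ∈ D₂
          · rw [Set.indicator_of_mem hx2, (h₁₂ x ⟨hx, hx2⟩ _).1, add_zero]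
          · rw [Set.indicator_of_notMem hx2, map_zero, add_zero]
        · rw [Set.indicator_of_notMem hx, e4 fun h => hx (e3 h)]
      have t₂ : T₂ g = g₂ := by
        refine Lp.ext ?_
        filter_upwards [transplant_ae hD₂ l₂ L₂ g, (ae_restrict_iff' hD₂).1 (ae_mono l₂ hgae),
          null M.open₂.measurableSet hn₂, z₂] with x e1 e2 e3 e4
        rw [e1]
        by_cases hx : x ∈ D₂
        · rw [Set.indicator_of_mem hx, e2 hx, Set.indicator_of_mem hx, map_add, h₂]
          by_cases hx2 : x ∈ D₁
          · rw [Set.indicator_of_mem hx2, (h₁₂ x ⟨hx2, hx⟩ _).2, zero_add]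
          · rw [Set.indicator_of_notMem hx2, map_zero, zero_add]
        · rw [Set.indicator_of_notMem hx, e4 fun h => hx (e3 h)]
      refine ⟨g, ?_⟩
      change M.W₁ (T₁ g) + M.W₂ (T₂ g) = _
      rw [t₁, t₂]
  · intro g
    obtain ⟨h, hh⟩ := exists_continuous_smul_Lp (ν := ν) (restrict_compl_Icc hTab) continuous_id g
    refine ⟨h, hh, ?_⟩
    change A (M.W₁ (T₁ g) + M.W₂ (T₂ g)) = M.W₁ (T₁ h) + M.W₂ (T₂ h)
    have key : ∀ {B D : Set ℝ} (hD : MeasurableSet D) (hDT : D ⊆ T)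
        (L : EuclideanSpace ℂ (Fin m) →L[ℂ] C2),
        transplant (ν' := volume.restrict B) hD (le hD hDT) L h =ᵐ[volume.restrict B]
          fun x => (x : ℂ) • transplant (ν' := volume.restrict B) hD (le hD hDT) L g x := by
      intro B D hD hDT L
      filter_upwards [transplant_ae (ν' := volume.restrict B) hD (le hD hDT) L h,
        transplant_ae (ν' := volume.restrict B) hD (le hD hDT) L g,
        (ae_restrict_iff' hD).1 (ae_mono (le hD hDT) hh)] with x e1 e2 e3
      rw [e1, e2]
      by_cases hx : x ∈ D
      · rw [Set.indicator_of_mem hx, Set.indicator_of_mem hx, e3 hx, map_smul, id]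
      · rw [Set.indicator_of_notMem hx, Set.indicator_of_notMem hx, smul_zero]
    rw [map_add, M.mul₁ _ _ (key hD₁ Set.subset_union_left L₁),
      M.mul₂ _ _ (key hD₂ Set.subset_union_right L₂)]

/-- The set where exactly one of the two closed bands is present has multiplicity two. -/
theorem hasMultiplicity_two (hs : ∀ f ∈ M.rest, s * ‖f‖ ≤ ‖A f - (c : ℂ) • f‖) (hρ : ρ < s)
    (hρ0 : 0 ≤ ρ) (hK : K ⊆ Metric.closedBall c ρ) (hKm : MeasurableSet K) :
    HasMultiplicity A (symmDiff (K ∩ closure B₁) (K ∩ closure B₂)) 2 := by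
  set S := symmDiff (K ∩ closure B₁) (K ∩ closure B₂) with hS
  have hSm : MeasurableSet S :=
    (hKm.inter isClosed_closure.measurableSet).symmDiff (hKm.inter isClosed_closure.measurableSet)
  have hSK : S ⊆ K := by
    rintro x (h | h) <;> exact h.1.1
  have disj : ∀ x, x ∈ S → x ∈ B₁ → x ∉ B₂ := by
    rintro x (h | h) h1 h2
    · exact h.2 ⟨h.1.1, subset_closure h2⟩
    · exact h.2 ⟨h.1.1, subset_closure h1⟩
  -- The two parts are disjoint, so both can use all of `ℂ²` by the identity map and the overlap
  -- condition is empty.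
  refine M.hasMultiplicity_of_split hs hρ hρ0 (hSK.trans hK) (D₁ := S ∩ B₁) (D₂ := S ∩ B₂)
    (hSm.inter M.open₁.measurableSet) (hSm.inter M.open₂.measurableSet) Set.inter_subset_right
    Set.inter_subset_right Set.inter_subset_left Set.inter_subset_left (by simp) (by simp)
    (.id ℂ _) (.id ℂ _) (.id ℂ _) (.id ℂ _) (fun v => rfl) (fun v => rfl)
    (fun x hx => absurd hx.2.2 (disj x hx.1.1 hx.1.2)) ?_
  rintro x (hx | hx) v
  · have h2 : x ∉ S ∩ B₂ := fun h => disj x hx.1 hx.2 h.2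
    simp [hx, h2]
  · have h2 : x ∉ S ∩ B₁ := fun h => disj x hx.1 h.2 hx.2
    simp [hx, h2]

/-- The first two coordinates of a vector in `ℂ⁴`. -/
def firstHalf : EuclideanSpace ℂ (Fin 4) →L[ℂ] C2 :=
  LinearMap.toContinuousLinearMap
    { toFun := fun v => !₂[v 0, v 1]
      map_add' := fun v w => by ext i; fin_cases i <;> simp
      map_smul' := fun a v => by ext i; fin_cases i <;> simp }

/-- The last two coordinates of a vector in `ℂ⁴`. -/
def secondHalf : EuclideanSpace ℂ (Fin 4) →L[ℂ] C2 :=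
  LinearMap.toContinuousLinearMap
    { toFun := fun v => !₂[v 2, v 3]
      map_add' := fun v w => by ext i; fin_cases i <;> simp
      map_smul' := fun a v => by ext i; fin_cases i <;> simp }

/-- The inclusion of `ℂ²` as the first two coordinates of `ℂ⁴`. -/
def inclFirst : C2 →L[ℂ] EuclideanSpace ℂ (Fin 4) :=
  LinearMap.toContinuousLinearMap
    { toFun := fun v => !₂[v 0, v 1, 0, 0]
      map_add' := fun v w => by ext i; fin_cases i <;> simp
      map_smul' := fun a v => by ext i; fin_cases i <;> simp }

/-- The inclusion of `ℂ²` as the last two coordinates of `ℂ⁴`. -/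
def inclSecond : C2 →L[ℂ] EuclideanSpace ℂ (Fin 4) :=
  LinearMap.toContinuousLinearMap
    { toFun := fun v => !₂[0, 0, v 0, v 1]
      map_add' := fun v w => by ext i; fin_cases i <;> simp
      map_smul' := fun a v => by ext i; fin_cases i <;> simp }

/-- The set where both closed bands are present has multiplicity four. -/
theorem hasMultiplicity_four (hs : ∀ f ∈ M.rest, s * ‖f‖ ≤ ‖A f - (c : ℂ) • f‖) (hρ : ρ < s)
    (hρ0 : 0 ≤ ρ) (hK : K ⊆ Metric.closedBall c ρ) (hKm : MeasurableSet K) :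
    HasMultiplicity A ((K ∩ closure B₁) ∩ (K ∩ closure B₂)) 4 := by
  set S := (K ∩ closure B₁) ∩ (K ∩ closure B₂) with hS
  have hD : MeasurableSet (K ∩ (B₁ ∩ B₂)) :=
    hKm.inter (M.open₁.measurableSet.inter M.open₂.measurableSet)
  have hDS : K ∩ (B₁ ∩ B₂) ⊆ S := fun x hx =>
    ⟨⟨hx.1, subset_closure hx.2.1⟩, ⟨hx.1, subset_closure hx.2.2⟩⟩
  -- Here the open bands must replace their closures: a point of `S ∩ B₁` that is missed lies in
  -- `closure B₂ \ B₂`, a null set.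
  have hn₁ : volume ((S ∩ B₁) \ (K ∩ (B₁ ∩ B₂))) = 0 :=
    measure_mono_null (t := closure B₂ \ B₂)
      (by
        rintro x ⟨⟨hxS, hx1⟩, hxD⟩
        exact ⟨hxS.2.2, fun h => hxD ⟨hxS.1.1, hx1, h⟩⟩) M.null₂
  have hn₂ : volume ((S ∩ B₂) \ (K ∩ (B₁ ∩ B₂))) = 0 :=
    measure_mono_null (t := closure B₁ \ B₁)
      (by
        rintro x ⟨⟨hxS, hx1⟩, hxD⟩
        exact ⟨hxS.1.2, fun h => hxD ⟨hxS.1.1, h, hx1⟩⟩) M.null₁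
  refine M.hasMultiplicity_of_split hs hρ hρ0 (fun x hx => hK hx.1.1) (D₁ := K ∩ (B₁ ∩ B₂))
    (D₂ := K ∩ (B₁ ∩ B₂)) hD hD (fun x hx => hx.2.1) (fun x hx => hx.2.2) hDS hDS hn₁ hn₂
    firstHalf secondHalf inclFirst inclSecond (fun v => ?_) (fun v => ?_)
    (fun x _ v => ⟨?_, ?_⟩) ?_
  · ext i; fin_cases i <;> simp [firstHalf, inclFirst]
  · ext i; fin_cases i <;> simp [secondHalf, inclSecond]
  · ext i; fin_cases i <;> simp [firstHalf, inclSecond]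
  · ext i; fin_cases i <;> simp [secondHalf, inclFirst]
  · intro x hx v
    rw [Set.union_self] at hx
    rw [Set.indicator_of_mem hx, Set.indicator_of_mem hx]
    simp [EuclideanSpace.norm_sq_eq, firstHalf, secondHalf, Fin.sum_univ_four]
    ring

end TwoBandModel

end Model

end Armchair
end


noncomputable section

set_option linter.unusedSectionVars false

namespace Armchair

open Polynomial

/-! ## Perturbation of the periodic eigenvalues -/

section Weyl

variable {p : ℕ}

theorem inner_periodicMatrix {q : ℤ → ℝ} {b : OrthonormalBasis (Fin (2 * p)) ℝ
      (EuclideanSpace ℝ (Fin (2 * p)))}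
    (hb : ∀ j, Matrix.mulVec (periodicMatrix p q) (b j) = periodicEigenvalue p q j • ⇑(b j))
    (x : EuclideanSpace ℝ (Fin (2 * p))) :
    inner ℝ x (Matrix.toEuclideanLin (periodicMatrix p q) x) =
      ∑ i : Fin (2 * p), periodicEigenvalue p q i * inner ℝ (b i) x ^ 2 := by
  have hT := Matrix.isSymmetric_toEuclideanLin_iff.2 (periodicMatrix_isHermitian p q)
  rw [← b.sum_inner_mul_inner]
  refine Finset.sum_congr rfl fun i _ => ?_
  have e : Matrix.toEuclideanLin (periodicMatrix p q) (b i) = periodicEigenvalue p q i • b i := by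
    ext k
    exact congrFun (hb i) k
  rw [← hT, e, inner_smul_left, real_inner_comm]
  simp only [conj_trivial]
  ring

/-- Weyl's inequality in the one-sided form. -/
theorem periodicEigenvalue_le_add {q r : ℤ → ℝ} {c : ℝ} (h : ∀ n, q n ≤ r n + c) {j : ℕ}
    (hj : j < 2 * p) : periodicEigenvalue p q j ≤ periodicEigenvalue p r j + c := by
  obtain ⟨b, hb⟩ := exists_sorted_eigenbasis p q
  obtain ⟨d, hd⟩ := exists_sorted_eigenbasis p r
  -- Courant–Fischer by counting: orthogonality to the eigenvectors of `q` below `j` and to those of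
  -- `r` above `j` makes `2p - 1` conditions. The coordinate `j` of `φ` is zero, so `φ` is not
  -- surjective and has a nontrivial kernel.
  let φ : EuclideanSpace ℝ (Fin (2 * p)) →ₗ[ℝ] (Fin (2 * p) → ℝ) :=
    LinearMap.pi fun i => if (i : ℕ) < j then (innerₛₗ ℝ (b i)) else
      if j < (i : ℕ) then (innerₛₗ ℝ (d i)) else 0
  have hφ : ¬ Function.Injective φ := by
    intro hinj
    have hsurj := (LinearMap.injective_iff_surjective_of_finrank_eq_finrank
      (f := φ) (by simp)).1 hinj
    obtain ⟨x, hx⟩ := hsurj (fun _ => 1)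
    have := congrFun hx ⟨j, hj⟩
    simp [φ] at this
  obtain ⟨x, hx, hx0⟩ : ∃ x, φ x = 0 ∧ x ≠ 0 := by
    by_contra! hc
    exact hφ ((injective_iff_map_eq_zero φ).2 hc)
  have hxb : ∀ i : Fin (2 * p), (i : ℕ) < j → inner ℝ (b i) x = 0 := fun i hi => by
    simpa [φ, hi] using congrFun hx i
  have hxd : ∀ i : Fin (2 * p), j < (i : ℕ) → inner ℝ (d i) x = 0 := fun i hi => by
    simpa [φ, hi, not_lt.2 hi.le] using congrFun hx i
  have sb : ∑ i, inner ℝ (b i) x ^ 2 = ‖x‖ ^ 2 := by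
    simpa [sq_abs] using b.sum_sq_norm_inner_right x
  have sd : ∑ i, inner ℝ (d i) x ^ 2 = ‖x‖ ^ 2 := by
    simpa [sq_abs] using d.sum_sq_norm_inner_right x
  have h1 : periodicEigenvalue p q j * ‖x‖ ^ 2 ≤
      inner ℝ x (Matrix.toEuclideanLin (periodicMatrix p q) x) := by
    rw [inner_periodicMatrix hb, ← sb, Finset.mul_sum]
    refine Finset.sum_le_sum fun i _ => ?_
    rcases lt_or_ge (i : ℕ) j with hi | hi
    · simp [hxb i hi]
    · exact mul_le_mul_of_nonneg_right (periodicEigenvalue_mono p q hi i.2) (sq_nonneg _)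
  have h2 : inner ℝ x (Matrix.toEuclideanLin (periodicMatrix p r) x) ≤
      periodicEigenvalue p r j * ‖x‖ ^ 2 := by
    rw [inner_periodicMatrix hd, ← sd, Finset.mul_sum]
    refine Finset.sum_le_sum fun i _ => ?_
    rcases lt_or_ge j (i : ℕ) with hi | hi
    · simp [hxd i hi]
    · exact mul_le_mul_of_nonneg_right (periodicEigenvalue_mono p r hi hj) (sq_nonneg _)
  have h3 : inner ℝ x (Matrix.toEuclideanLin (periodicMatrix p q) x) ≤
      inner ℝ x (Matrix.toEuclideanLin (periodicMatrix p r) x) + c * ‖x‖ ^ 2 := by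
    have e : ∀ k, Matrix.mulVec (periodicMatrix p q) x k =
        Matrix.mulVec (periodicMatrix p r) x k + (q (k : ℕ) - r (k : ℕ)) * x k := by
      intro k
      have : periodicMatrix p q = periodicMatrix p r +
          Matrix.diagonal (fun k : Fin (2 * p) => q (k : ℕ) - r (k : ℕ)) := by
        ext i k
        simp only [periodicMatrix, Matrix.add_apply, Matrix.diagonal_apply]
        split_ifs <;> ring
      rw [this, Matrix.add_mulVec, Pi.add_apply, Matrix.mulVec_diagonal]
    rw [EuclideanSpace.real_norm_sq_eq, Finset.mul_sum, PiLp.inner_apply, PiLp.inner_apply,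
      ← Finset.sum_add_distrib]
    refine Finset.sum_le_sum fun k _ => ?_
    change Matrix.mulVec (periodicMatrix p q) x k * x k ≤
      Matrix.mulVec (periodicMatrix p r) x k * x k + c * x k ^ 2
    rw [e]
    nlinarith [mul_nonneg (sub_nonneg.2 (h (k : ℕ))) (sq_nonneg (x k))]
  have hpos : 0 < ‖x‖ ^ 2 := by positivity
  nlinarith

theorem periodicEigenvalue_add_const (q : ℤ → ℝ) (c : ℝ) {j : ℕ} (hj : j < 2 * p) :
    periodicEigenvalue p (fun n => q n + c) j = periodicEigenvalue p q j + c := by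
  have h := periodicEigenvalue_le_add (p := p) (q := q) (r := fun n => q n + c) (c := -c)
    (fun n => by linarith) hj
  exact le_antisymm (periodicEigenvalue_le_add (fun _ => le_rfl) hj) (by linarith)

/-- Absorbs the shift into the potential. The range of `n` matters, because the default eigenvalue
`0` outside it does not move. -/
theorem shiftedGap_eq (q : ℤ → ℝ) (c : ℝ) {n : ℕ} (hn : 1 ≤ n) (hn' : n ≤ p - 1) :
    shiftedGap p q c n = gap p (fun n => q n + c) n := by
  rw [shiftedGap, gap, gap, Set.image_add_const_Ioo, zMinus, zMinus, zPlus, zPlus,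
    periodicEigenvalue_add_const q c (by omega), periodicEigenvalue_add_const q c (by omega)]

end Weyl

/-! ## The free operator -/

section Free

variable {p : ℕ} [NeZero p]

/-- The doubly degenerate `2p`-periodic eigenvalues of the free operator. -/
def freeNode (p n : ℕ) : ℝ := -2 * Real.cos (Real.pi * n / p)

/-- `n ↦ T_n(x / 2)` is a free solution, even in `n`, so Cayley–Hamilton at the site `0` reads off
the discriminant. -/
theorem discr_free_eval (x : ℝ) :
    (discr p (fun _ => 0)).eval x = 2 * (Chebyshev.T ℝ p).eval (x / 2) := by
  have hu : IsSol (fun n : ℤ => x - (fun _ => (0 : ℝ)) n)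
      (fun n => (Chebyshev.T ℝ n).eval (x / 2)) := by
    intro n
    have h := Chebyshev.T_add_two ℝ (n - 1)
    rw [show n - 1 + 2 = n + 1 by ring, show n - 1 + 1 = n by ring] at h
    simp only [h, eval_sub, eval_mul, eval_ofNat, eval_X]
    ring
  have := IsSol.discr_mul (p := p) (fun _ => rfl) hu 0
  rw [zero_add, zero_sub, Chebyshev.T_neg, Chebyshev.T_zero, eval_one, mul_one] at this
  linarith

theorem discr_free_sq_eq_iff (x : ℝ) :
    (discr p (fun _ => 0)).eval x ^ 2 = 4 ↔ ∃ n ≤ p, x = freeNode p n := by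
  have hp := NeZero.ne p
  have hp' : (p : ℝ) ≠ 0 := by exact_mod_cast hp
  rw [discr_free_eval, show (2 * (Chebyshev.T ℝ p).eval (x / 2)) ^ 2 = 4 ↔
    |(Chebyshev.T ℝ p).eval (x / 2)| = 1 by
      rw [← sq_eq_sq₀ (abs_nonneg _) zero_le_one, sq_abs, one_pow, mul_pow]
      constructor <;> intro h <;> linarith, Chebyshev.abs_eval_T_real_eq_one_iff hp]
  have refl : ∀ k ≤ p, Real.cos (((p - k : ℕ) : ℝ) * Real.pi / p) =
      -Real.cos (Real.pi * k / p) := fun k hk => by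
    rw [Nat.cast_sub hk, ← Real.cos_pi_sub]
    congr 1
    field_simp
  constructor
  · rintro ⟨k, hk, h⟩
    refine ⟨p - k, by omega, ?_⟩
    have := refl (p - k) (by omega)
    rw [Nat.sub_sub_self hk, ← h] at this
    rw [freeNode]
    linarith
  · rintro ⟨k, hk, rfl⟩
    refine ⟨p - k, by omega, ?_⟩
    rw [refl k hk, freeNode]
    ring

theorem freeNode_lt {m n : ℕ} (hmn : m < n) (hn : n ≤ p) : freeNode p m < freeNode p n := by
  have hp : (0 : ℝ) < p := by exact_mod_cast NeZero.pos p
  have hn' : (n : ℝ) ≤ p := by exact_mod_cast hn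
  have hm' : (m : ℝ) < n := by exact_mod_cast hmn
  have := Real.cos_lt_cos_of_nonneg_of_le_pi (x := Real.pi * m / p) (y := Real.pi * n / p)
    (by positivity) (by rw [div_le_iff₀ hp]; exact mul_le_mul_of_nonneg_left hn' Real.pi_pos.le)
    (div_lt_div_of_pos_right (mul_lt_mul_of_pos_left hm' Real.pi_pos) hp)
  rw [freeNode, freeNode]
  linarith

/-- `Δ² = 4` has exactly `p + 1` solutions in the free case, so any strictly increasing choice of `p
+ 1` of them is the full ordered list. -/
theorem eq_freeNode_of_strictMono {f : Fin (p + 1) → ℝ} (hf : StrictMono f)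
    (h : ∀ i, (discr p (fun _ => 0)).eval (f i) ^ 2 = 4) (i : Fin (p + 1)) :
    f i = freeNode p i := by
  have hg : StrictMono fun i : Fin (p + 1) => freeNode p i := fun i j hij =>
    freeNode_lt hij (by omega)
  set s : Finset ℝ := Finset.univ.image fun i : Fin (p + 1) => freeNode p i
  have hs : s.card = p + 1 := by
    rw [Finset.card_image_of_injective _ hg.injective, Finset.card_fin]
  have h1 := Finset.orderEmbOfFin_unique hs (f := f) (fun i => by
    obtain ⟨n, hn, e⟩ := (discr_free_sq_eq_iff _).1 (h i)
    exact Finset.mem_image.2 ⟨⟨n, by omega⟩, Finset.mem_univ _, e.symm⟩) hf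
  have h2 := Finset.orderEmbOfFin_unique hs (fun i =>
    Finset.mem_image_of_mem _ (Finset.mem_univ i)) hg
  exact congrFun (h1.trans h2.symm) i

theorem zPlus_le_zPlus {q : ℤ → ℝ} {m n : ℕ} (h : m ≤ n) (hn : n < p) :
    zPlus p q m ≤ zPlus p q n :=
  periodicEigenvalue_mono p q (by omega) (by omega)

/-- The sequence `z_0^+, z_1^-, …, z_p^-` is strictly increasing because bands are nondegenerate, so
it must be the list of nodes. The upper edges are treated likewise with `z_p^-` appended at the end.
-/
theorem zMinus_free {n : ℕ} (hn : 1 ≤ n) (hn' : n ≤ p) :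
    zMinus p (fun _ => 0) n = freeNode p n := by
  set q : ℤ → ℝ := fun _ => 0
  have hq : ∀ n : ℤ, q (n + p) = q n := fun _ => rfl
  have hp := NeZero.pos p
  have hmono : StrictMono fun i : Fin (p + 1) =>
      if (i : ℕ) = 0 then zPlus p q 0 else zMinus p q i := by
    intro i j hij
    have hij' : (i : ℕ) < j := hij
    have h1 : zPlus p q ((j : ℕ) - 1) < zMinus p q j := by
      have := zPlus_lt_zMinus hq (n := (j : ℕ) - 1) (by omega)
      rwa [Nat.sub_add_cancel (by omega)] at this
    simp only [show (j : ℕ) ≠ 0 by omega, if_false]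
    refine lt_of_le_of_lt ?_ h1
    split_ifs with h0
    · exact zPlus_le_zPlus (Nat.zero_le _) (by omega)
    · exact periodicEigenvalue_mono p q (by omega) (by omega)
  have := eq_freeNode_of_strictMono hmono (fun i => by
    split_ifs with h0
    · exact discr_sq_zPlus hq hp
    · have := discr_sq_zMinus hq (n := (i : ℕ) - 1) (by omega)
      rwa [Nat.sub_add_cancel (by omega)] at this) ⟨n, by omega⟩
  rwa [if_neg (show ((⟨n, by omega⟩ : Fin (p + 1)) : ℕ) ≠ 0 from (by omega : n ≠ 0))] at this

theorem zPlus_free {n : ℕ} (hn : n < p) : zPlus p (fun _ => 0) n = freeNode p n := by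
  set q : ℤ → ℝ := fun _ => 0
  have hq : ∀ n : ℤ, q (n + p) = q n := fun _ => rfl
  have hp := NeZero.pos p
  have hmono : StrictMono fun i : Fin (p + 1) =>
      if (i : ℕ) < p then zPlus p q i else zMinus p q p := by
    intro i j hij
    have hij' : (i : ℕ) < j := hij
    have hi : (i : ℕ) < p := by omega
    have h1 := zPlus_lt_zMinus hq hi
    simp only [hi, if_true]
    refine h1.trans_le ?_
    split_ifs with h0
    · exact periodicEigenvalue_mono p q (by omega) (by omega)
    · exact periodicEigenvalue_mono p q (by omega) (by omega)
  have := eq_freeNode_of_strictMono hmono (fun i => by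
    split_ifs with h0
    · exact discr_sq_zPlus hq h0
    · have := discr_sq_zMinus hq (n := p - 1) (by omega)
      rwa [Nat.sub_add_cancel (by omega)] at this) ⟨n, by omega⟩
  rwa [if_pos (show ((⟨n, by omega⟩ : Fin (p + 1)) : ℕ) < p from hn)] at this

end Free

/-! ## The spectrum in a window -/

section Window

variable {p : ℕ} [NeZero p] {q : ℤ → ℝ} {c δ : ℝ}

theorem zMinus_mem_Icc (hδ : ∀ n, |q n| ≤ δ) {n : ℕ} (hn : 1 ≤ n) (hn' : n ≤ p) :
    zMinus p (fun n => q n + c) n ∈ Set.Icc (freeNode p n + c - δ) (freeNode p n + c + δ) := by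
  have h1 := periodicEigenvalue_le_add (p := p) (q := fun n => q n + c) (r := fun _ => 0)
    (c := c + δ) (fun n => by linarith [(abs_le.1 (hδ n)).2]) (j := 2 * n - 1) (by omega)
  have h2 := periodicEigenvalue_le_add (p := p) (q := fun _ => 0) (r := fun n => q n + c)
    (c := δ - c) (fun n => by linarith [(abs_le.1 (hδ n)).1]) (j := 2 * n - 1) (by omega)
  have h3 := zMinus_free (p := p) hn hn'
  rw [zMinus] at h3 ⊢
  constructor <;> linarith

theorem zPlus_mem_Icc (hδ : ∀ n, |q n| ≤ δ) {n : ℕ} (hn : n < p) :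
    zPlus p (fun n => q n + c) n ∈ Set.Icc (freeNode p n + c - δ) (freeNode p n + c + δ) := by
  have h1 := periodicEigenvalue_le_add (p := p) (q := fun n => q n + c) (r := fun _ => 0)
    (c := c + δ) (fun n => by linarith [(abs_le.1 (hδ n)).2]) (j := 2 * n) (by omega)
  have h2 := periodicEigenvalue_le_add (p := p) (q := fun _ => 0) (r := fun n => q n + c)
    (c := δ - c) (fun n => by linarith [(abs_le.1 (hδ n)).1]) (j := 2 * n) (by omega)
  have h3 := zPlus_free (p := p) hn
  rw [zPlus] at h3 ⊢
  constructor <;> linarith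

theorem closure_bandSet (hq : ∀ n, q (n + p) = q n) :
    closure (bandSet p q) = {x | (discr p q).eval x ^ 2 ≤ 4} := by
  rw [bandSet_eq_iUnion hq, Finset.closure_biUnion]
  ext x
  simp only [Set.mem_iUnion, Finset.mem_range, exists_prop, band, Set.mem_ofPred_eq,
    discr_sq_le_iff hq]
  refine exists_congr fun n => and_congr_right fun hn => ?_
  rw [closure_Ioo (zPlus_lt_zMinus hq hn).ne]

theorem volume_closure_bandSet_diff (hq : ∀ n, q (n + p) = q n) :
    volume (closure (bandSet p q) \ bandSet p q) = 0 := by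
  refine measure_mono_null (t := ⋃ n ∈ Finset.range p, {zPlus p q n, zMinus p q (n + 1)}) ?_
    (Set.Finite.measure_zero (Set.Finite.biUnion (Finset.finite_toSet _)
      fun _ _ => (Set.finite_singleton _).insert _) _)
  rintro x ⟨hx, hx'⟩
  rw [closure_bandSet hq] at hx
  obtain ⟨n, hn, h1, h2⟩ := (discr_sq_le_iff hq x).1 hx
  refine Set.mem_biUnion (Finset.mem_coe.2 (Finset.mem_range.2 hn)) ?_
  rcases h1.eq_or_lt with h | h
  · exact Or.inl h.symm
  rcases h2.eq_or_lt with h' | h'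
  · exact Or.inr h'
  exact absurd ((discr_sq_lt_iff hq x).2 ⟨n, hn, h, h'⟩) hx'

theorem closure_bandSet_subset (hq : ∀ n, q (n + p) = q n) (hδ : ∀ n, |q n| ≤ δ) :
    closure (bandSet p fun n => q n + c) ⊆ Set.Icc (-2 + c - δ) (2 + c + δ) := by
  have hq' : ∀ n, (fun n => q n + c) (n + p) = (fun n => q n + c) n := fun n => by simp [hq]
  have hp := NeZero.pos p
  refine (closure_mono (bandSet_subset_Icc hq')).trans ?_
  rw [closure_Icc]
  refine Set.Icc_subset_Icc ?_ ?_
  · have := (zPlus_mem_Icc (c := c) hδ hp).1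
    simpa [freeNode] using this
  · have := (zMinus_mem_Icc (c := c) hδ hp le_rfl).2
    have hp' : (p : ℝ) ≠ 0 := by exact_mod_cast hp.ne'
    simpa [freeNode, mul_div_assoc, div_self hp'] using this

/-- The interval `[a, b]` is inside the hull of the free spectrum shifted by `c`, and only the
gaps with numbers in `T` can meet it, with a margin `m`. -/
structure IsWindow (p : ℕ) (c a b m : ℝ) (T : Set ℕ) : Prop where
  left : -2 + c + m ≤ a
  right : b ≤ 2 + c - m
  outside : ∀ n, 1 ≤ n → n ≤ p - 1 → n ∉ T → freeNode p n + c + m ≤ a ∨ b ≤ freeNode p n + c - m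

theorem exists_isWindow {a b : ℝ} {T : Set ℕ} (left : -2 + c < a) (right : b < 2 + c)
    (outside : ∀ n, 1 ≤ n → n ≤ p - 1 → n ∉ T → freeNode p n + c < a ∨ b < freeNode p n + c) :
    ∃ m > 0, IsWindow p c a b m T := by
  have key : ∀ x y : ℝ, x < y → ∀ᶠ m in nhdsWithin (0 : ℝ) (Set.Ioi 0), x + m ≤ y := by
    intro x y h
    filter_upwards [Ioo_mem_nhdsGT (sub_pos.2 h)] with m hm
    linarith [hm.2]
  have h3 : ∀ᶠ m in nhdsWithin (0 : ℝ) (Set.Ioi 0), ∀ n ∈ Finset.range p, 1 ≤ n → n ∉ T →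
      freeNode p n + c + m ≤ a ∨ b ≤ freeNode p n + c - m := by
    rw [Filter.eventually_all_finset]
    intro n hn
    have hn := Finset.mem_range.1 hn
    by_cases h1 : 1 ≤ n ∧ n ∉ T
    · rcases outside n h1.1 (by omega) h1.2 with h | h
      · filter_upwards [key _ _ h] with m hm _ _ using Or.inl hm
      · filter_upwards [key _ _ h] with m hm _ _ using Or.inr (by linarith)
    · exact Filter.Eventually.of_forall fun m h2 h3 => absurd ⟨h2, h3⟩ h1
  obtain ⟨m, ⟨⟨h1, h2⟩, h3⟩, hm⟩ :=
    (((key _ _ left).and (key _ _ right)).and h3).and self_mem_nhdsWithin |>.exists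
  have hp := NeZero.pos p
  exact ⟨m, hm, h1, by linarith, fun n hn hn' => h3 n (Finset.mem_range.2 (by omega)) hn⟩

/-- By Weyl's inequality every edge stays within `δ` of its shifted free node. With `δ` also as
margin, the window remains in the spectral hull and the gaps outside `T` cannot reach it. -/
theorem closure_bandSet_inter_Icc {a b : ℝ} {T : Set ℕ} (hq : ∀ n, q (n + p) = q n)
    (hδ : ∀ n, |q n| ≤ δ) (hT : IsWindow p c a b δ T) :
    Set.Icc a b ∩ closure (bandSet p fun n => q n + c) =
      Set.Icc a b \ ⋃ n ∈ {n : ℕ | 1 ≤ n ∧ n ≤ p - 1 ∧ n ∈ T}, shiftedGap p q c n := by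
  have hq' : ∀ n, (fun n => q n + c) (n + p) = (fun n => q n + c) n := fun n => by simp [hq]
  have hp := NeZero.pos p
  have hp' : (p : ℝ) ≠ 0 := by exact_mod_cast hp.ne'
  ext x
  rw [closure_bandSet hq', Set.mem_inter_iff, Set.mem_sdiff]
  refine and_congr_right fun hx => ?_
  have h0 : zPlus p (fun n => q n + c) 0 ≤ x := by
    have := (zPlus_mem_Icc (c := c) hδ hp).2
    simp only [freeNode, Nat.cast_zero, mul_zero, zero_div, Real.cos_zero] at this
    linarith [hT.left, hx.1]
  have h1 : x ≤ zMinus p (fun n => q n + c) p := by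
    have := (zMinus_mem_Icc (c := c) hδ hp le_rfl).1
    simp only [freeNode, mul_div_assoc, div_self hp', mul_one, Real.cos_pi] at this
    linarith [hT.right, hx.2]
  rw [Set.mem_ofPred_eq, discr_sq_le_iff_notMem_gap hq' h0 h1]
  simp only [Set.mem_iUnion, Set.mem_ofPred_eq, not_exists]
  constructor
  · rintro h n ⟨hn, hn', -⟩ hx'
    rw [shiftedGap_eq q c hn hn'] at hx'
    exact h n hn hn' hx'
  · intro h n hn hn' hx'
    by_cases hnT : n ∈ T
    · exact h n ⟨hn, hn', hnT⟩ (by rwa [shiftedGap_eq q c hn hn'])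
    · have e1 := (zMinus_mem_Icc (c := c) hδ hn (show n ≤ p by omega)).1
      have e2 := (zPlus_mem_Icc (c := c) hδ (show n < p by omega)).2
      rcases hT.outside n hn hn' hnT with h' | h'
      · linarith [hx.1, hx'.2]
      · linarith [hx.2, hx'.1]

end Window

end Armchair

end


noncomputable section

set_option linter.unusedSectionVars false

namespace Armchair

/-! ## Trigonometric estimates for the windows -/

section Estimates

variable {N p : ℕ}

theorem real_params (hN : 4 < 2 * N) (hp : 2 * N < p) :
    (3 : ℝ) ≤ N ∧ 2 * (N : ℝ) < p := by
  constructor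
  · exact_mod_cast (by omega : 3 ≤ N)
  · exact_mod_cast hp

theorem one_div_six_lt (hN : 4 < 2 * N) (hp : 2 * N < p) :
    0 < 1 / (6 * (p : ℝ)) ∧ 1 / (6 * (p : ℝ)) < 1 / 6 * (1 / (2 * (N : ℝ))) := by
  obtain ⟨h3, hp'⟩ := real_params hN hp
  have hp0 : (0 : ℝ) < p := by linarith
  refine ⟨by positivity, ?_⟩
  rw [show (1 : ℝ) / 6 * (1 / (2 * N)) = 1 / (6 * (2 * N)) by field_simp]
  exact one_div_lt_one_div_of_lt (by linarith) (by linarith)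

theorem half_width_le (hN : 4 < 2 * N) : 0 < 1 / (2 * (N : ℝ)) ∧ 1 / (2 * (N : ℝ)) ≤ 1 / 6 := by
  have h3 : (3 : ℝ) ≤ N := by exact_mod_cast (by omega : 3 ≤ N)
  exact ⟨by positivity, one_div_le_one_div_of_le (by norm_num) (by linarith)⟩

theorem rPlus_eq (N p : ℕ) : rPlus N p =
    Real.cos (1 / (2 * N) + 1 / (6 * p)) + √3 * Real.sin (1 / (2 * N) + 1 / (6 * p)) - 1 := by
  rw [rPlus, sub_sub, Real.cos_sub, Real.cos_pi_div_three, Real.sin_pi_div_three]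
  ring

theorem rMinus_eq (N p : ℕ) : rMinus N p =
    Real.cos (1 / (2 * N) + 1 / (6 * p)) - √3 * Real.sin (1 / (2 * N) + 1 / (6 * p)) - 1 := by
  rw [rMinus, add_assoc, Real.cos_add, Real.cos_pi_div_three, Real.sin_pi_div_three]
  ring

theorem sqrt_three_bounds : 1.7 < √(3 : ℝ) ∧ √(3 : ℝ) < 1.74 :=
  ⟨Real.lt_sqrt_of_sq_lt (by norm_num), (Real.sqrt_lt' (by norm_num)).2 (by norm_num)⟩

/-- Used at the left end of the central window for `J + 1`: the curvature terms work against the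
estimate and are quadratic, while the gain is linear in `b`. The constants fit `b = π/(2N) ≤ π/6`
and `x ≤ (7/6)/(2N)`, where `7/(6π) < 0.38`. -/
theorem two_sub_cos_sub_cos_lt {b x : ℝ} (hx : 0 < x) (hxb : x ≤ 0.38 * b) (hb : b ≤ 0.53) :
    2 - Real.cos b - Real.cos x < √3 * (Real.sin b - Real.sin x) := by
  have hb0 : 0 < b := by linarith
  have h1 := Real.one_sub_sq_div_two_le_cos (x := b)
  have h2 := Real.one_sub_sq_div_two_le_cos (x := x)
  have h3 := Real.sin_gt_sub_cube hb0
  have h4 := Real.sin_lt hx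
  have h5 : b ^ 3 ≤ 0.2809 * b := by nlinarith
  have h6 : 0.5 * b ≤ Real.sin b - Real.sin x := by linarith
  have h7 : 1.7 * (0.5 * b) ≤ √3 * (Real.sin b - Real.sin x) :=
    mul_le_mul sqrt_three_bounds.1.le h6 (by positivity) (by positivity)
  nlinarith

theorem abs_rPlus_lt {x : ℝ} (hx : 0 < x) (hx' : x ≤ 0.2) :
    |Real.cos x + √3 * Real.sin x - 1| ≤ 1.74 * x ∧
      |Real.cos x - √3 * Real.sin x - 1| ≤ 1.85 * x := by
  have h1 := Real.one_sub_sq_div_two_le_cos (x := x)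
  have h2 := Real.cos_le_one x
  have h3 := (Real.sin_lt hx).le
  have h4 : 0 ≤ Real.sin x :=
    Real.sin_nonneg_of_nonneg_of_le_pi hx.le (by linarith [Real.pi_gt_three])
  have h5 : √3 * Real.sin x ≤ 1.74 * x :=
    mul_le_mul sqrt_three_bounds.2.le h3 h4 (by norm_num)
  have h6 : 1.7 * Real.sin x ≤ √3 * Real.sin x :=
    mul_le_mul_of_nonneg_right sqrt_three_bounds.1.le h4
  have h7 : x - x ^ 3 / 6 < Real.sin x := Real.sin_gt_sub_cube hx
  have h8 : x ^ 3 ≤ 0.04 * x := by nlinarith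
  constructor
  · rw [abs_le]; constructor <;> nlinarith
  · rw [abs_le]; constructor <;> nlinarith

/-- The squared form of the comparison of `√(5 + 4 cos (π/N))` with `rTildeMinus`. At `h = 0` the
slack is `cos b (1 - cos b)`, of order `b²`, which beats the loss of order `b h`; the constant fits
`h = 1/(6p) < b/(6π)`. -/
theorem two_mul_cos_sq_lt {b h : ℝ} (hb : 0 < b) (hb' : b ≤ 0.53) (hh : 0 < h)
    (hh' : h ≤ 0.0532 * b) :
    2 * Real.cos b ^ 2 < Real.cos (b + h) + Real.cos (b + h) ^ 2 := by
  have hC1 : Real.cos b ≤ 1 - 0.48 * b ^ 2 := by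
    have h1 := Real.cos_bound (x := b) (by rw [abs_le]; constructor <;> linarith)
    rw [abs_of_pos hb] at h1
    have h2 := (abs_le.1 h1).2
    have h0 : b ^ 2 ≤ 0.3 := by nlinarith
    have h3 : b ^ 4 ≤ 0.3 * b ^ 2 := by
      rw [show b ^ 4 = b ^ 2 * b ^ 2 by ring]
      exact mul_le_mul_of_nonneg_right h0 (sq_nonneg b)
    nlinarith
  have hC0 := Real.one_sub_sq_div_two_le_cos (x := b)
  have hb2 : b ^ 2 ≤ 0.281 := by nlinarith
  have hC2 : (0.85 : ℝ) ≤ Real.cos b := by linarith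
  have hs := Real.sin_lt hb
  have hs0 : 0 ≤ Real.sin b :=
    Real.sin_nonneg_of_nonneg_of_le_pi hb.le (by linarith [Real.pi_gt_three])
  have hsh := Real.sin_lt hh
  have hsh0 : 0 ≤ Real.sin h :=
    Real.sin_nonneg_of_nonneg_of_le_pi hh.le (by linarith [Real.pi_gt_three])
  have hch := Real.one_sub_sq_div_two_le_cos (x := h)
  have hh2 : h ^ 2 ≤ 0.0029 * b ^ 2 := by nlinarith
  have h1 : Real.sin b * Real.sin h ≤ b * h := mul_le_mul hs.le hsh.le hsh0 hb.le
  have hbh : b * h ≤ 0.0532 * b ^ 2 := by nlinarith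
  have hcc : Real.cos b - h ^ 2 / 2 ≤ Real.cos b * Real.cos h := by
    nlinarith [Real.cos_le_one b, Real.cos_le_one h]
  have hD : Real.cos b - 0.055 * b ^ 2 ≤ Real.cos (b + h) := by
    rw [Real.cos_add]
    linarith
  have hpos : 0 < Real.cos b - 0.055 * b ^ 2 := by nlinarith
  have hD2 : (Real.cos b - 0.055 * b ^ 2) ^ 2 ≤ Real.cos (b + h) ^ 2 :=
    pow_le_pow_left₀ hpos.le hD 2
  have hbb : 0 < b ^ 2 := by positivity
  have e1 : 0.85 * (0.48 * b ^ 2) ≤ Real.cos b * (1 - Real.cos b) :=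
    mul_le_mul hC2 (by linarith) (by positivity) (by linarith)
  have e2 : Real.cos b * b ^ 2 ≤ b ^ 2 := by nlinarith [Real.cos_le_one b]
  nlinarith

theorem sqrt_lt_rTildeMinus (hN : 4 < 2 * N) (hp : 2 * N < p) :
    √(5 + 4 * Real.cos (Real.pi / N)) < rTildeMinus N p := by
  obtain ⟨h3, -⟩ := real_params hN hp
  obtain ⟨h1, h2⟩ := one_div_six_lt hN hp
  obtain ⟨h4, h5⟩ := half_width_le hN
  have π1 := Real.pi_gt_d2
  have π2 := Real.pi_lt_d2
  set b := Real.pi / (2 * N) with hb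
  have hb' : b = Real.pi * (1 / (2 * N)) := by rw [hb]; ring
  have hb0 : 0 < b := by positivity
  have key := two_mul_cos_sq_lt hb0 (by rw [hb']; nlinarith) h1 (by rw [hb']; nlinarith)
  have e : Real.cos (Real.pi / N) = 2 * Real.cos b ^ 2 - 1 := by
    rw [← Real.cos_two_mul, hb]
    congr 1
    field_simp
  have hc : 0 < Real.cos (b + 1 / (6 * p)) := by
    apply Real.cos_pos_of_mem_Ioo
    constructor
    · linarith [Real.pi_pos]
    · rw [hb']; nlinarith
  rw [rTildeMinus, Real.sqrt_lt' (by linarith), e]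
  nlinarith

/-- Jordan's inequality gives `sin (π/N) ≥ 4 / (2N)`, whereas the window has ends at most `1.85 ·
(7/6) / (2N)` in modulus. -/
theorem center_lt_sin (hN : 4 < 2 * N) (hp : 2 * N < p) :
    max |rMinus N p| |rPlus N p| < Real.sin (Real.pi / N) := by
  obtain ⟨h3, -⟩ := real_params hN hp
  obtain ⟨h1, h2⟩ := one_div_six_lt hN hp
  obtain ⟨h4, h5⟩ := half_width_le hN
  have hs := Real.mul_le_sin (x := Real.pi / N) (by positivity)
    (div_le_div_of_nonneg_left Real.pi_pos.le (by norm_num) (by linarith))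
  have e : 2 / Real.pi * (Real.pi / N) = 4 * (1 / (2 * N)) := by
    field_simp
    norm_num
  rw [e] at hs
  obtain ⟨h6, h7⟩ := abs_rPlus_lt (x := 1 / (2 * N) + 1 / (6 * p)) (by linarith) (by linarith)
  rw [rPlus_eq, rMinus_eq]
  exact max_lt (by linarith) (by linarith)

theorem half_angle_facts (hN : 4 < 2 * N) (hp : 2 * N < p) :
    0 < Real.pi / (2 * N) ∧ Real.pi / (2 * N) ≤ Real.pi / 6 ∧ Real.pi / (2 * N) ≤ 0.525 ∧
      0 < 1 / (2 * (N : ℝ)) + 1 / (6 * p) ∧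
      1 / (2 * (N : ℝ)) + 1 / (6 * p) ≤ 0.38 * (Real.pi / (2 * N)) := by
  obtain ⟨h3, -⟩ := real_params hN hp
  obtain ⟨h1, h2⟩ := one_div_six_lt hN hp
  obtain ⟨h4, h5⟩ := half_width_le hN
  have π1 := Real.pi_gt_d2
  have π2 := Real.pi_lt_d2
  have hb' : Real.pi / (2 * N) = Real.pi * (1 / (2 * N)) := by ring
  rw [hb']
  refine ⟨by positivity, ?_, ?_, by linarith, ?_⟩ <;> nlinarith

theorem freeNode_eq_cos {n : ℕ} : freeNode p n = -2 * Real.cos (Real.pi * n / p) := rfl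

theorem node_angle_lt (hN : 4 < 2 * N) (hp : 2 * N < p) {n : ℕ} (hn : n ≤ p - 1) :
    0 ≤ Real.pi * n / p ∧ Real.pi * n / p < Real.pi := by
  obtain ⟨h3, hp'⟩ := real_params hN hp
  have hn' : (n : ℝ) < p := by exact_mod_cast (by omega : n < p)
  have hp0 : (0 : ℝ) < p := by linarith
  refine ⟨by positivity, ?_⟩
  rw [div_lt_iff₀ hp0]
  exact mul_lt_mul_of_pos_left hn' Real.pi_pos

/-- For `J + 1` the nodes are `1 - 2 cos`, the window ends `2 cos - 1`; the opposite curvatures make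
the comparison at the left end a genuine estimate. -/
theorem isWindow_centerFirst [NeZero p] (hN : 4 < 2 * N) (hp : 2 * N < p) :
    ∃ m > 0, IsWindow p 1 (rMinus N p) (rPlus N p) m {n | |(n : ℝ) - p / 3| ≤ p / (2 * N)} := by
  obtain ⟨h3, hp'⟩ := real_params hN hp
  have hp0 : (0 : ℝ) < p := by linarith
  obtain ⟨hb0, hb6, hb, hx0, hxb⟩ := half_angle_facts hN hp
  have key := two_sub_cos_sub_cos_lt hx0 hxb (by linarith)
  have habs := abs_rPlus_lt hx0 (by linarith)
  rw [← rPlus_eq, ← rMinus_eq, abs_le, abs_le] at habs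
  have hπ := Real.pi_pos
  refine exists_isWindow ?_ ?_ ?_
  · linarith
  · linarith
  · intro n hn hn' hT
    obtain ⟨hy0, hy1⟩ := node_angle_lt hN hp hn'
    simp only [Set.mem_ofPred_eq, not_le, lt_abs] at hT
    rw [freeNode_eq_cos, rPlus_eq, rMinus_eq]
    set x := 1 / (2 * (N : ℝ)) + 1 / (6 * p)
    set b := Real.pi / (2 * N) with hbdef
    have hc1 := Real.cos_le_one b
    have hc2 := Real.cos_le_one x
    have e : Real.pi / p * (p / (2 * N)) = b := by rw [hbdef]; field_simp
    have e' : Real.pi / p * (n - p / 3) = Real.pi * n / p - Real.pi / 3 := by field_simp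
    have hpp : 0 < Real.pi / p := by positivity
    rcases hT with h | h
    · right
      have h1 := mul_lt_mul_of_pos_left h hpp
      rw [e, e'] at h1
      have h2 := Real.cos_lt_cos_of_nonneg_of_le_pi (x := Real.pi / 3 + b)
        (y := Real.pi * n / p) (by linarith) hy1.le (by linarith)
      rw [Real.cos_add, Real.cos_pi_div_three, Real.sin_pi_div_three] at h2
      linarith
    · left
      have h1 := mul_lt_mul_of_pos_left h hpp
      rw [e, mul_neg, e'] at h1
      have h2 := Real.cos_lt_cos_of_nonneg_of_le_pi (x := Real.pi * n / p)
        (y := Real.pi / 3 - b) hy0 (by linarith) (by linarith)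
      rw [Real.cos_sub, Real.cos_pi_div_three, Real.sin_pi_div_three] at h2
      linarith

/-- For `J - 1` the reflection `y ↦ π - y` puts nodes and window ends in the same form `2 cos - 1`,
so monotonicity of the cosine and `x < b` suffice. -/
theorem isWindow_centerSecond [NeZero p] (hN : 4 < 2 * N) (hp : 2 * N < p) :
    ∃ m > 0, IsWindow p (-1) (rMinus N p) (rPlus N p) m
      {n | |(n : ℝ) - 2 * p / 3| ≤ p / (2 * N)} := by
  obtain ⟨h3, hp'⟩ := real_params hN hp
  have hp0 : (0 : ℝ) < p := by linarith
  obtain ⟨hb0, hb6, hb, hx0, hxb⟩ := half_angle_facts hN hp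
  have habs := abs_rPlus_lt hx0 (by linarith)
  rw [← rPlus_eq, ← rMinus_eq, abs_le, abs_le] at habs
  have hπ := Real.pi_pos
  refine exists_isWindow ?_ ?_ ?_
  · linarith
  · linarith
  · intro n hn hn' hT
    obtain ⟨hy0, hy1⟩ := node_angle_lt hN hp hn'
    simp only [Set.mem_ofPred_eq, not_le, lt_abs] at hT
    rw [freeNode_eq_cos, rPlus, rMinus, sub_sub (Real.pi / 3), add_assoc (Real.pi / 3)]
    set x := 1 / (2 * (N : ℝ)) + 1 / (6 * p)
    set b := Real.pi / (2 * N) with hbdef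
    have e : Real.pi / p * (p / (2 * N)) = b := by rw [hbdef]; field_simp
    have e' : Real.pi / p * (n - 2 * p / 3) = Real.pi * n / p - 2 * Real.pi / 3 := by field_simp
    have hpp : 0 < Real.pi / p := by positivity
    have hcos := Real.cos_pi_sub (Real.pi * n / p)
    rcases hT with h | h
    · right
      have h1 := mul_lt_mul_of_pos_left h hpp
      rw [e, e'] at h1
      have h2 := Real.cos_lt_cos_of_nonneg_of_le_pi (x := Real.pi - Real.pi * n / p)
        (y := Real.pi / 3 - x) (by linarith) (by linarith) (by linarith)
      linarith
    · left
      have h1 := mul_lt_mul_of_pos_left h hpp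
      rw [e, mul_neg, e'] at h1
      have h2 := Real.cos_lt_cos_of_nonneg_of_le_pi (x := Real.pi / 3 + x)
        (y := Real.pi - Real.pi * n / p) (by linarith) (by linarith) (by linarith)
      linarith

theorem edge_facts (hN : 4 < 2 * N) (hp : 2 * N < p) :
    rTildePlus p < 3 ∧ 1 < rTildeMinus N p ∧ rTildeMinus N p ≤ rTildePlus p := by
  obtain ⟨h1, h2⟩ := one_div_six_lt hN hp
  obtain ⟨h4, h5⟩ := half_width_le hN
  obtain ⟨hb0, hb6, hb, hx0, hxb⟩ := half_angle_facts hN hp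
  have hπ := Real.pi_gt_three
  have e1 := Real.cos_lt_cos_of_nonneg_of_le_pi (x := 0) (y := 1 / (6 * p)) le_rfl
    (by linarith) h1
  have e2 := Real.cos_le_cos_of_nonneg_of_le_pi (x := 1 / (6 * p))
    (y := Real.pi / (2 * N) + 1 / (6 * p)) h1.le (by linarith) (by linarith)
  have e3 := Real.cos_pos_of_mem_Ioo (x := Real.pi / (2 * N) + 1 / (6 * p))
    ⟨by linarith, by linarith⟩
  rw [Real.cos_zero] at e1
  rw [rTildePlus, rTildeMinus]
  refine ⟨by linarith, by linarith, by linarith⟩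

/-- The bound on `n` is exact: multiplied by `π / p`, it becomes the angle `π/(2N) + 1/(6p)` in
`rTildeMinus`. Near `-3` all free nodes of `J - 1` beyond that angle lie to the right of the window.
-/
theorem isWindow_edgeLower [NeZero p] (hN : 4 < 2 * N) (hp : 2 * N < p) :
    ∃ m > 0, IsWindow p (-1) (-rTildePlus p) (-rTildeMinus N p) m
      {n | (n : ℝ) ≤ p / (2 * N) + 1 / (6 * Real.pi)} := by
  obtain ⟨h3, hp'⟩ := real_params hN hp
  have hp0 : (0 : ℝ) < p := by linarith
  obtain ⟨e1, e2, -⟩ := edge_facts hN hp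
  obtain ⟨h1, h2⟩ := one_div_six_lt hN hp
  obtain ⟨hb0, hb6, hb, hx0, hxb⟩ := half_angle_facts hN hp
  have hπ := Real.pi_gt_three
  refine exists_isWindow (by linarith) (by linarith) fun n hn hn' hT => ?_
  obtain ⟨hy0, hy1⟩ := node_angle_lt hN hp hn'
  simp only [Set.mem_ofPred_eq, not_le] at hT
  right
  have hpp : 0 < Real.pi / p := by positivity
  have h4 := mul_lt_mul_of_pos_left hT hpp
  have e : Real.pi / p * (p / (2 * N) + 1 / (6 * Real.pi)) =
      Real.pi / (2 * N) + 1 / (6 * p) := by field_simp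
  have e' : Real.pi / p * n = Real.pi * n / p := by ring
  rw [e, e'] at h4
  have h5 := Real.cos_lt_cos_of_nonneg_of_le_pi (by linarith) hy1.le h4
  rw [freeNode_eq_cos, rTildeMinus]
  linarith

theorem isWindow_edgeUpper [NeZero p] (hN : 4 < 2 * N) (hp : 2 * N < p) :
    ∃ m > 0, IsWindow p 1 (rTildeMinus N p) (rTildePlus p) m
      {n | (p : ℝ) - p / (2 * N) - 1 / (6 * Real.pi) ≤ n} := by
  obtain ⟨h3, hp'⟩ := real_params hN hp
  have hp0 : (0 : ℝ) < p := by linarith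
  obtain ⟨e1, e2, -⟩ := edge_facts hN hp
  obtain ⟨h1, h2⟩ := one_div_six_lt hN hp
  obtain ⟨hb0, hb6, hb, hx0, hxb⟩ := half_angle_facts hN hp
  have hπ := Real.pi_gt_three
  refine exists_isWindow (by linarith) (by linarith) fun n hn hn' hT => ?_
  obtain ⟨hy0, hy1⟩ := node_angle_lt hN hp hn'
  simp only [Set.mem_ofPred_eq, not_le] at hT
  left
  have hpp : 0 < Real.pi / p := by positivity
  have h4 := mul_lt_mul_of_pos_left hT hpp
  have e : Real.pi / p * (p - p / (2 * N) - 1 / (6 * Real.pi)) =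
      Real.pi - (Real.pi / (2 * N) + 1 / (6 * p)) := by field_simp; ring
  have e' : Real.pi / p * n = Real.pi * n / p := by ring
  rw [e, e'] at h4
  have h5 := Real.cos_lt_cos_of_nonneg_of_le_pi hy0 (by linarith) h4
  rw [Real.cos_pi_sub] at h5
  rw [freeNode_eq_cos, rTildeMinus]
  linarith

end Estimates

end Armchair

end


noncomputable section

set_option linter.unusedSectionVars false

namespace Armchair

/-! ## A discrete Wirtinger inequality -/

section Wirtinger

variable {N : ℕ} [NeZero N]

/-- The discrete Fourier transform. -/
def fourierSum (x : ZMod N → ℂ) (s : ZMod N) : ℂ := ∑ j, ZMod.stdAddChar (-(j * s)) * x j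

theorem sum_norm_sq_fourierSum (x : ZMod N → ℂ) :
    ∑ s, ‖fourierSum x s‖ ^ 2 = N * ∑ j, ‖x j‖ ^ 2 := by
  apply Complex.ofReal_injective
  have e : ∀ z : ℂ, ((‖z‖ ^ 2 : ℝ) : ℂ) = z * (starRingEnd ℂ) z := fun z => by
    rw [Complex.mul_conj, Complex.normSq_eq_norm_sq]
  rw [Complex.ofReal_sum, Complex.ofReal_mul, Complex.ofReal_sum, Complex.ofReal_natCast]
  simp only [e, fourierSum, map_sum, map_mul, Finset.sum_mul_sum]
  rw [Finset.sum_comm, Finset.mul_sum]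
  refine Finset.sum_congr rfl fun j _ => ?_
  rw [Finset.sum_comm]
  have h : ∀ k, ∑ s, ZMod.stdAddChar (-(j * s)) * x j *
      ((starRingEnd ℂ) (ZMod.stdAddChar (-(k * s))) * (starRingEnd ℂ) (x k)) =
      if k = j then N * (x j * (starRingEnd ℂ) (x j)) else 0 := by
    intro k
    have h1 : ∀ s : ZMod N, ZMod.stdAddChar (-(j * s)) * x j *
        ((starRingEnd ℂ) (ZMod.stdAddChar (-(k * s))) * (starRingEnd ℂ) (x k)) =
        ZMod.stdAddChar (s * (k - j)) * (x j * (starRingEnd ℂ) (x k)) := fun s => by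
      rw [← AddChar.map_neg_eq_conj, neg_neg, show s * (k - j) = -(j * s) + k * s by ring,
        AddChar.map_add_eq_mul]
      ring
    simp only [h1]
    rw [← Finset.sum_mul, AddChar.sum_mulShift _ (ZMod.isPrimitive_stdAddChar N), ZMod.card]
    by_cases hk : k = j
    · simp [hk]
    · simp [hk, sub_ne_zero.2 hk]
  simp only [h]
  rw [Finset.sum_ite_eq' Finset.univ j]
  simp

theorem fourierSum_add_shift (x : ZMod N → ℂ) (s : ZMod N) :
    fourierSum (fun k => x k + x (k + 1)) s = (1 + ZMod.stdAddChar s) * fourierSum x s := by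
  have : ∑ j : ZMod N, ZMod.stdAddChar (-(j * s)) * x (j + 1) =
      ZMod.stdAddChar s * fourierSum x s := by
    rw [fourierSum, Finset.mul_sum, ← Equiv.sum_comp (Equiv.addRight (1 : ZMod N))
      (fun j => ZMod.stdAddChar s * (ZMod.stdAddChar (-(j * s)) * x j))]
    refine Finset.sum_congr rfl fun j _ => ?_
    rw [Equiv.coe_addRight, ← mul_assoc, ← AddChar.map_add_eq_mul]
    congr 2
    ring
  rw [add_mul, one_mul, ← this]
  simp only [fourierSum, mul_add, Finset.sum_add_distrib]

/-- `|1 + e^{iθ}|² = 2 + 2 cos θ`, and among nonzero frequencies the largest value is at `θ = 2π/N`;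
angles beyond `π` are reflected to `2π - θ`. -/
theorem norm_one_add_stdAddChar_le {s : ZMod N} (hs : s ≠ 0) :
    ‖1 + ZMod.stdAddChar s‖ ^ 2 ≤ (2 * Real.cos (Real.pi / N)) ^ 2 := by
  have hN : (0 : ℝ) < N := by exact_mod_cast NeZero.pos N
  have hN1 : N ≠ 1 := by
    rintro rfl
    exact hs (Subsingleton.elim _ _)
  set v := s.val
  have hv : v < N := ZMod.val_lt s
  have hv0 : v ≠ 0 := fun h => hs ((ZMod.val_eq_zero s).1 h)
  have e : (ZMod.stdAddChar s : ℂ) = Complex.exp ((2 * Real.pi * v / N : ℝ) * Complex.I) := by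
    rw [ZMod.stdAddChar_apply, ZMod.toCircle_apply]
    congr 1
    push_cast
    ring
  have h1 : ∀ θ : ℝ, ‖1 + Complex.exp (θ * Complex.I)‖ ^ 2 = 2 + 2 * Real.cos θ := fun θ => by
    rw [← Complex.normSq_eq_norm_sq, Complex.normSq_apply]
    simp only [Complex.add_re, Complex.one_re, Complex.exp_ofReal_mul_I_re, Complex.add_im,
      Complex.one_im, Complex.exp_ofReal_mul_I_im]
    nlinarith [Real.sin_sq_add_cos_sq θ]
  have hv1 : (1 : ℝ) ≤ v := by exact_mod_cast Nat.one_le_iff_ne_zero.2 hv0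
  have hv2 : (v : ℝ) ≤ N - 1 := by
    have : v + 1 ≤ N := hv
    have : ((v + 1 : ℕ) : ℝ) ≤ N := by exact_mod_cast this
    push_cast at this
    linarith
  have hN2 : (2 : ℝ) ≤ N := by
    have := NeZero.pos N
    exact_mod_cast (by omega : 2 ≤ N)
  have e2 : 2 * Real.pi * v / N = 2 * Real.pi / N * v := by ring
  have hw : 0 < 2 * Real.pi / N := by positivity
  have eN : 2 * Real.pi / N * N = 2 * Real.pi := by field_simp
  have hcos : Real.cos (2 * Real.pi * v / N) ≤ Real.cos (2 * Real.pi / N) := by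
    rw [e2]
    rcases le_or_gt (2 * Real.pi / N * v) Real.pi with h | h
    · exact Real.cos_le_cos_of_nonneg_of_le_pi hw.le h (by nlinarith)
    · rw [← Real.cos_two_pi_sub (2 * Real.pi / N * v)]
      exact Real.cos_le_cos_of_nonneg_of_le_pi hw.le (by linarith) (by nlinarith)
  rw [e, h1]
  have := Real.cos_two_mul (Real.pi / N)
  rw [show 2 * (Real.pi / N) = 2 * Real.pi / N by ring] at this
  nlinarith

/-- Zero-mean functions on the cyclic group satisfy a Wirtinger inequality. -/
theorem sum_norm_add_shift_sq_le {x : ZMod N → ℂ} (hx : ∑ k, x k = 0) :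
    ∑ k, ‖x k + x (k + 1)‖ ^ 2 ≤ (2 * Real.cos (Real.pi / N)) ^ 2 * ∑ k, ‖x k‖ ^ 2 := by
  have hN : (0 : ℝ) < N := by exact_mod_cast NeZero.pos N
  have h1 := sum_norm_sq_fourierSum x
  have h2 := sum_norm_sq_fourierSum (fun k => x k + x (k + 1))
  have h3 : ∑ s, ‖fourierSum (fun k => x k + x (k + 1)) s‖ ^ 2 ≤
      (2 * Real.cos (Real.pi / N)) ^ 2 * ∑ s, ‖fourierSum x s‖ ^ 2 := by
    rw [Finset.mul_sum]
    refine Finset.sum_le_sum fun s _ => ?_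
    rw [fourierSum_add_shift, norm_mul, mul_pow]
    by_cases hs : s = 0
    · have : fourierSum x s = 0 := by simp [fourierSum, hs, hx]
      simp [this]
    · exact mul_le_mul_of_nonneg_right (norm_one_add_stdAddChar_le hs) (sq_nonneg _)
  rw [h1, h2] at h3
  refine le_of_mul_le_mul_left ?_ hN
  linarith

end Wirtinger

/-! ## The zero-mean part of the armchair Hamiltonian -/

section ZeroMean

variable {N : ℕ} [NeZero N]

theorem inner_permOp {ι : Type} {σ : ι → ι} (hσ : Function.Involutive σ) (f g : L2 ι) :
    inner ℂ (permOp hσ.toPerm f) g = inner ℂ f (permOp hσ.toPerm g) := by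
  rw [lp.inner_eq_tsum, lp.inner_eq_tsum, ← Equiv.tsum_eq hσ.toPerm]
  refine tsum_congr fun i => ?_
  rw [permOp_apply, permOp_apply]
  simp only [Function.Involutive.coe_toPerm, hσ i]

theorem norm_permOp {ι : Type} (σ : ι ≃ ι) (f : L2 ι) : ‖permOp σ f‖ = ‖f‖ := by
  rw [← sq_eq_sq₀ (norm_nonneg _) (norm_nonneg _), lp_norm_sq, lp_norm_sq]
  exact σ.tsum_eq (fun i => ‖f i‖ ^ 2)

theorem inner_mulOp {ι : Type} (v : Potential) (c : ι → ℤ) (f g : L2 ι) :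
    inner ℂ (mulOp v c f) g = inner ℂ f (mulOp v c g) := by
  rw [lp.inner_eq_tsum, lp.inner_eq_tsum]
  refine tsum_congr fun i => ?_
  rw [mulOp_apply, mulOp_apply]
  simp only [RCLike.inner_apply, map_mul, Complex.conj_ofReal]
  ring

theorem norm_mulOp_le {ι : Type} (v : Potential) (c : ι → ℤ) (f : L2 ι) :
    ‖mulOp v c f‖ ≤ ‖v‖ * ‖f‖ :=
  (ContinuousLinearMap.le_opNorm _ _).trans (mul_le_mul_of_nonneg_right
    (LinearMap.mkContinuous_norm_le _ (norm_nonneg v) _) (norm_nonneg f))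

theorem hamiltonian_symm (v : Potential) (f g : L2 (Vertex N)) :
    inner ℂ (hamiltonian N v f) g = inner ℂ f (hamiltonian N v g) := by
  simp only [hamiltonian, add_apply, inner_add_left, inner_add_right,
    inner_permOp, inner_mulOp]

/-- The sequences whose mean over the cyclic variable vanishes. -/
def zeroMean (N : ℕ) [NeZero N] : Submodule ℂ (L2 (Vertex N)) where
  carrier := {f | ∀ (n : ℤ) (j : Fin 2), ∑ k, f (n, j, k) = 0}
  add_mem' {f g} hf hg n j := by
    have : ∀ k, (f + g) (n, j, k) = f (n, j, k) + g (n, j, k) := fun _ => rfl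
    simp only [this, Finset.sum_add_distrib, hf n j, hg n j, add_zero]
  zero_mem' n j := Finset.sum_eq_zero fun _ _ => rfl
  smul_mem' a f hf n j := by
    have : ∀ k, (a • f) (n, j, k) = a * f (n, j, k) := fun _ => rfl
    simp only [this, ← Finset.mul_sum, hf n j, mul_zero]

theorem hamiltonian_mem_zeroMean (v : Potential) {f : L2 (Vertex N)} (hf : f ∈ zeroMean N) :
    hamiltonian N v f ∈ zeroMean N := by
  intro n j
  fin_cases j
  · change ∑ k, hamiltonian N v f (n, 0, k) = 0
    have e : ∑ k, f (n - 1, 1, k - 1) = 0 :=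
      (Equiv.sum_comp (Equiv.subRight (1 : ZMod N)) (fun k => f (n - 1, 1, k))).trans (hf _ _)
    simp only [hamiltonian_apply_zero, Finset.sum_add_distrib, ← Finset.mul_sum, e]
    simp [hf _ _]
  · change ∑ k, hamiltonian N v f (n, 1, k) = 0
    have e : ∑ k, f (n + 1, 0, k + 1) = 0 :=
      (Equiv.sum_comp (Equiv.addRight (1 : ZMod N)) (fun k => f (n + 1, 0, k))).trans (hf _ _)
    simp only [hamiltonian_apply_one, Finset.sum_add_distrib, ← Finset.mul_sum, e]
    simp [hf _ _]

/-- The hopping operators along the three families of bonds. -/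
abbrev hopA (N : ℕ) : L2 (Vertex N) →L[ℂ] L2 (Vertex N) := permOp (bondA_involutive N).toPerm

abbrev hopB (N : ℕ) : L2 (Vertex N) →L[ℂ] L2 (Vertex N) := permOp (bondB_involutive N).toPerm

abbrev hopC (N : ℕ) : L2 (Vertex N) →L[ℂ] L2 (Vertex N) := permOp (bondC_involutive N).toPerm

theorem summable_norm_sq {ι : Type} (f : L2 ι) : Summable fun i => ‖f i‖ ^ 2 := by
  simpa using (memℓp_gen_iff (p := 2) (by norm_num)).1 (lp.memℓp f)

theorem lp_norm_sq_eq_tsum_fiber (f : L2 (Vertex N)) :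
    ‖f‖ ^ 2 = ∑' n : ℤ, ∑ j : Fin 2, ∑ k : ZMod N, ‖f (n, j, k)‖ ^ 2 := by
  rw [lp_norm_sq, (summable_norm_sq f).tsum_prod]
  refine tsum_congr fun n => ?_
  rw [tsum_fintype, Fintype.sum_prod_type]

theorem summable_fiber (f : L2 (Vertex N)) :
    Summable fun n : ℤ => ∑ j : Fin 2, ∑ k : ZMod N, ‖f (n, j, k)‖ ^ 2 := by
  have := (summable_norm_sq f).prod
  simpa only [tsum_fintype, Fintype.sum_prod_type] using this

/-- The walk along the bonds B, C, A returns to the same `n` on the other sublattice, displaced by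
one in `k` relative to bond C. On each fibre the operator is therefore `x_k + x_{k ± 1}`, and the
Wirtinger inequality applies. -/
theorem norm_hop_add_le {f : L2 (Vertex N)} (hf : f ∈ zeroMean N)
    (hc : 0 ≤ Real.cos (Real.pi / N)) :
    ‖hopC N f + hopA N (hopC N (hopB N f))‖ ≤ 2 * Real.cos (Real.pi / N) * ‖f‖ := by
  refine abs_le_of_sq_le_sq' ?_ (by positivity) |>.2
  rw [mul_pow, lp_norm_sq_eq_tsum_fiber, lp_norm_sq_eq_tsum_fiber f, ← tsum_mul_left]
  refine Summable.tsum_le_tsum (fun n => ?_) (summable_fiber _) ((summable_fiber f).mul_left _)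
  have e0 : ∀ k, (hopC N f + hopA N (hopC N (hopB N f))) (n, 0, k) =
      f (n, 1, k) + f (n, 1, k - 1) := fun k => by
    change f (n, 1, k) + f (n + 1 - 1, 1, k - 1) = _
    rw [add_sub_cancel_right]
  have e1 : ∀ k, (hopC N f + hopA N (hopC N (hopB N f))) (n, 1, k) =
      f (n, 0, k) + f (n, 0, k + 1) := fun k => by
    change f (n, 0, k) + f (n - 1 + 1, 0, k + 1) = _
    rw [sub_add_cancel]
  rw [Fin.sum_univ_two, Fin.sum_univ_two]
  simp only [e0, e1]
  have s0 := sum_norm_add_shift_sq_le (hf n 0)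
  have s1 := sum_norm_add_shift_sq_le (hf n 1)
  have e2 : ∑ k, ‖f (n, 1, k) + f (n, 1, k - 1)‖ ^ 2 =
      ∑ k, ‖f (n, 1, k) + f (n, 1, k + 1)‖ ^ 2 := by
    rw [← Equiv.sum_comp (Equiv.addRight (1 : ZMod N))]
    refine Finset.sum_congr rfl fun k _ => ?_
    rw [Equiv.coe_addRight, add_sub_cancel_right, add_comm]
  rw [e2, mul_add]
  linarith

theorem permOp_permOp {ι : Type} {σ : ι → ι} (hσ : Function.Involutive σ) (f : L2 ι) :
    permOp hσ.toPerm (permOp hσ.toPerm f) = f := by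
  ext i
  change f (σ (σ i)) = f i
  rw [hσ i]

/-- The hexagon relation: as the hoppings are involutions it says that the word `BACBAC` goes once
around a hexagon and closes. -/
theorem hopB_hopA_hopC_hopB (f : L2 (Vertex N)) :
    hopB N (hopA N (hopC N (hopB N f))) = hopC N (hopA N f) := by
  ext ⟨n, j, k⟩
  fin_cases j
  · change f (n - 1 - 1 + 1, 0, k - 1 + 1) = f (n - 1, 0, k)
    rw [sub_add_cancel, sub_add_cancel]
  · change f (n + 1 + 1 - 1, 1, k + 1 - 1) = f (n + 1, 1, k)
    rw [add_sub_cancel_right, add_sub_cancel_right]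

/-- By the hexagon relation, replacing `C` by `ACB` in `⟨Cf, (A + B)f⟩` only conjugates it, so twice
the real part is the pairing with `C + ACB`. With `t = ‖(A + B)f‖` and `c = cos (π/N)` the square
norm lies within `2 c t ‖f‖` of `‖f‖² + t²`: completing the square gives the lower bound, `t ≤ 2
‖f‖` the upper one. -/
theorem free_bounds {f : L2 (Vertex N)} (hf : f ∈ zeroMean N)
    (hc : 0 ≤ Real.cos (Real.pi / N)) :
    (Real.sin (Real.pi / N) * ‖f‖) ^ 2 ≤ ‖hopC N f + (hopA N f + hopB N f)‖ ^ 2 ∧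
      ‖hopC N f + (hopA N f + hopB N f)‖ ^ 2 ≤ (5 + 4 * Real.cos (Real.pi / N)) * ‖f‖ ^ 2 := by
  have h1 : inner ℂ (hopA N (hopC N (hopB N f))) (hopA N f) = inner ℂ (hopB N f) (hopC N f) := by
    rw [inner_permOp, inner_permOp, permOp_permOp]
  have h2 : inner ℂ (hopA N (hopC N (hopB N f))) (hopB N f) = inner ℂ (hopA N f) (hopC N f) := by
    rw [← inner_permOp, hopB_hopA_hopC_hopB, inner_permOp]
  set t := ‖hopA N f + hopB N f‖
  have ht : t ≤ 2 * ‖f‖ := by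
    refine (norm_add_le _ _).trans ?_
    rw [norm_permOp, norm_permOp, two_mul]
  have hre : 2 * RCLike.re (inner ℂ (hopC N f) (hopA N f + hopB N f)) =
      RCLike.re (inner ℂ (hopC N f + hopA N (hopC N (hopB N f))) (hopA N f + hopB N f)) := by
    have : inner ℂ (hopA N (hopC N (hopB N f))) (hopA N f + hopB N f) =
        inner ℂ (hopA N f + hopB N f) (hopC N f) := by
      rw [inner_add_right, inner_add_left, h1, h2, add_comm]
    rw [inner_add_left, this, map_add, inner_re_symm (hopA N f + hopB N f)]
    ring
  have habs : |2 * RCLike.re (inner ℂ (hopC N f) (hopA N f + hopB N f))| ≤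
      2 * Real.cos (Real.pi / N) * ‖f‖ * t := by
    rw [hre]
    exact (RCLike.abs_re_le_norm _).trans ((norm_inner_le_norm _ _).trans
      (mul_le_mul_of_nonneg_right (norm_hop_add_le hf hc) (norm_nonneg _)))
  rw [@norm_add_sq ℂ, norm_permOp]
  obtain ⟨h3, h4⟩ := abs_le.1 habs
  have hs := Real.sin_sq_add_cos_sq (Real.pi / N)
  have ht0 : 0 ≤ t := norm_nonneg _
  have hf0 := norm_nonneg f
  constructor
  · nlinarith [sq_nonneg (t - Real.cos (Real.pi / N) * ‖f‖)]
  · have h5 : Real.cos (Real.pi / N) * ‖f‖ * t ≤ Real.cos (Real.pi / N) * ‖f‖ * (2 * ‖f‖) :=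
      mul_le_mul_of_nonneg_left ht (by positivity)
    nlinarith

theorem hamiltonian_apply_eq (v : Potential) (f : L2 (Vertex N)) :
    hamiltonian N v f = hopC N f + (hopA N f + hopB N f) + mulOp v (site N) f := by
  rw [add_comm (hopC N f)]
  rfl

theorem norm_hamiltonian_ge (v : Potential) {f : L2 (Vertex N)} (hf : f ∈ zeroMean N)
    (hc : 0 ≤ Real.cos (Real.pi / N)) :
    (Real.sin (Real.pi / N) - ‖v‖) * ‖f‖ ≤ ‖hamiltonian N v f‖ := by
  have h1 := abs_le_of_sq_le_sq' (free_bounds hf hc).1 (norm_nonneg _) |>.2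
  have h2 := norm_mulOp_le v (site N) f
  have h3 := norm_sub_norm_le (hopC N f + (hopA N f + hopB N f)) (-mulOp v (site N) f)
  rw [sub_neg_eq_add, norm_neg, ← hamiltonian_apply_eq] at h3
  linarith

theorem norm_hamiltonian_le (v : Potential) {f : L2 (Vertex N)} (hf : f ∈ zeroMean N)
    (hc : 0 ≤ Real.cos (Real.pi / N)) :
    ‖hamiltonian N v f‖ ≤ (√(5 + 4 * Real.cos (Real.pi / N)) + ‖v‖) * ‖f‖ := by
  have h1 : ‖hopC N f + (hopA N f + hopB N f)‖ ≤ √(5 + 4 * Real.cos (Real.pi / N)) * ‖f‖ := by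
    refine abs_le_of_sq_le_sq' ?_ (by positivity) |>.2
    rw [mul_pow, Real.sq_sqrt (by linarith)]
    exact (free_bounds hf hc).2
  have h2 := norm_mulOp_le v (site N) f
  rw [hamiltonian_apply_eq]
  refine (norm_add_le _ _).trans ?_
  linarith

end ZeroMean

end Armchair

end


noncomputable section

set_option linter.unusedSectionVars false

namespace Armchair

/-! ## The reduction of the armchair Hamiltonian -/

section Lift

variable {N : ℕ} [NeZero N]

/-- The sign `σ ^ (n + j)`. -/
def liftSign (σ : ℤˣ) (n : ℤ) (j : Fin 2) : ℂ := ((σ ^ (n + (j : ℕ)) : ℤˣ) : ℤ)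

theorem liftSign_zero (σ : ℤˣ) (n : ℤ) : liftSign σ n 0 = ((σ ^ n : ℤˣ) : ℤ) := by
  simp [liftSign]

theorem liftSign_one (σ : ℤˣ) (n : ℤ) : liftSign σ n 1 = (σ : ℤ) * ((σ ^ n : ℤˣ) : ℤ) := by
  simp [liftSign, zpow_add, mul_comm]

theorem unit_cast_mul_self (σ : ℤˣ) : ((σ : ℤ) : ℂ) * ((σ : ℤ) : ℂ) = 1 := by
  have := Int.units_coe_mul_self σ
  exact_mod_cast this

theorem liftSign_mul_self (σ : ℤˣ) (n : ℤ) (j : Fin 2) : liftSign σ n j * liftSign σ n j = 1 :=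
  unit_cast_mul_self _

theorem conj_liftSign (σ : ℤˣ) (n : ℤ) (j : Fin 2) :
    (starRingEnd ℂ) (liftSign σ n j) = liftSign σ n j := by
  simp [liftSign]

theorem norm_liftSign (σ : ℤˣ) (n : ℤ) (j : Fin 2) : ‖liftSign σ n j‖ = 1 := by
  have h := congrArg norm (liftSign_mul_self σ n j)
  rw [norm_mul, norm_one] at h
  nlinarith [norm_nonneg (liftSign σ n j)]

/-- The normalization `(2N)^(-1/2)`. -/
def liftScale (N : ℕ) : ℝ := (√(2 * N))⁻¹

theorem liftScale_sq (N : ℕ) [NeZero N] : liftScale N * liftScale N * (2 * N) = 1 := by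
  have hN : (0 : ℝ) < N := by exact_mod_cast NeZero.pos N
  have h := Real.mul_self_sqrt (show (0 : ℝ) ≤ 2 * N by positivity)
  have h0 : √(2 * (N : ℝ)) ≠ 0 := by positivity
  rw [liftScale]
  field_simp
  rw [sq, h]

theorem hasSum_lift_norm_sq (σ : ℤˣ) (u : L2 ℤ) :
    HasSum (fun x : Vertex N => ‖liftSign σ x.1 x.2.1 * liftScale N * u x.1‖ ^ 2) (‖u‖ ^ 2) := by
  have h1 : HasSum (fun n => ‖u n‖ ^ 2) (‖u‖ ^ 2) := by
    rw [lp_norm_sq]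
    exact (summable_norm_sq u).hasSum
  have h2 := hasSum_fintype (fun _ : Fin 2 × ZMod N => liftScale N * liftScale N)
  have h3 := h1.mul h2 (h1.summable.mul_of_nonneg h2.summable (fun _ => sq_nonneg _)
    fun _ => mul_self_nonneg _)
  have e : ∑ _x : Fin 2 × ZMod N, liftScale N * liftScale N = 1 := by
    rw [Finset.sum_const, Finset.card_univ, Fintype.card_prod, Fintype.card_fin, ZMod.card,
      nsmul_eq_mul, ← liftScale_sq N]
    push_cast
    ring
  rw [e, mul_one] at h3
  refine h3.congr_fun fun x => ?_
  rw [norm_mul, norm_mul, norm_liftSign, one_mul, Complex.norm_real, mul_pow, Real.norm_eq_abs,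
    sq_abs]
  ring

/-- The isometry `(I_σ u)_{n,j,k} = σ^(n+j) (2N)^(-1/2) u_n`. -/
def lift (N : ℕ) [NeZero N] (σ : ℤˣ) : L2 ℤ →ₗᵢ[ℂ] L2 (Vertex N) where
  toFun u := ⟨fun x => liftSign σ x.1 x.2.1 * liftScale N * u x.1,
    (memℓp_gen_iff (p := 2) (by norm_num)).2
      (by simpa using (hasSum_lift_norm_sq (N := N) σ u).summable)⟩
  map_add' u w := by
    ext x
    exact mul_add _ _ _
  map_smul' a u := by
    ext x
    exact mul_left_comm _ _ _
  norm_map' u := by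
    rw [← sq_eq_sq₀ (norm_nonneg _) (norm_nonneg _), lp_norm_sq]
    exact (hasSum_lift_norm_sq (N := N) σ u).tsum_eq

theorem lift_apply (σ : ℤˣ) (u : L2 ℤ) (n : ℤ) (j : Fin 2) (k : ZMod N) :
    lift N σ u (n, j, k) = liftSign σ n j * liftScale N * u n := rfl

theorem inner_lift (σ : ℤˣ) (u : L2 ℤ) (f : L2 (Vertex N)) :
    inner ℂ (lift N σ u) f =
      ∑' n, (starRingEnd ℂ) (u n) * (liftScale N * ∑ j, liftSign σ n j * ∑ k, f (n, j, k)) := by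
  have h := lp.summable_inner (𝕜 := ℂ) (lift N σ u) f
  rw [lp.inner_eq_tsum, h.tsum_prod]
  refine tsum_congr fun n => ?_
  rw [tsum_fintype, Fintype.sum_prod_type, Finset.mul_sum, Finset.mul_sum]
  refine Finset.sum_congr rfl fun j _ => ?_
  rw [Finset.mul_sum, Finset.mul_sum, Finset.mul_sum]
  refine Finset.sum_congr rfl fun k _ => ?_
  rw [lift_apply, RCLike.inner_apply, map_mul, map_mul, conj_liftSign, Complex.conj_ofReal]
  ring

theorem inner_lift_zeroMean (σ : ℤˣ) (u : L2 ℤ) {f : L2 (Vertex N)} (hf : f ∈ zeroMean N) :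
    inner ℂ (lift N σ u) f = 0 := by
  rw [inner_lift]
  have : ∀ n j, ∑ k, f (n, j, k) = 0 := hf
  simp [this]

theorem inner_lift_lift (u w : L2 ℤ) : inner ℂ (lift N 1 u) (lift N (-1) w) = 0 := by
  rw [inner_lift]
  have e : ∀ n j, ∑ k, lift N (-1) w (n, j, k) =
      N * (liftSign (-1) n j * liftScale N * w n) := fun n j => by
    simp only [lift_apply, Finset.sum_const, Finset.card_univ, ZMod.card, nsmul_eq_mul]
  simp only [e, Fin.sum_univ_two, liftSign_zero, liftSign_one]
  simp

theorem inner_lift_single (σ : ℤˣ) (n : ℤ) (f : L2 (Vertex N)) :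
    inner ℂ (lift N σ (lp.single 2 n 1)) f =
      liftScale N * ∑ j, liftSign σ n j * ∑ k, f (n, j, k) := by
  rw [inner_lift, tsum_eq_single n]
  · simp
  · intro m hm
    simp [hm]

/-- Testing against point masses in both sectors yields the sum and the difference of the two
sublattice sums at each `n`. -/
theorem mem_zeroMean_of_inner_lift {f : L2 (Vertex N)}
    (h : ∀ σ u, inner ℂ (lift N σ u) f = 0) : f ∈ zeroMean N := by
  have h0 : (liftScale N : ℂ) ≠ 0 := by
    intro h0
    have := liftScale_sq N
    rw [Complex.ofReal_eq_zero.1 h0] at this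
    simp at this
  intro n j
  have h1 := h 1 (lp.single 2 n 1)
  have h2 := h (-1) (lp.single 2 n 1)
  rw [inner_lift_single, mul_eq_zero, or_iff_right h0, Fin.sum_univ_two, liftSign_zero,
    liftSign_one] at h1 h2
  have h3 := unit_cast_mul_self ((-1) ^ n)
  have h4 : ∑ k, f (n, 0, k) = ∑ k, f (n, 1, k) := by
    have := congrArg (fun z => (((((-1) ^ n : ℤˣ) : ℤˣ) : ℤ) : ℂ) * z) h2
    simp only [mul_add, mul_zero, ← mul_assoc, h3, one_mul] at this
    simp only [Units.val_neg, Units.val_one, Int.cast_neg, Int.cast_one, mul_neg, mul_one,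
      neg_mul, h3, one_mul] at this
    linear_combination this
  have h5 : ∑ k, f (n, 0, k) + ∑ k, f (n, 1, k) = 0 := by simpa using h1
  fin_cases j
  · change ∑ k, f (n, 0, k) = 0
    linear_combination (1 / 2 : ℂ) * h5 + (1 / 2 : ℂ) * h4
  · change ∑ k, f (n, 1, k) = 0
    linear_combination (1 / 2 : ℂ) * h5 - (1 / 2 : ℂ) * h4

/-- Along the first two families of bonds `n + j` changes by an even number, along the third by one.
The sign therefore leaves the former as ordinary hopping in `n` and turns the latter into the
constant potential `σ`. -/
theorem hamiltonian_lift {v : Potential} (hv : ∀ n : ℤ, v (2 * n) = v (2 * n + 1)) (σ : ℤˣ)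
    {u w : L2 ℤ}
    (h : ∀ n, w n = u (n + 1) + u (n - 1) + ((evenPart v n + (σ : ℤ) : ℝ) : ℂ) * u n) :
    hamiltonian N v (lift N σ u) = lift N σ w := by
  have hσ := unit_cast_mul_self σ
  have z1 : ∀ n : ℤ, (((σ ^ (n + 1) : ℤˣ) : ℤ) : ℂ) = (σ : ℤ) * ((σ ^ n : ℤˣ) : ℤ) := fun n => by
    rw [zpow_add_one, Units.val_mul, Int.cast_mul, mul_comm]
  have z2 : ∀ n : ℤ, (((σ ^ (n - 1) : ℤˣ) : ℤ) : ℂ) = (σ : ℤ) * ((σ ^ n : ℤˣ) : ℤ) := fun n => by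
    have := z1 (n - 1)
    rw [sub_add_cancel] at this
    rw [this, ← mul_assoc, hσ, one_mul]
  ext ⟨n, j, k⟩
  have hn := h n
  simp only [evenPart, Complex.ofReal_add, Complex.ofReal_intCast] at hn
  fin_cases j
  · change hamiltonian N v (lift N σ u) (n, 0, k) = lift N σ w (n, 0, k)
    simp only [hamiltonian_apply_zero, lift_apply, liftSign_zero, liftSign_one, z1, z2, hn]
    linear_combination (((σ ^ n : ℤˣ) : ℤ) : ℂ) * liftScale N * (u (n + 1) + u (n - 1)) * hσ
  · change hamiltonian N v (lift N σ u) (n, 1, k) = lift N σ w (n, 1, k)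
    simp only [hamiltonian_apply_one, lift_apply, liftSign_zero, liftSign_one, z1, z2, hn, ← hv]
    linear_combination -(((σ ^ n : ℤˣ) : ℤ) : ℂ) * liftScale N * u n * hσ

end Lift

section Model

variable {N p : ℕ} [NeZero N] [NeZero p] {v : Potential}

theorem evenPart_periodic (hper : ∀ n : ℤ, v (n + 2 * p) = v n) (n : ℤ) :
    evenPart v (n + p) = evenPart v n := by
  rw [evenPart, mul_add]
  exact hper (2 * n)

theorem evenPart_add_periodic (hper : ∀ n : ℤ, v (n + 2 * p) = v n) (c : ℝ) (n : ℤ) :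
    (fun n => evenPart v n + c) (n + p) = (fun n => evenPart v n + c) n := by
  simp only [evenPart_periodic hper]

/-- The spectral representation of `I_σ (J + σ) I_σ*`. -/
def sectorMap (N : ℕ) [NeZero N] (hper : ∀ n : ℤ, v (n + 2 * p) = v n) (σ : ℤˣ) (c : ℝ) :
    SpecSpace p (fun n => evenPart v n + c) →ₗᵢ[ℂ] L2 (Vertex N) :=
  (lift N σ).comp (blochBasis (evenPart_add_periodic hper c)).repr.toLinearIsometry

theorem hamiltonian_sectorMap (hv : ∀ n : ℤ, v (2 * n) = v (2 * n + 1))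
    (hper : ∀ n : ℤ, v (n + 2 * p) = v n) (σ : ℤˣ) {c : ℝ} (hc : c = (σ : ℤ))
    (g h : SpecSpace p (fun n => evenPart v n + c))
    (hgh : h =ᵐ[volume.restrict (bandSet p fun n => evenPart v n + c)]
      fun x => (x : ℂ) • g x) :
    hamiltonian N v (sectorMap N hper σ c g) = sectorMap N hper σ c h :=
  hamiltonian_lift hv σ fun n => by
    rw [← hc]
    exact blochBasis_repr_mul (evenPart_add_periodic hper c) hgh n

/-- The armchair Hamiltonian is the orthogonal sum of `J + 1`, `J - 1` and its zero-mean part. -/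
def armchairModel (N : ℕ) [NeZero N] (hv : ∀ n : ℤ, v (2 * n) = v (2 * n + 1))
    (hper : ∀ n : ℤ, v (n + 2 * p) = v n) :
    TwoBandModel (hamiltonian N v) (bandSet p fun n => evenPart v n + 1)
      (bandSet p fun n => evenPart v n + -1) where
  symm := hamiltonian_symm v
  open₁ := isOpen_bandSet _ _
  open₂ := isOpen_bandSet _ _
  null₁ := volume_closure_bandSet_diff (evenPart_add_periodic hper 1)
  null₂ := volume_closure_bandSet_diff (evenPart_add_periodic hper (-1))
  bdd := by
    have h1 := bandSet_subset_Icc (p := p) (q := fun n => evenPart v n + 1)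
      (evenPart_add_periodic hper 1)
    have h2 := bandSet_subset_Icc (p := p) (q := fun n => evenPart v n + -1)
      (evenPart_add_periodic hper (-1))
    exact ⟨_, _, h1.trans (Set.Icc_subset_Icc (min_le_left _ _) (le_max_left _ _)),
      h2.trans (Set.Icc_subset_Icc (min_le_right _ _) (le_max_right _ _))⟩
  W₁ := sectorMap N hper 1 1
  W₂ := sectorMap N hper (-1) (-1)
  rest := zeroMean N
  mul₁ := hamiltonian_sectorMap hv hper 1 (by simp)
  mul₂ := hamiltonian_sectorMap hv hper (-1) (by simp)
  map_rest f hf := hamiltonian_mem_zeroMean v hf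
  orth g₁ g₂ := inner_lift_lift _ _
  orth₁ g f hf := inner_lift_zeroMean 1 _ hf
  orth₂ g f hf := inner_lift_zeroMean (-1) _ hf
  decomp f := by
    -- The sector components come from the adjoints of the isometries; what remains is orthogonal to
    -- both ranges, hence of zero mean.
    set u₁ := ContinuousLinearMap.adjoint (lift N 1).toContinuousLinearMap f
    set u₂ := ContinuousLinearMap.adjoint (lift N (-1)).toContinuousLinearMap f
    have hu₁ : ∀ w : L2 ℤ, inner ℂ (lift N 1 w) f = inner ℂ w u₁ := fun w =>
      (ContinuousLinearMap.adjoint_inner_right (lift N 1).toContinuousLinearMap w f).symm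
    have hu₂ : ∀ w : L2 ℤ, inner ℂ (lift N (-1) w) f = inner ℂ w u₂ := fun w =>
      (ContinuousLinearMap.adjoint_inner_right (lift N (-1)).toContinuousLinearMap w f).symm
    refine ⟨(blochBasis (evenPart_add_periodic hper 1)).repr.symm u₁,
      (blochBasis (evenPart_add_periodic hper (-1))).repr.symm u₂,
      f - (lift N 1 u₁ + lift N (-1) u₂), mem_zeroMean_of_inner_lift fun σ u => ?_, ?_⟩
    · rw [inner_sub_right, inner_add_right]
      rcases Int.units_eq_one_or σ with rfl | rfl
      · rw [hu₁, LinearIsometry.inner_map_map, inner_lift_lift]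
        ring
      · have : inner ℂ (lift N (-1) u) (lift N 1 u₁) = 0 := by
          rw [← inner_conj_symm, inner_lift_lift, map_zero]
        rw [hu₂, LinearIsometry.inner_map_map, this]
        ring
    · have e₁ : sectorMap N hper 1 1
          ((blochBasis (evenPart_add_periodic hper 1)).repr.symm u₁) = lift N 1 u₁ :=
        congrArg (lift N 1) (LinearIsometryEquiv.apply_symm_apply _ _)
      have e₂ : sectorMap N hper (-1) (-1)
          ((blochBasis (evenPart_add_periodic hper (-1))).repr.symm u₂) = lift N (-1) u₂ :=
        congrArg (lift N (-1)) (LinearIsometryEquiv.apply_symm_apply _ _)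
      rw [e₁, e₂]
      abel

end Model

end Armchair

end


noncomputable section

set_option linter.unusedSectionVars false

namespace Armchair

open Polynomial Filter
open scoped Topology

/-! ## Opening of the gaps for small potentials -/

section OpenGaps

variable {p : ℕ} [NeZero p]

/-- Abel summation for two `2p`-periodic solutions. -/
theorem sum_mul_sub_mul_eq_zero {m : ℕ} {c d f g : ℤ → ℂ} (hf : IsSol c f) (hg : IsSol d g)
    (hfm : ∀ n, f (n + m) = f n) (hgm : ∀ n, g (n + m) = g n) :
    ∑ j ∈ Finset.range m, (c j - d j) * (f j * g j) = 0 := by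
  have key : ∀ k : ℕ, ∑ j ∈ Finset.range k, (c j - d j) * (f j * g j) =
      (g (k - 1) * f k - f (k - 1) * g k) - (g (0 - 1) * f 0 - f (0 - 1) * g 0) := by
    intro k
    induction k with
    | zero => simp
    | succ k ih =>
      rw [Finset.sum_range_succ, ih]
      have h1 := hf k
      have h2 := hg k
      push_cast
      rw [add_sub_cancel_right]
      linear_combination f k * h2 - g k * h1
  have e : ((m : ℤ) - 1) = 0 - 1 + m := by ring
  have h0 := hfm 0
  have h1 := hgm 0
  rw [zero_add] at h0 h1
  rw [key, e, hfm, hgm, h0, h1, sub_self]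

/-- The gap eigenvalue is degenerate only if all solutions are periodic. -/
theorem mem_periodicSol_of_zPlus_le {q : ℤ → ℝ} (hq : ∀ n, q (n + p) = q n) {n : ℕ} (hn : 1 ≤ n)
    (hn' : n ≤ p - 1) (h : zPlus p q n ≤ zMinus p q n) {u : ℤ → ℝ}
    (hu : IsSol (fun k => zPlus p q n - q k) u) : u ∈ periodicSol p q (zPlus p q n) := by
  have hle : zMinus p q n ≤ zPlus p q n :=
    periodicEigenvalue_mono p q (by omega) (by omega)
  refine mem_periodicSol_of_finrank hq (finrank_periodicSol_ge hq
    ![⟨2 * n - 1, by omega⟩, ⟨2 * n, by omega⟩] ?_ ?_) hu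
  · intro i j hij
    fin_cases i <;> fin_cases j <;> simp at hij ⊢ <;> omega
  · intro i
    fin_cases i
    · exact le_antisymm hle h
    · rfl

theorem tendsto_isSol {ι : Type} {l : Filter ι} {c f : ι → ℤ → ℂ} {d g : ℤ → ℂ}
    (hf : ∀ t, IsSol (c t) (f t)) (hg : IsSol d g)
    (hc : ∀ n, Tendsto (fun t => c t n) l (𝓝 (d n)))
    (h0 : ∀ t, f t 0 = g 0) (h1 : ∀ t, f t 1 = g 1) (n : ℕ) :
    Tendsto (fun t => f t n) l (𝓝 (g n)) := by
  suffices h : Tendsto (fun t => f t n) l (𝓝 (g n)) ∧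
      Tendsto (fun t => f t (n + 1)) l (𝓝 (g (n + 1))) from h.1
  induction n with
  | zero => simp [h0, h1, tendsto_const_nhds]
  | succ k ih =>
    push_cast
    refine ⟨ih.2, ?_⟩
    have e1 : ∀ t, f t (k + 1 + 1) = c t (k + 1) * f t (k + 1) - f t k := fun t => by
      have := hf t (k + 1)
      rw [add_sub_cancel_right] at this
      linear_combination this
    have e2 : g (k + 1 + 1) = d (k + 1) * g (k + 1) - g k := by
      have := hg (k + 1)
      rw [add_sub_cancel_right] at this
      linear_combination this
    simp only [e1, e2]
    exact ((hc _).mul ih.2).sub ih.1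

/-- The free Bloch wave with energy `2 cos κ`. -/
def freeWave (κ : ℝ) (j : ℤ) : ℂ := Complex.exp (κ * j * Complex.I)

theorem isSol_freeWave (κ : ℝ) : IsSol (fun _ => ((2 * Real.cos κ : ℝ) : ℂ)) (freeWave κ) := by
  intro n
  have e1 : freeWave κ (n + 1) = Complex.exp (κ * Complex.I) * freeWave κ n := by
    rw [freeWave, freeWave, ← Complex.exp_add]
    congr 1
    push_cast
    ring
  have e2 : freeWave κ (n - 1) = Complex.exp (-κ * Complex.I) * freeWave κ n := by
    rw [freeWave, freeWave, ← Complex.exp_add]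
    congr 1
    push_cast
    ring
  rw [e1, e2, Complex.ofReal_mul, Complex.ofReal_cos, Complex.ofReal_ofNat, Complex.two_cos]
  ring

/-- If the `n`-th gap is closed for arbitrarily small `t`, then a Fourier coefficient of the
potential vanishes. -/
theorem sum_eq_zero_of_frequently_closed {q : ℤ → ℝ} (hq : ∀ n, q (n + p) = q n) {Q : ℝ}
    (hQ : ∀ n, |q n| ≤ Q) {n : ℕ} (hn : 1 ≤ n) (hn' : n ≤ p - 1)
    (h : ∃ᶠ t in 𝓝[>] (0 : ℝ),
      zPlus p (fun k => t * q k) n ≤ zMinus p (fun k => t * q k) n) :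
    ∑ j ∈ Finset.range (2 * p),
      (q j : ℂ) * Complex.exp (2 * Real.pi * Complex.I / p) ^ ((p - n) * j) = 0 := by
  have hp := NeZero.pos p
  have hpC : (p : ℂ) ≠ 0 := by exact_mod_cast hp.ne'
  have hpR : (p : ℝ) ≠ 0 := by exact_mod_cast hp.ne'
  -- The supplement `π - π n / p`, so that `2 cos κ` is the free node without a sign.
  set κ : ℝ := Real.pi * (p - n : ℕ) / p with hκ
  set l0 : ℝ := 2 * Real.cos κ
  have hl0 : freeNode p n = l0 := by
    rw [freeNode, show Real.pi * n / p = Real.pi - κ by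
      rw [hκ, Nat.cast_sub (by omega)]
      field_simp
      ring, Real.cos_pi_sub]
    ring
  set ζ := Complex.exp (2 * Real.pi * Complex.I / p) with hζ
  have hprim : IsPrimitiveRoot ζ p := Complex.isPrimitiveRoot_exp p hp.ne'
  have gsq : ∀ j : ℕ, freeWave κ j * freeWave κ j = ζ ^ ((p - n) * j) := fun j => by
    rw [freeWave, ← Complex.exp_add, hζ, ← Complex.exp_nat_mul]
    congr 1
    rw [hκ]
    push_cast
    ring
  have gper : ∀ j, freeWave κ (j + (2 * p : ℕ)) = freeWave κ j := fun j => by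
    rw [freeWave, freeWave, show (κ : ℂ) * ((j + (2 * p : ℕ) : ℤ) : ℂ) * Complex.I =
      κ * j * Complex.I + (p - n : ℕ) * (2 * Real.pi * Complex.I) by
        rw [hκ]
        push_cast
        field_simp,
      Complex.exp_add, Complex.exp_nat_mul_two_pi_mul_I, mul_one]
  -- The wave is paired with itself, not with its conjugate: `g²` is a nontrivial character because
  -- `0 < p - n < p`, so its sum vanishes and the eigenvalue shift disappears in the limit.
  have gsum : ∑ j ∈ Finset.range (2 * p), freeWave κ j * freeWave κ j = 0 := by
    have hne : ζ ^ (p - n) ≠ 1 := by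
      rw [ne_eq, hprim.pow_eq_one_iff_dvd]
      exact fun hd => absurd (Nat.le_of_dvd (by omega) hd) (by omega)
    have := mul_neg_geom_sum (ζ ^ (p - n)) (2 * p)
    rw [← pow_mul, show (p - n) * (2 * p) = p * (2 * (p - n)) by ring, pow_mul, hprim.pow_eq_one,
      one_pow, sub_self, mul_eq_zero, or_iff_right (sub_ne_zero.2 hne.symm)] at this
    rw [← this]
    exact Finset.sum_congr rfl fun j _ => by rw [gsq, pow_mul]
  -- the perturbed solutions with the initial values of the free wave
  set z : ℝ → ℝ := fun t => zPlus p (fun k => t * q k) n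
  set f : ℝ → ℤ → ℂ := fun t j =>
    freeWave κ 0 * ((theta (fun k => t * q k) j).eval (z t) : ℝ) +
      freeWave κ 1 * ((phi (fun k => t * q k) j).eval (z t) : ℝ)
  have hcast : ∀ t {u : ℤ → ℝ}, IsSol (fun k => z t - t * q k) u →
      IsSol (fun k => ((z t - t * q k : ℝ) : ℂ)) (fun k => (u k : ℂ)) :=
    fun t u hu => hu.map Complex.ofRealHom
  have hf : ∀ t, IsSol (fun k => ((z t - t * q k : ℝ) : ℂ)) (f t) := fun t =>
    ((hcast t (isSol_eval _ _ (isSol_theta _))).const_mul (freeWave κ 0)).add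
      ((hcast t (isSol_eval _ _ (isSol_phi _))).const_mul (freeWave κ 1))
  have hz : ∀ t, 0 < t → |z t - l0| ≤ t * Q := fun t ht => by
    have := zPlus_mem_Icc (p := p) (q := fun k => t * q k) (c := 0) (δ := t * Q)
      (fun k => by rw [abs_mul, abs_of_pos ht]; exact mul_le_mul_of_nonneg_left (hQ k) ht.le)
      (show n < p by omega)
    simp only [add_zero, hl0] at this
    rw [abs_le]
    constructor <;> linarith [this.1, this.2]
  -- pairing with the free wave
  have hpair : ∃ᶠ t in 𝓝[>] (0 : ℝ), 0 < t ∧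
      ∑ j ∈ Finset.range (2 * p), (((z t - l0) / t - q j : ℝ) : ℂ) *
        (f t j * freeWave κ j) = 0 := by
    refine (h.and_eventually self_mem_nhdsWithin).mono fun t ht => ⟨ht.2, ?_⟩
    have ht0 : (0 : ℝ) < t := ht.2
    have hqt : ∀ k, (fun k => t * q k) (k + p) = (fun k => t * q k) k := fun k => by simp [hq]
    have hper : ∀ j, f t (j + (2 * p : ℕ)) = f t j := fun j => by
      have h1 := (mem_periodicSol_of_zPlus_le hqt hn hn' ht.1
        (isSol_eval _ _ (isSol_theta _))).2 j
      have h2 := (mem_periodicSol_of_zPlus_le hqt hn hn' ht.1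
        (isSol_eval _ _ (isSol_phi _))).2 j
      dsimp only at h1 h2
      simp only [f, z]
      rw [h1, h2]
    have e : ∀ j : ℕ, (((z t - t * q j : ℝ) : ℂ) - (l0 : ℝ)) * (f t j * freeWave κ j) =
        (t : ℂ) * ((((z t - l0) / t - q j : ℝ) : ℂ) * (f t j * freeWave κ j)) := fun j => by
      have : ((z t - t * q j : ℝ) : ℂ) - (l0 : ℝ) = (t : ℂ) * (((z t - l0) / t - q j : ℝ) : ℂ) := by
        rw [← Complex.ofReal_sub, ← Complex.ofReal_mul, mul_sub, mul_div_cancel₀ _ ht0.ne']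
        congr 1
        ring
      rw [this, mul_assoc]
    have := (Finset.sum_congr rfl fun j _ => (e j).symm).trans
      (sum_mul_sub_mul_eq_zero (hf t) (isSol_freeWave κ) hper gper)
    rw [← Finset.mul_sum, mul_eq_zero] at this
    exact this.resolve_left (by exact_mod_cast ht0.ne')
  have hztend : Tendsto z (𝓝[>] 0) (𝓝 l0) := by
    rw [tendsto_iff_norm_sub_tendsto_zero]
    have : Tendsto (fun t : ℝ => t * Q) (𝓝[>] 0) (𝓝 0) := by
      have := (tendsto_id (α := ℝ) (x := 𝓝 0)).mul_const Q
      rw [zero_mul] at this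
      exact this.mono_left nhdsWithin_le_nhds
    refine squeeze_zero' (Eventually.of_forall fun _ => norm_nonneg _) ?_ this
    filter_upwards [self_mem_nhdsWithin] with t ht using hz t ht
  have hftend : ∀ j : ℕ, Tendsto (fun t => f t j) (𝓝[>] 0) (𝓝 (freeWave κ j)) := by
    refine tendsto_isSol hf (isSol_freeWave κ) (fun k => ?_) (fun t => by simp [f])
      (fun t => by simp [f])
    refine (Complex.continuous_ofReal.tendsto _).comp ?_
    have h2 : Tendsto (fun t : ℝ => t * q k) (𝓝[>] 0) (𝓝 0) := by
      have := (tendsto_id (α := ℝ) (x := 𝓝 0)).mul_const (q k)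
      rw [zero_mul] at this
      exact this.mono_left nhdsWithin_le_nhds
    have := hztend.sub h2
    rwa [sub_zero] at this
  -- pass to the limit
  set S : ℝ → ℂ := fun t => ∑ j ∈ Finset.range (2 * p), f t j * freeWave κ j
  set R : ℝ → ℂ := fun t => ∑ j ∈ Finset.range (2 * p), (q j : ℂ) * (f t j * freeWave κ j)
  have hS : Tendsto (fun t => Q * ‖S t‖) (𝓝[>] 0) (𝓝 0) := by
    have : Tendsto S (𝓝[>] 0) (𝓝 0) := by
      rw [← gsum]
      exact tendsto_finsetSum _ fun j _ => (hftend j).mul_const _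
    simpa using (this.norm).const_mul Q
  have hR : Tendsto (fun t => ‖R t‖) (𝓝[>] 0) (𝓝 ‖∑ j ∈ Finset.range (2 * p),
      (q j : ℂ) * ζ ^ ((p - n) * j)‖) := by
    refine Tendsto.norm (tendsto_finsetSum _ fun j _ => ?_)
    rw [← gsq]
    exact ((hftend j).mul_const _).const_mul _
  -- The quotient `(z t - l0) / t` need not converge, but it is bounded by `Q`; this is enough
  -- because `S t → 0`.
  have hRS : ∃ᶠ t in 𝓝[>] (0 : ℝ), ‖R t‖ ≤ Q * ‖S t‖ := by
    refine hpair.mono fun t ht => ?_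
    have e : R t = (((z t - l0) / t : ℝ) : ℂ) * S t := by
      have := ht.2
      simp only [Complex.ofReal_sub _ (q _), sub_mul, Finset.sum_sub_distrib,
        ← Finset.mul_sum] at this
      exact (sub_eq_zero.1 this).symm
    rw [e, norm_mul, Complex.norm_real, Real.norm_eq_abs, abs_div, abs_of_pos ht.1]
    refine mul_le_mul_of_nonneg_right ?_ (norm_nonneg _)
    rw [div_le_iff₀ ht.1, mul_comm]
    exact hz t ht.1
  have hle := le_of_tendsto_of_tendsto_of_frequently hR hS hRS
  exact norm_le_zero_iff.1 hle

/-- Moves from the sum over two periods starting at `0`, given by Abel summation, to one period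
starting at `1`, the indexing of `evenVector`. -/
theorem sum_range_shift {q : ℤ → ℝ} {ω : ℂ} (hq : ∀ n, q (n + p) = q n) (hω : ω ^ p = 1) :
    ∑ j ∈ Finset.range (2 * p), (q j : ℂ) * ω ^ j =
      2 * (ω * ∑ j ∈ Finset.range p, (q (j + 1) : ℂ) * ω ^ j) := by
  set F : ℕ → ℂ := fun j => (q j : ℂ) * ω ^ j
  have hF : ∀ j, F (p + j) = F j := fun j => by
    simp only [F]
    rw [pow_add, hω, one_mul, Nat.cast_add, add_comm (p : ℤ), hq]
  have h1 : ω * ∑ j ∈ Finset.range p, (q (j + 1) : ℂ) * ω ^ j =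
      ∑ j ∈ Finset.range p, F (j + 1) := by
    rw [Finset.mul_sum]
    refine Finset.sum_congr rfl fun j _ => ?_
    simp only [F]
    push_cast
    ring
  have h2 : ∑ j ∈ Finset.range p, F (j + 1) = ∑ j ∈ Finset.range p, F j := by
    have := (Finset.sum_range_succ' F p).symm.trans (Finset.sum_range_succ F p)
    have h0 := hF 0
    rw [add_zero] at h0
    rw [h0] at this
    exact add_right_cancel this
  have h3 : ∑ j ∈ Finset.range (2 * p), F j =
      ∑ j ∈ Finset.range p, F j + ∑ j ∈ Finset.range p, F (p + j) := by
    rw [two_mul, Finset.sum_range_add]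
  rw [h1, h2, h3, Finset.sum_congr rfl fun j _ => hF j, two_mul]

/-- The Fourier coefficients of the vectors in `Ξ_p` do not vanish. -/
theorem sum_ne_zero_of_mem_Xi {u : Fin p → ℝ} (hu : u ∈ Xi p) {n : ℕ} (hn : 1 ≤ n)
    (hn' : n ≤ p - 1) :
    ∑ j : Fin p, (u j : ℂ) *
      Complex.exp (2 * Real.pi * Complex.I / p) ^ ((p - n) * (j : ℕ)) ≠ 0 := by
  obtain ⟨α, hα, hsum⟩ := hu
  have hp := NeZero.pos p
  have hpC : (p : ℂ) ≠ 0 := by exact_mod_cast hp.ne'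
  set ζ := Complex.exp (2 * Real.pi * Complex.I / p) with hζ
  have hprim : IsPrimitiveRoot ζ p := Complex.isPrimitiveRoot_exp p hp.ne'
  have ehat : ∀ m (j : Fin p), eHat p m j = (p : ℂ)⁻¹ * ζ ^ (m * (j : ℕ)) := fun m j => by
    rw [eHat, hζ, ← Complex.exp_nat_mul, ← Complex.exp_nat_mul]
    congr 2
    push_cast
    ring
  have orth : ∀ m ≤ p, ∑ j : Fin p, eHat p m j * ζ ^ ((p - n) * (j : ℕ)) =
      if m = n then 1 else 0 := fun m hm => by
    have e : ∀ j : Fin p, eHat p m j * ζ ^ ((p - n) * (j : ℕ)) =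
        (p : ℂ)⁻¹ * (ζ ^ (m + (p - n))) ^ (j : ℕ) := fun j => by
      rw [ehat, mul_assoc, ← pow_add, ← add_mul, pow_mul]
    simp only [e]
    rw [← Finset.mul_sum, Fin.sum_univ_eq_sum_range (fun j => (ζ ^ (m + (p - n))) ^ j)]
    split_ifs with hmn
    · rw [hmn, Nat.add_sub_cancel' (by omega), hprim.pow_eq_one]
      simp [hpC]
    · have hne : ζ ^ (m + (p - n)) ≠ 1 := by
        rw [ne_eq, hprim.pow_eq_one_iff_dvd]
        rintro ⟨k, hk⟩
        rcases Nat.lt_or_ge k 2 with h2 | h2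
        · interval_cases k <;> omega
        · have : p * 2 ≤ p * k := Nat.mul_le_mul_left p h2
          omega
      have := mul_neg_geom_sum (ζ ^ (m + (p - n))) p
      rw [← pow_mul, mul_comm _ p, pow_mul ζ, hprim.pow_eq_one, one_pow, sub_self, mul_eq_zero,
        or_iff_right (sub_ne_zero.2 hne.symm)] at this
      rw [this, mul_zero]
  have e : ∑ j : Fin p, (u j : ℂ) * ζ ^ ((p - n) * (j : ℕ)) =
      ∑ m ∈ Finset.range (p / 2 + 1),
        (α m : ℂ) * ((if m = n then 1 else 0) + if p - m = n then 1 else 0) := by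
    simp only [hsum, Finset.sum_mul]
    rw [Finset.sum_comm]
    refine Finset.sum_congr rfl fun m hm => ?_
    have hm' := Finset.mem_range.1 hm
    rw [← orth m (by omega), ← orth (p - m) (by omega), ← Finset.sum_add_distrib, Finset.mul_sum]
    refine Finset.sum_congr rfl fun j _ => ?_
    ring
  rw [e]
  -- The only index up to `p / 2` with `m = n` or `p - m = n`; both hold when `2n = p`, and then the
  -- factor is `2`.
  set m₀ := min n (p - n)
  have hm₀ : 1 ≤ m₀ ∧ 2 * m₀ ≤ p := by omega
  rw [Finset.sum_eq_single m₀]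
  · refine mul_ne_zero (by exact_mod_cast hα m₀ hm₀.1 hm₀.2) ?_
    rcases Nat.lt_or_ge n (p - n) with h1 | h1
    · rw [if_pos (by omega), if_neg (by omega)]
      norm_num
    · rcases h1.eq_or_lt with h2 | h2
      · rw [if_pos (by omega), if_pos (by omega)]
        norm_num
      · rw [if_neg (by omega), if_pos (by omega)]
        norm_num
  · intro m hm hne
    have hm' := Finset.mem_range.1 hm
    rw [if_neg (by omega), if_neg (by omega)]
    simp
  · intro h
    exact absurd (Finset.mem_range.2 (by omega)) h

/-- Failure to open for all small `t` means being closed for arbitrarily small `t`, which kills a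
Fourier coefficient. Finitely many `n` allow one `t₀`. -/
theorem exists_gaps_open {v : Potential} (hper : ∀ n : ℤ, v (n + 2 * p) = v n)
    (hΞ : evenVector p v ∈ Xi p) :
    ∃ t₀ : ℝ, 0 < t₀ ∧ ∀ t : ℝ, 0 < t → t < t₀ → ∀ n : ℕ, 1 ≤ n → n ≤ p - 1 →
      zMinus p (evenPart (t • v)) n < zPlus p (evenPart (t • v)) n := by
  have hp := NeZero.pos p
  have hq := evenPart_periodic hper
  have hQ : ∀ n, |evenPart v n| ≤ ‖v‖ := fun n => lp.norm_apply_le_norm (by simp) v (2 * n)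
  have key : ∀ᶠ t in 𝓝[>] (0 : ℝ), ∀ n ∈ Finset.range p, 1 ≤ n →
      zMinus p (evenPart (t • v)) n < zPlus p (evenPart (t • v)) n := by
    rw [eventually_all_finset]
    intro n hn
    have hn' := Finset.mem_range.1 hn
    by_contra hc
    have hc' : ∃ᶠ t in 𝓝[>] (0 : ℝ), 1 ≤ n ∧
        zPlus p (evenPart (t • v)) n ≤ zMinus p (evenPart (t • v)) n := by
      rw [not_eventually] at hc
      exact hc.mono fun t ht => by simpa using ht
    have hn1 : 1 ≤ n := hc'.exists.choose_spec.1
    have hprim := Complex.isPrimitiveRoot_exp p hp.ne'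
    have h0 := sum_eq_zero_of_frequently_closed hq hQ hn1 (by omega)
      (hc'.mono fun t ht => ht.2)
    simp only [pow_mul _ (p - n)] at h0
    have hω : (Complex.exp (2 * Real.pi * Complex.I / p) ^ (p - n)) ^ p = 1 := by
      rw [← pow_mul, mul_comm _ p, pow_mul, hprim.pow_eq_one, one_pow]
    rw [sum_range_shift hq hω, mul_eq_zero, or_iff_right two_ne_zero, mul_eq_zero,
      or_iff_right (pow_ne_zero _ (Complex.exp_ne_zero _)), ← Fin.sum_univ_eq_sum_range
        (fun j => (evenPart v (j + 1) : ℂ) *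
          (Complex.exp (2 * Real.pi * Complex.I / p) ^ (p - n)) ^ j)] at h0
    refine sum_ne_zero_of_mem_Xi hΞ hn1 (by omega) ?_
    simp only [pow_mul _ (p - n)]
    exact h0
  obtain ⟨t₀, ht₀, h⟩ := mem_nhdsGT_iff_exists_Ioo_subset.1 key
  exact ⟨t₀, ht₀, fun t h1 h2 n hn hn' => h ⟨h1, h2⟩ n (Finset.mem_range.2 (by omega)) hn⟩

end OpenGaps

end Armchair

end


noncomputable section

set_option linter.unusedSectionVars false

namespace Armchair

/-! ## The spectrum in the windows -/

section Main

variable {N p : ℕ} [NeZero N] [NeZero p] {v : Potential}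

theorem abs_evenPart_le (v : Potential) (n : ℤ) : |evenPart v n| ≤ ‖v‖ :=
  lp.norm_apply_le_norm (by simp) v (2 * n)

theorem cos_pi_div_nonneg (hN : 4 < 2 * N) (hp : 2 * N < p) : 0 ≤ Real.cos (Real.pi / N) := by
  have h3 := (real_params hN hp).1
  have hπ := Real.pi_pos
  have h0 : 0 ≤ Real.pi / N := by positivity
  exact Real.cos_nonneg_of_mem_Icc ⟨by linarith,
    div_le_div_of_nonneg_left hπ.le two_pos (by linarith)⟩

/-- The model is used with centre `0`: the zero-mean part is bounded below there by `sin (π/N) -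
‖v‖`, more than the radius of the window. -/
theorem center_window (hN : 4 < 2 * N) (hp : 2 * N < p)
    (hv : ∀ n : ℤ, v (2 * n) = v (2 * n + 1)) (hper : ∀ n : ℤ, v (n + 2 * p) = v n)
    {m₁ m₂ : ℝ}
    (h₁ : IsWindow p 1 (rMinus N p) (rPlus N p) m₁ {n | |(n : ℝ) - p / 3| ≤ p / (2 * N)})
    (h₂ : IsWindow p (-1) (rMinus N p) (rPlus N p) m₂ {n | |(n : ℝ) - 2 * p / 3| ≤ p / (2 * N)})
    (hm₁ : ‖v‖ ≤ m₁) (hm₂ : ‖v‖ ≤ m₂)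
    (hv0 : ‖v‖ < Real.sin (Real.pi / N) - max |rMinus N p| |rPlus N p|) :
    (spectrum ℝ (hamiltonian N v) ∩ Set.Icc (rMinus N p) (rPlus N p) =
      centerFirst N p (evenPart v) ∪ centerSecond N p (evenPart v)) ∧
    HasMultiplicity (hamiltonian N v)
      (symmDiff (centerFirst N p (evenPart v)) (centerSecond N p (evenPart v))) 2 ∧
    HasMultiplicity (hamiltonian N v)
      (centerFirst N p (evenPart v) ∩ centerSecond N p (evenPart v)) 4 := by
  have e₁ : centerFirst N p (evenPart v) = Set.Icc (rMinus N p) (rPlus N p) ∩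
      closure (bandSet p fun n => evenPart v n + 1) :=
    (closure_bandSet_inter_Icc (evenPart_periodic hper)
      (fun n => (abs_evenPart_le v n).trans hm₁) h₁).symm
  have e₂ : centerSecond N p (evenPart v) = Set.Icc (rMinus N p) (rPlus N p) ∩
      closure (bandSet p fun n => evenPart v n + -1) :=
    (closure_bandSet_inter_Icc (evenPart_periodic hper)
      (fun n => (abs_evenPart_le v n).trans hm₂) h₂).symm
  have hc : 0 ≤ Real.cos (Real.pi / N) := cos_pi_div_nonneg hN hp
  set M := armchairModel N hv hper
  have hs : ∀ f ∈ M.rest, (Real.sin (Real.pi / N) - ‖v‖) * ‖f‖ ≤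
      ‖hamiltonian N v f - ((0 : ℝ) : ℂ) • f‖ := fun f hf => by
    rw [Complex.ofReal_zero, zero_smul, sub_zero]
    exact norm_hamiltonian_ge v hf hc
  have hK : Set.Icc (rMinus N p) (rPlus N p) ⊆
      Metric.closedBall 0 (max |rMinus N p| |rPlus N p|) := fun x hx => by
    rw [mem_closedBall_zero_iff]
    exact abs_le_max_abs_abs hx.1 hx.2
  have hρ : max |rMinus N p| |rPlus N p| < Real.sin (Real.pi / N) - ‖v‖ := by linarith
  have hρ0 : 0 ≤ max |rMinus N p| |rPlus N p| := le_max_of_le_left (abs_nonneg _)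
  rw [e₁, e₂]
  refine ⟨?_, M.hasMultiplicity_two hs hρ hρ0 hK measurableSet_Icc,
    M.hasMultiplicity_four hs hρ hρ0 hK measurableSet_Icc⟩
  refine (M.spectrum_inter hs hρ hK).trans ?_
  rw [Set.inter_comm, Set.inter_union_distrib_left]

theorem norm_sub_smul_zeroMean_ge (hN : 4 < 2 * N) (hp : 2 * N < p) (v : Potential) {c r : ℝ}
    (hc : |c| = r) {f : L2 (Vertex N)} (hf : f ∈ zeroMean N) :
    (r - (√(5 + 4 * Real.cos (Real.pi / N)) + ‖v‖)) * ‖f‖ ≤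
      ‖hamiltonian N v f - (c : ℂ) • f‖ := by
  have hcos : 0 ≤ Real.cos (Real.pi / N) := cos_pi_div_nonneg hN hp
  have h1 := norm_hamiltonian_le v hf hcos
  have h2 := norm_sub_norm_le ((c : ℂ) • f) (hamiltonian N v f)
  rw [norm_smul, Complex.norm_real, Real.norm_eq_abs, hc, norm_sub_rev] at h2
  linarith

/-- The centre is now the far end `rTildePlus`, from which the zero-mean part, bounded by `√(5 + 4
cos (π/N)) + ‖v‖`, is farther than any point of the window. The bands of `J - 1` end below `1 +
‖v‖`, so only one copy is seen. -/
theorem edgeUpper_window (hN : 4 < 2 * N) (hp : 2 * N < p)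
    (hv : ∀ n : ℤ, v (2 * n) = v (2 * n + 1)) (hper : ∀ n : ℤ, v (n + 2 * p) = v n) {m : ℝ}
    (h : IsWindow p 1 (rTildeMinus N p) (rTildePlus p) m
      {n | (p : ℝ) - p / (2 * N) - 1 / (6 * Real.pi) ≤ n})
    (hm : ‖v‖ ≤ m) (hv1 : ‖v‖ < rTildeMinus N p - 1)
    (hv0 : ‖v‖ < rTildeMinus N p - √(5 + 4 * Real.cos (Real.pi / N))) :
    (spectrum ℝ (hamiltonian N v) ∩ Set.Icc (rTildeMinus N p) (rTildePlus p) =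
      edgeUpper N p (evenPart v)) ∧
    HasMultiplicity (hamiltonian N v) (edgeUpper N p (evenPart v)) 2 := by
  obtain ⟨-, f2, f3⟩ := edge_facts hN hp
  have e₁ : edgeUpper N p (evenPart v) = Set.Icc (rTildeMinus N p) (rTildePlus p) ∩
      closure (bandSet p fun n => evenPart v n + 1) :=
    (closure_bandSet_inter_Icc (evenPart_periodic hper)
      (fun n => (abs_evenPart_le v n).trans hm) h).symm
  have e₂ : Set.Icc (rTildeMinus N p) (rTildePlus p) ∩
      closure (bandSet p fun n => evenPart v n + -1) = ∅ := by
    rw [Set.eq_empty_iff_forall_notMem]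
    rintro x ⟨hx, hx'⟩
    have := (closure_bandSet_subset (evenPart_periodic hper) (abs_evenPart_le v) hx').2
    linarith [hx.1]
  set M := armchairModel N hv hper
  have hs : ∀ f ∈ M.rest, (rTildePlus p - (√(5 + 4 * Real.cos (Real.pi / N)) + ‖v‖)) * ‖f‖ ≤
      ‖hamiltonian N v f - ((rTildePlus p : ℝ) : ℂ) • f‖ := fun f hf =>
    norm_sub_smul_zeroMean_ge hN hp v (abs_of_pos (by linarith)) hf
  have hρ : rTildePlus p - rTildeMinus N p <
      rTildePlus p - (√(5 + 4 * Real.cos (Real.pi / N)) + ‖v‖) := by linarith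
  have hK : Set.Icc (rTildeMinus N p) (rTildePlus p) ⊆
      Metric.closedBall (rTildePlus p) (rTildePlus p - rTildeMinus N p) := fun x hx => by
    rw [Metric.mem_closedBall, Real.dist_eq, abs_le]
    constructor <;> linarith [hx.1, hx.2]
  have hmult := M.hasMultiplicity_two hs hρ (by linarith) hK measurableSet_Icc
  rw [e₂, ← Set.bot_eq_empty, symmDiff_bot] at hmult
  rw [e₁]
  refine ⟨?_, hmult⟩
  refine (M.spectrum_inter hs hρ hK).trans ?_
  rw [Set.inter_comm, Set.inter_union_distrib_left, e₂, Set.union_empty]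

theorem edgeLower_window (hN : 4 < 2 * N) (hp : 2 * N < p)
    (hv : ∀ n : ℤ, v (2 * n) = v (2 * n + 1)) (hper : ∀ n : ℤ, v (n + 2 * p) = v n) {m : ℝ}
    (h : IsWindow p (-1) (-rTildePlus p) (-rTildeMinus N p) m
      {n | (n : ℝ) ≤ p / (2 * N) + 1 / (6 * Real.pi)})
    (hm : ‖v‖ ≤ m) (hv1 : ‖v‖ < rTildeMinus N p - 1)
    (hv0 : ‖v‖ < rTildeMinus N p - √(5 + 4 * Real.cos (Real.pi / N))) :
    (spectrum ℝ (hamiltonian N v) ∩ Set.Icc (-rTildePlus p) (-rTildeMinus N p) =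
      edgeLower N p (evenPart v)) ∧
    HasMultiplicity (hamiltonian N v) (edgeLower N p (evenPart v)) 2 := by
  obtain ⟨-, f2, f3⟩ := edge_facts hN hp
  have e₂ : edgeLower N p (evenPart v) = Set.Icc (-rTildePlus p) (-rTildeMinus N p) ∩
      closure (bandSet p fun n => evenPart v n + -1) :=
    (closure_bandSet_inter_Icc (evenPart_periodic hper)
      (fun n => (abs_evenPart_le v n).trans hm) h).symm
  have e₁ : Set.Icc (-rTildePlus p) (-rTildeMinus N p) ∩
      closure (bandSet p fun n => evenPart v n + 1) = ∅ := by
    rw [Set.eq_empty_iff_forall_notMem]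
    rintro x ⟨hx, hx'⟩
    have := (closure_bandSet_subset (evenPart_periodic hper) (abs_evenPart_le v) hx').1
    linarith [hx.2]
  set M := armchairModel N hv hper
  have hs : ∀ f ∈ M.rest, (rTildePlus p - (√(5 + 4 * Real.cos (Real.pi / N)) + ‖v‖)) * ‖f‖ ≤
      ‖hamiltonian N v f - ((-rTildePlus p : ℝ) : ℂ) • f‖ := fun f hf =>
    norm_sub_smul_zeroMean_ge hN hp v (by rw [abs_neg, abs_of_pos (by linarith)]) hf
  have hρ : rTildePlus p - rTildeMinus N p <
      rTildePlus p - (√(5 + 4 * Real.cos (Real.pi / N)) + ‖v‖) := by linarith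
  have hK : Set.Icc (-rTildePlus p) (-rTildeMinus N p) ⊆
      Metric.closedBall (-rTildePlus p) (rTildePlus p - rTildeMinus N p) := fun x hx => by
    rw [Metric.mem_closedBall, Real.dist_eq, abs_le]
    constructor <;> linarith [hx.1, hx.2]
  have hmult := M.hasMultiplicity_two hs hρ (by linarith) hK measurableSet_Icc
  rw [e₁, ← Set.bot_eq_empty, bot_symmDiff] at hmult
  rw [e₂]
  refine ⟨?_, hmult⟩
  refine (M.spectrum_inter hs hρ hK).trans ?_
  rw [Set.inter_comm, Set.inter_union_distrib_left, e₁, Set.empty_union]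

end Main

end Armchair

end

/-! ### Assembly of the windows -/

theorem theorem5p4 (N p : ℕ) (hN : 4 < 2 * N) (hp : 2 * N < p) :
    (∃ δ : ℝ, 0 < δ ∧ ∀ v : Armchair.Potential,
      (∀ n : ℤ, v (2 * n) = v (2 * n + 1)) → (∀ n : ℤ, v (n + 2 * p) = v n) → ‖v‖ < δ →
        (spectrum ℝ (Armchair.hamiltonian N v) ∩
            Set.Icc (Armchair.rMinus N p) (Armchair.rPlus N p) =
          Armchair.centerFirst N p (Armchair.evenPart v) ∪
            Armchair.centerSecond N p (Armchair.evenPart v)) ∧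
        -- the two sets of the union contribute multiplicity 2 each
        Armchair.HasMultiplicity (Armchair.hamiltonian N v)
          (symmDiff (Armchair.centerFirst N p (Armchair.evenPart v))
            (Armchair.centerSecond N p (Armchair.evenPart v))) 2 ∧
        Armchair.HasMultiplicity (Armchair.hamiltonian N v)
          (Armchair.centerFirst N p (Armchair.evenPart v) ∩
            Armchair.centerSecond N p (Armchair.evenPart v)) (2 + 2) ∧
        (spectrum ℝ (Armchair.hamiltonian N v) ∩
            Set.Icc (-Armchair.rTildePlus p) (-Armchair.rTildeMinus N p) =
          Armchair.edgeLower N p (Armchair.evenPart v)) ∧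
        Armchair.HasMultiplicity (Armchair.hamiltonian N v)
          (Armchair.edgeLower N p (Armchair.evenPart v)) 2 ∧
        (spectrum ℝ (Armchair.hamiltonian N v) ∩
            Set.Icc (Armchair.rTildeMinus N p) (Armchair.rTildePlus p) =
          Armchair.edgeUpper N p (Armchair.evenPart v)) ∧
        Armchair.HasMultiplicity (Armchair.hamiltonian N v)
          (Armchair.edgeUpper N p (Armchair.evenPart v)) 2) ∧
    (∀ v : Armchair.Potential,
      (∀ n : ℤ, v (2 * n) = v (2 * n + 1)) → (∀ n : ℤ, v (n + 2 * p) = v n) →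
      Armchair.evenVector p v ∈ Armchair.Xi p →
        ∃ t₀ : ℝ, 0 < t₀ ∧ ∀ t : ℝ, 0 < t → t < t₀ → ∀ n : ℕ, 1 ≤ n → n ≤ p - 1 →
          Armchair.zMinus p (Armchair.evenPart (t • v)) n <
            Armchair.zPlus p (Armchair.evenPart (t • v)) n) := by
  have : NeZero N := ⟨by omega⟩
  have : NeZero p := ⟨by omega⟩
  refine ⟨?_, fun v _ hper hΞ => Armchair.exists_gaps_open hper hΞ⟩
  obtain ⟨m₁, hm₁, h₁⟩ := Armchair.isWindow_centerFirst hN hp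
  obtain ⟨m₂, hm₂, h₂⟩ := Armchair.isWindow_centerSecond hN hp
  obtain ⟨m₃, hm₃, h₃⟩ := Armchair.isWindow_edgeLower hN hp
  obtain ⟨m₄, hm₄, h₄⟩ := Armchair.isWindow_edgeUpper hN hp
  have h₅ := sub_pos.2 (Armchair.center_lt_sin hN hp)
  have h₆ := sub_pos.2 (Armchair.sqrt_lt_rTildeMinus hN hp)
  have h₇ := sub_pos.2 (Armchair.edge_facts hN hp).2.1
  -- `δ` is the least of seven margins: four for the gap edges near the windows, two separating the
  -- windows from the zero-mean part, and one separating the outer windows from the other copy of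
  -- `J`.
  refine ⟨_, lt_min hm₁ (lt_min hm₂ (lt_min hm₃ (lt_min hm₄ (lt_min h₅ (lt_min h₆ h₇))))),
    fun v hv hper hδ => ?_⟩
  simp only [lt_min_iff] at hδ
  obtain ⟨d₁, d₂, d₃, d₄, d₅, d₆, d₇⟩ := hδ
  obtain ⟨c₁, c₂, c₃⟩ := Armchair.center_window hN hp hv hper h₁ h₂ d₁.le d₂.le d₅
  obtain ⟨l₁, l₂⟩ := Armchair.edgeLower_window hN hp hv hper h₃ d₃.le d₇ d₆
  obtain ⟨u₁, u₂⟩ := Armchair.edgeUpper_window hN hp hv hper h₄ d₄.le d₇ d₆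
  exact ⟨c₁, c₂, c₃, l₁, l₂, u₁, u₂⟩
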